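/- Conventions. Let $R=\mathbb Z[c]$, graded by $\deg c=2$; for a graded module $N$ put $N\{n\}_j=N_{j+n}$. Let $A$ be the free graded $R$-module with basis $\mathbf 1,X$, $\deg\mathbf 1=1$, $\deg X=-1$, with multiplication $m$ given by the unit $\mathbf 1$ and $X^2=0$, and comultiplication $\Delta(\mathbf 1)=\mathbf 1\otimes X+X\otimes\mathbf 1+c\,X\otimes X$, $\Delta(X)=X\otimes X$. For a plane diagram $D$ of an oriented link, with ordered set $\mathcal I$ of crossings, of which $x(D)$ are negative and $y(D)$ positive, and for $L\subseteq\mathcal I$, let $D(L)$ be the union of circles obtained by taking the $1$-resolution at the crossings in $L$ and the $0$-resolution at the others (the resolution compatible with the orientation is the $1$-resolution at a negative crossing and the $0$-resolution at a positive one), and let $V_D(L)=A^{\otimes\{\text{circles of }D(L)\}}\{-|L|\}$. Let $\overline C^i(D)=\bigoplus_{|L|=i}V_D(L)$, with differential the sum, over $a\notin L$, of $(-1)^{\#\{b\in L:\,b>a\}}$ times the map $V_D(L)\to V_D(L\cup\{a\})$ given by $m$ if two circles merge at $a$ and by $\Delta$ if one circle splits at $a$ (and by the identity on the other circles). Put $C(D)=\overline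 C(D)[x(D)]\{2x(D)-y(D)\}$, where $C[n]^i=C^{i+n}$ with differential multiplied by $(-1)^n$. Let $H^i(D)$ be the $i$-th cohomology of $C(D)$, and let $\mathcal H^{i,j}(D)$ be the $i$-th cohomology group of the degree $j$ part of the complex obtained in the same way with $\mathbb Z$ (in degree $0$) in place of $R$ and $c=0$. For $k\ge 1$ let $T_{2,k}$ be the $(2,k)$ torus link given by its standard diagram: the closure of the two-strand braid with $k$ crossings, both strands oriented in parallel and all $k$ crossings negative (so $x=k$, $y=0$, and $T_{2,3}$ is the left-handed trefoil). **Proposition.** (1) Let $k\ge1$. The above is a complex of graded $R$-modules (the differential squares to zero and preserves the grading), and there are isomorphisms of graded $R$-modules $$\begin{aligned} H^i(T_{2,k})&=0 &&\text{for } i<-k \text{ and } i>0,\\ H^0(T_{2,k})&\cong R\{k\}\oplus R\{k-2\},\\ H^{-1}(T_{2,k})&=0,\\ H^{-2j}(T_{2,k})&\cong (R/2R)\{4j+k\}\oplus R\{4j-2+k\} &&\text{for } 1\le j\le\tfrac{k-1}{2},\ j\in\mathbb Z,\\ H^{-2j-1}(T_{2,k})&\cong R\{4j+2+k\} &&\text{for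 } 1\le j\le\tfrac{k-1}{2},\ j\in\mathbb Z,\\ H^{-k}(T_{2,k})&\cong R\{3k\}\oplus R\{3k-2\} &&\text{for even } k. \end{aligned}$$ (2) Let $k>1$. The version over $\mathbb Z$ with $c=0$ is a complex of graded abelian groups, and $$\begin{aligned} \mathcal H^{0,-k}(T_{2,k})&\cong\mathbb Z,\qquad \mathcal H^{0,2-k}(T_{2,k})\cong\mathbb Z,\\ \mathcal H^{-2j-1,-4j-2-k}(T_{2,k})&\cong\mathbb Z &&\text{for } 1\le j\le\tfrac{k-1}{2},\ j\in\mathbb Z,\\ \mathcal H^{-2j,-4j-k}(T_{2,k})&\cong\mathbb Z/2 &&\text{for } 1\le j\le\tfrac{k-1}{2},\ j\in\mathbb Z,\\ \mathcal H^{-2j,-4j+2-k}(T_{2,k})&\cong\mathbb Z &&\text{for } 1\le j\le\tfrac{k-1}{2},\ j\in\mathbb Z,\\ \mathcal H^{-k,-3k}(T_{2,k})&\cong\mathbb Z,\qquad \mathcal H^{-k,2-3k}(T_{2,k})\cong\mathbb Z &&\text{for even } k,\\ \mathcal H^{i,j}(T_{2,k})&=0 &&\text{for all other } i,j\in\mathbb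 Z. \end{aligned}$$ -/

import Mathlib

noncomputable section

namespace Khovanov

/-! ### Plane diagrams -/

/-- A plane diagram of an oriented link, as an oriented planar-diagram code.
The crossings are `0, …, n - 1`.  `arc c 0, arc c 1, arc c 2, arc c 3` are the arcs of the diagram
at the four ends of the crossing `c`, in counterclockwise order, where the end `0` is the one at
which the lower strand enters `c` (so it leaves at the end `2`).
If `neg c` is true, the upper strand enters at the end `1` and leaves at the end `3`;
otherwise it enters at `3` and leaves at `1`.
An arc without ends is a closed curve that meets no crossing. -/
structure PlaneDiagram where
  n : ℕ
  Arc : Type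
  finiteArc : Finite Arc
  arc : Fin n → Fin 4 → Arc
  neg : Fin n → Bool
  /-- an arc enters a crossing in at most one place -/
  injective_in : Function.Injective
    (fun p : Fin n × Bool => arc p.1 (if p.2 then 0 else if neg p.1 then 1 else 3))
  /-- an arc leaves a crossing in at most one place -/
  injective_out : Function.Injective
    (fun p : Fin n × Bool => arc p.1 (if p.2 then 2 else if neg p.1 then 3 else 1))
  /-- an arc enters a crossing if and only if it leaves one -/
  range_in_eq_range_out :
    Set.range (fun p : Fin n × Bool => arc p.1 (if p.2 then 0 else if neg p.1 then 1 else 3)) =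
    Set.range (fun p : Fin n × Bool => arc p.1 (if p.2 then 2 else if neg p.1 then 3 else 1))
  /-- Planarity, by Euler's formula `V - E + F = 2 · #components` with `V = n` and `E = 2 n`.
  The corner `(c, i)` is the one between the ends `i` and `i + 1` of the crossing `c`; a face is
  a class of corners under the relation of being adjacent along the same side of an arc. -/
  planar :
    Nat.card (Quot (fun p q : Fin n × Fin 4 => ∃ r : Fin n × Fin 4,
      p ≠ r ∧ arc p.1 p.2 = arc r.1 r.2 ∧ q = (r.1, r.2 - 1))) =
    n + 2 * Nat.card (Quot (fun c d : Fin n => ∃ i j, arc c i = arc d j))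

namespace PlaneDiagram

variable (D : PlaneDiagram)

/-- `x(D)`: the number of negative crossings. -/
def x : ℕ := (Finset.univ.filter fun c => D.neg c = true).card

/-- `y(D)`: the number of positive crossings. -/
def y : ℕ := (Finset.univ.filter fun c => D.neg c = false).card

/-- How the arcs are joined at the crossings in the resolution `D(L)`: at a crossing outside `L`
(`0`-resolution) the end `0` is joined to `1` and `2` to `3`; at a crossing in `L`
(`1`-resolution) the end `0` is joined to `3` and `1` to `2`. -/
def Joined (L : Finset (Fin D.n)) (u v : D.Arc) : Prop :=
  ∃ c, (c ∉ L ∧ ((u = D.arc c 0 ∧ v = D.arc c 1) ∨ (u = D.arc c 2 ∧ v = D.arc c 3))) ∨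
    (c ∈ L ∧ ((u = D.arc c 0 ∧ v = D.arc c 3) ∨ (u = D.arc c 1 ∧ v = D.arc c 2)))

/-- The circles of the resolution `D(L)`. -/
def Circles (L : Finset (Fin D.n)) : Type := Quot (D.Joined L)

/-- The circle of `D(L)` through a given arc. -/
def circle (L : Finset (Fin D.n)) (u : D.Arc) : D.Circles L := Quot.mk _ u

instance (L : Finset (Fin D.n)) : Finite (D.Circles L) :=
  haveI := D.finiteArc
  inferInstanceAs (Finite (Quot (D.Joined L)))

instance (L : Finset (Fin D.n)) : Fintype (D.Circles L) := Fintype.ofFinite _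

instance (L : Finset (Fin D.n)) : DecidableEq (D.Circles L) := Classical.decEq _

end PlaneDiagram

/-- The arcs of the diagram of `T_{2,k}`: `(t, 0)` and `(t, 1)` are the left and the right strand
coming into the crossing `t` from below, and `t + 1` is taken modulo `k`. -/
def torusArc (k : ℕ) (t : Fin k) : Fin 4 → Fin k × Fin 2 :=
  ![(t, 0), (t, 1), (finRotate k t, 1), (finRotate k t, 0)]

theorem chain_eq {k : ℕ} {α : Type} (f : Fin k → α) (hf : ∀ t, f (finRotate k t) = f t)
    (s t : Fin k) : f s = f t := by
  cases k with
  | zero => exact s.elim0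
  | succ m =>
    have key : ∀ (n : ℕ) (hn : n < m + 1), f ⟨n, hn⟩ = f 0 := by
      intro n
      induction n with
      | zero => intro hn; rfl
      | succ n ih =>
        intro hn
        rw [← ih (by omega), ← hf ⟨n, by omega⟩, finRotate_of_lt (by omega : n < m)]
    rw [key s s.2, key t t.2]

theorem torus_planar (k : ℕ) (hk : 0 < k) :
    Nat.card (Quot (fun p q : Fin k × Fin 4 => ∃ r : Fin k × Fin 4,
      p ≠ r ∧ torusArc k p.1 p.2 = torusArc k r.1 r.2 ∧ q = (r.1, r.2 - 1))) =
    k + 2 * Nat.card (Quot (fun c d : Fin k => ∃ i j, torusArc k c i = torusArc k d j)) := by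
  have h1 : Nat.card (Quot (fun c d : Fin k => ∃ i j, torusArc k c i = torusArc k d j)) = 1 := by
    rw [Nat.card_eq_one_iff_unique]
    refine ⟨⟨?_⟩, ⟨Quot.mk _ ⟨0, hk⟩⟩⟩
    rintro ⟨s⟩ ⟨t⟩
    exact chain_eq (fun t => Quot.mk _ t)
      (fun t => Quot.sound ⟨0, 3, by simp [torusArc]⟩) s t
  have h2 : Nat.card (Quot (fun p q : Fin k × Fin 4 => ∃ r : Fin k × Fin 4,
      p ≠ r ∧ torusArc k p.1 p.2 = torusArc k r.1 r.2 ∧ q = (r.1, r.2 - 1))) =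
      Nat.card (Fin k ⊕ Fin 2) := by
    set rel := (fun p q : Fin k × Fin 4 => ∃ r : Fin k × Fin 4,
      p ≠ r ∧ torusArc k p.1 p.2 = torusArc k r.1 r.2 ∧ q = (r.1, r.2 - 1)) with hrel
    have e1 : ∀ t, Quot.mk rel (finRotate k t, 1) = Quot.mk rel (t, 1) := fun t =>
      Quot.sound ⟨(t, 2), by simp, by simp [torusArc], rfl⟩
    have e3 : ∀ t, Quot.mk rel (finRotate k t, 3) = Quot.mk rel (t, 3) := fun t =>
      (Quot.sound ⟨(finRotate k t, 0), by simp, by simp [torusArc], rfl⟩ :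
        Quot.mk rel (t, 3) = Quot.mk rel (finRotate k t, 3)).symm
    have e2 : ∀ t, Quot.mk rel (finRotate k t, 0) = Quot.mk rel (t, 2) := fun t =>
      Quot.sound ⟨(t, 3), by simp, by simp [torusArc], rfl⟩
    refine Nat.card_congr
      { toFun := Quot.lift (fun p => (![Sum.inl p.1, Sum.inr 0, Sum.inl (finRotate k p.1),
            Sum.inr 1] : Fin 4 → Fin k ⊕ Fin 2) p.2) ?_
        invFun := Sum.elim (fun t => Quot.mk _ (t, 0))
          ![Quot.mk _ (⟨0, hk⟩, 1), Quot.mk _ (⟨0, hk⟩, 3)]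
        left_inv := ?_
        right_inv := ?_ }
    · rintro ⟨t, i⟩ ⟨s', j'⟩ ⟨⟨s, j⟩, hne, harc, hq⟩
      obtain ⟨rfl, rfl⟩ := Prod.mk.inj hq
      fin_cases i <;> fin_cases j <;> simp_all [torusArc]
    · rintro ⟨t, i⟩
      fin_cases i
      · rfl
      · exact chain_eq (fun t => Quot.mk rel (t, 1)) e1 ⟨0, hk⟩ t
      · exact e2 t
      · exact chain_eq (fun t => Quot.mk rel (t, 3)) e3 ⟨0, hk⟩ t
    · rintro (t | i)
      · rfl
      · fin_cases i <;> rfl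
  rw [h1, h2]
  simp

/-- The standard diagram of the torus link `T_{2,k}`: the closure of the braid on two upward
strands with `k` crossings, all of them negative (so `T_{2,3}` is the left-handed trefoil). -/
def torusDiagram (k : ℕ) (hk : 0 < k) : PlaneDiagram where
  n := k
  Arc := Fin k × Fin 2
  finiteArc := inferInstance
  arc := torusArc k
  neg _ := true
  injective_in := by
    rintro ⟨s, _ | _⟩ ⟨t, _ | _⟩ h <;> simp_all [torusArc]
  injective_out := by
    rintro ⟨s, _ | _⟩ ⟨t, _ | _⟩ h <;> simp_all [torusArc]
  range_in_eq_range_out := by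
    ext ⟨t, i⟩
    obtain ⟨s, rfl⟩ := (finRotate k).surjective t
    constructor
    · intro _
      fin_cases i
      · exact ⟨(s, false), by simp [torusArc]⟩
      · exact ⟨(s, true), by simp [torusArc]⟩
    · intro _
      fin_cases i
      · exact ⟨(finRotate k s, true), by simp [torusArc]⟩
      · exact ⟨(finRotate k s, false), by simp [torusArc]⟩
  planar := torus_planar k hk

/-! ### The algebra `A` -/

/-- The basis `{𝟏, X}` of `A`. -/
inductive Lab
  | one
  | X
deriving DecidableEq

instance : Fintype Lab := ⟨{.one, .X}, fun u => by cases u <;> simp⟩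

/-- `deg 𝟏 = 1`, `deg X = -1`. -/
def Lab.deg : Lab → ℤ
  | .one => 1
  | .X => -1

/-- `mulCoeff K u v w` is the coefficient of `w` in `u v`:
`𝟏 𝟏 = 𝟏`, `𝟏 X = X 𝟏 = X`, `X X = 0`. -/
def mulCoeff (K : Type) [CommRing K] : Lab → Lab → Lab → K
  | .one, .one, .one => 1
  | .one, .X, .X => 1
  | .X, .one, .X => 1
  | _, _, _ => 0

/-- `comulCoeff c u v w` is the coefficient of `v ⊗ w` in `Δ u`:
`Δ 𝟏 = 𝟏 ⊗ X + X ⊗ 𝟏 + c X ⊗ X`, `Δ X = X ⊗ X`. -/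
def comulCoeff {K : Type} [CommRing K] (c : K) : Lab → Lab → Lab → K
  | .one, .one, .X => 1
  | .one, .X, .one => 1
  | .one, .X, .X => c
  | .X, .X, .X => 1
  | _, _, _ => 0

/-! ### The complex of a diagram

`K` is the ground ring, `c : K` the parameter in the comultiplication, and `𝒢` the grading
of `K`. -/

namespace PlaneDiagram

variable {K : Type} [CommRing K] (D : PlaneDiagram) (c : K) (𝒢 : ℤ → AddSubgroup K)

/-- `F(D(L))`, the tensor power of `A` with one factor for each circle of `D(L)`, written in its
basis of pure tensors of the elements `𝟏` and `X`: the labelings of the circles. -/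
abbrev V (K : Type) (D : PlaneDiagram) (L : Finset (Fin D.n)) : Type :=
  (D.Circles L → Lab) → K

open Classical in
/-- The matrix coefficient of `F(S) : F(D(L)) → F(D(L'))`, `L' = L ∪ {a}`, where `S` is the
cobordism with a saddle at `a`.  It is the identity on the circles that do not pass through `a`;
at `a` it is the multiplication if two different circles of `D(L)` merge into one, and the
comultiplication if one circle of `D(L)` splits into two. -/
def saddleCoeff (a : Fin D.n) (L L' : Finset (Fin D.n))
    (σ : D.Circles L → Lab) (τ : D.Circles L' → Lab) : K :=
  let p := D.circle L (D.arc a 0)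
  let q := D.circle L (D.arc a 2)
  let p' := D.circle L' (D.arc a 0)
  let q' := D.circle L' (D.arc a 2)
  if ∀ u, D.circle L u ≠ p → D.circle L u ≠ q → σ (D.circle L u) = τ (D.circle L' u) then
    if p ≠ q ∧ p' = q' then mulCoeff K (σ p) (σ q) (τ p')
    else if p = q ∧ p' ≠ q' then comulCoeff c (σ p) (τ p') (τ q')
    else 0
  else 0

/-- The structure map `ξ_a : F(D(L)) → F(D(L'))` for `L' = L ∪ {a}`. -/
def xi (a : Fin D.n) (L L' : Finset (Fin D.n)) : V K D L →ₗ[K] V K D L' where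
  toFun v τ := ∑ σ, v σ * D.saddleCoeff c a L L' σ τ
  map_add' v w := by ext τ; simp [add_mul, Finset.sum_add_distrib]
  map_smul' r v := by ext τ; simp [Finset.mul_sum, mul_assoc]

/-- The canonical map `E(L) → E(L ∪ {a})`, which appends `a` to an ordering of `L`, takes the
increasing ordering of `L` to this sign times the increasing ordering of `L ∪ {a}`. -/
def edgeSign (a : Fin D.n) (L : Finset (Fin D.n)) : ℤ :=
  (-1) ^ (L.filter fun b => a < b).card

/-- `C^i(D)` is the direct sum of the `V_D(L)` with `|L| = i + x(D)`: the shift `[x(D)]` is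
included, the shifts of the grading are in `stateDeg`. -/
abbrev Chain (K : Type) (D : PlaneDiagram) (i : ℤ) : Type :=
  (L : {L : Finset (Fin D.n) // (L.card : ℤ) = i + D.x}) → V K D L.1

theorem card_erase_eq {D : PlaneDiagram} {i i' : ℤ} (h : i + 1 = i') {L : Finset (Fin D.n)}
    (hL : (L.card : ℤ) = i' + D.x) {a : Fin D.n} (ha : a ∈ L) :
    ((L.erase a).card : ℤ) = i + D.x := by
  have := Finset.card_erase_add_one ha
  omega

/-- The differential `C^i(D) → C^{i'}(D)`, `i' = i + 1`, of `C(D)`. -/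
def d (i i' : ℤ) (h : i + 1 = i') : Chain K D i →ₗ[K] Chain K D i' :=
  LinearMap.pi fun L' =>
    ∑ a : {a // a ∈ L'.1}, ((-1 : ℤ) ^ D.x * D.edgeSign a.1 (L'.1.erase a.1)) •
      (D.xi c a.1 (L'.1.erase a.1) L'.1 ∘ₗ
        LinearMap.proj (⟨L'.1.erase a.1, card_erase_eq h L'.2 a.2⟩ :
          {L : Finset (Fin D.n) // (L.card : ℤ) = i + D.x}))

/-- The degree of a pure tensor of basis elements in `C(D)`: the sum of the degrees of the
factors, raised by `|L|` and lowered by `2 x(D) - y(D)`. -/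
def stateDeg (L : Finset (Fin D.n)) (σ : D.Circles L → Lab) : ℤ :=
  (∑ s, (σ s).deg) + L.card - (2 * D.x - D.y)

/-- `C^i_j(D)`: the homogeneous elements of degree `j` in `C^i(D)`. -/
def chainGr (i j : ℤ) : AddSubgroup (Chain K D i) where
  carrier := {v | ∀ L σ, v L σ ∈ 𝒢 (j - D.stateDeg L.1 σ)}
  zero_mem' L σ := (𝒢 (j - D.stateDeg L.1 σ)).zero_mem
  add_mem' hv hw L σ := (𝒢 (j - D.stateDeg L.1 σ)).add_mem (hv L σ) (hw L σ)
  neg_mem' hv L σ := (𝒢 (j - D.stateDeg L.1 σ)).neg_mem (hv L σ)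

/-- `C(D)` is a complex of graded modules. -/
def IsGradedComplex : Prop :=
  (∀ i i' i'' : ℤ, ∀ (h : i + 1 = i') (h' : i' + 1 = i''),
    D.d c i' i'' h' ∘ₗ D.d c i i' h = 0) ∧
  (∀ i i' : ℤ, ∀ (h : i + 1 = i') (j : ℤ), ∀ v ∈ D.chainGr 𝒢 i j,
    D.d c i i' h v ∈ D.chainGr 𝒢 i' j)

/-- The module of `i`-cocycles. -/
abbrev Z (i : ℤ) : Submodule K (Chain K D i) := LinearMap.ker (D.d c i (i + 1) rfl)

/-- The module of `i`-coboundaries. -/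
abbrev B (i : ℤ) : Submodule K (Chain K D i) :=
  LinearMap.range (D.d c (i - 1) i (sub_add_cancel i 1))

/-- `H^i(D)`, the `i`-th cohomology of `C(D)`. -/
abbrev H (i : ℤ) : Type := D.Z c i ⧸ (D.B c i).comap (D.Z c i).subtype

/-- The grading of `H^i(D)`: classes of homogeneous cocycles of degree `j`. -/
def HGr (i j : ℤ) : AddSubgroup (D.H c i) :=
  ((D.chainGr 𝒢 i j).comap (D.Z c i).subtype.toAddMonoidHom).map
    ((D.B c i).comap (D.Z c i).subtype).mkQ.toAddMonoidHom

/-- Cocycles of the degree `j` subcomplex. -/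
abbrev ZGr (i j : ℤ) : AddSubgroup (Chain K D i) := (D.Z c i).toAddSubgroup ⊓ D.chainGr 𝒢 i j

/-- Coboundaries of the degree `j` subcomplex. -/
abbrev BGr (i j : ℤ) : AddSubgroup (Chain K D i) :=
  (D.chainGr 𝒢 (i - 1) j).map (D.d c (i - 1) i (sub_add_cancel i 1)).toAddMonoidHom

/-- The `i`-th cohomology group of the degree `j` subcomplex of `C(D)`. -/
abbrev HDeg (i j : ℤ) : Type := D.ZGr c 𝒢 i j ⧸ (D.BGr c 𝒢 i j).addSubgroupOf (D.ZGr c 𝒢 i j)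

end PlaneDiagram

/-! ### Graded modules -/

/-- An isomorphism of graded modules: a linear equivalence that maps each graded component onto
the component of the same degree. -/
def GradedIso (K : Type) [CommRing K] {M N : Type} [AddCommGroup M] [Module K M]
    [AddCommGroup N] [Module K N] (𝒜 : ℤ → AddSubgroup M) (ℬ : ℤ → AddSubgroup N) : Prop :=
  ∃ e : M ≃ₗ[K] N, ∀ j, (𝒜 j).map e.toLinearMap.toAddMonoidHom = ℬ j

/-- The shift `{n}`: `N{n}_j = N_{j+n}`. -/
def shift {M : Type} [AddCommGroup M] (𝒜 : ℤ → AddSubgroup M) (n : ℤ) (j : ℤ) : AddSubgroup M :=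
  𝒜 (j + n)

/-- The grading of the direct sum of two graded modules. -/
def dsum {M N : Type} [AddCommGroup M] [AddCommGroup N]
    (𝒜 : ℤ → AddSubgroup M) (ℬ : ℤ → AddSubgroup N) (j : ℤ) : AddSubgroup (M × N) :=
  (𝒜 j).prod (ℬ j)

/-- `R = ℤ[c]`. -/
abbrev R : Type := Polynomial ℤ

/-- The grading of `R`, with `deg c = 2`. -/
def RGr (j : ℤ) : AddSubgroup R where
  carrier := {p | ∀ m : ℕ, p.coeff m ≠ 0 → 2 * (m : ℤ) = j}
  zero_mem' m h := by simp at h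
  add_mem' {p q} hp hq m h := by
    by_cases h1 : p.coeff m = 0
    · refine hq m fun h2 => h ?_
      simp [h1, h2]
    · exact hp m h1
  neg_mem' {p} hp m h := hp m (by simpa using h)

/-- `R/2R`. -/
abbrev RmodTwo : Type := R ⧸ Ideal.span {(2 : R)}

/-- The grading of `R/2R`. -/
def RmodTwoGr (j : ℤ) : AddSubgroup RmodTwo :=
  (RGr j).map (Ideal.Quotient.mk (Ideal.span {(2 : R)})).toAddMonoidHom

/-- The grading of `ℤ`, concentrated in degree `0`. -/
def ZGrading (j : ℤ) : AddSubgroup ℤ where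
  carrier := {z | z ≠ 0 → j = 0}
  zero_mem' h := absurd rfl h
  add_mem' {a b} ha hb h := by
    by_cases h1 : a = 0
    · exact hb fun h2 => h (by simp [h1, h2])
    · exact ha h1
  neg_mem' {a} ha h := ha (by simpa using h)

end Khovanov

end

open Khovanov

noncomputable section

namespace Khovanov

/-! Cut the closed braid at its first crossing. If that crossing is resolved horizontally, an open
chain of circles with k-1 crossings remains, and every saddle in its complex P_{k-1} is a
multiplication. If it is resolved vertically, the complex C_{k-1} of the shorter closed braid
remains. So C_k is the mapping cone of a chain map P_{k-1} → C_{k-1}, called `wrap`, which makes the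
first crossing vertical.

In the same way P_n is the cone of the multiplication A ⊗ P_{n-1} → P_{n-1}. This map is split by p
↦ 1 ⊗ p, and its kernel consists of the elements X ⊗ p - 1 ⊗ Xp, a copy of P_{n-1}. By induction the
cohomology of P_n is a single copy of A, carried by the term with all resolutions horizontal and
represented by the cycles `top α` (`path_exact`).

On these cycles, X acting on the first circle and X acting on the last circle differ by the sign
(-1)^n (`lam_top`, `rho_top`). Hence C_k reduces to a small complex A → ⋯ → A → A ⊗ A with k copies
of A. Its last map is Δ, and its map from copy s+1 to copy s is 1 + (-1)^s times X (`wrap_top_lett`,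
`cycD_gen`). The lemmas `cyc_exact` and `cyc_boundary` say that cocycles and coboundaries of C_k may
be computed there. Since Δ is injective with free cokernel of rank 2, degrees 0 and -1 follow. In
degree -s with s ≥ 2 the maps alternate between 0 and 2X, which gives A/2XA for even s < k, the span
of X for odd s, and all of A for even s = k. The parameter c enters only through Δ.

The link with the diagram is `toState`, which encodes a labelled resolution as a cyclic word;
`d_ofState` identifies the differential with (-1)^k `cycD`. For the grading, the projections onto
homogeneous components commute with the differential, so representatives and preimages can be chosen
homogeneous. The result is packaged once in `CohomologyGenerators` and then read off for both ground
rings, where 2 is not a zero divisor. -/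

/-! ### Words and the complex of a chain of circles -/

/-- A word records the resolutions of consecutive crossings of a two-strand braid: `none` is a
crossing with the vertical resolution, `some b` is a crossing with the horizontal resolution and
with the label `b` on the circle that starts above it. -/
abbrev Word : Type := List (Option Lab)

/-- The number of vertical resolutions in a word. -/
def dots : Word → ℕ
  | [] => 0
  | none :: l => dots l + 1
  | some _ :: l => dots l

section Path

variable {K : Type} [CommRing K]

/-- The sign operator `(-1)^dots`. -/
def eps (q : Lab → Word → K) (a : Lab) (l : Word) : K := (-1) ^ dots l * q a l

/-- Multiplication of the first letter by `X`. -/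
def lam (q : Lab → Word → K) : Lab → Word → K
  | .one, _ => 0
  | .X, l => q .one l

/-- Multiplication of the last letter by `X`. -/
def rho : (Lab → Word → K) → Lab → Word → K
  | q, a, [] => lam q a []
  | q, a, none :: l => rho (fun a l => q a (none :: l)) a l
  | q, a, some b :: l => rho (fun b l => q a (some b :: l)) b l

/-- Multiplication of the two first letters. -/
def merge (q : Lab → Lab → Word → K) : Lab → Word → K := q .one + lam (q .X)

/-- The differential on functions of nonempty words `a l`. -/
def pathD : (Lab → Word → K) → Lab → Word → K
  | _, _, [] => 0
  | q, a, none :: l => pathD (fun a l => q a (none :: l)) a l +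
      eps (merge fun a b l => q a (some b :: l)) a l
  | q, a, some b :: l => pathD (fun b l => q a (some b :: l)) b l

/-- The cycles of the highest degree. -/
def top (α : Lab → K) : Lab → Word → K
  | a, [] => α a
  | _, none :: _ => 0
  | .X, some b :: l => top α b l
  | .one, some .X :: l => -top α .one l
  | .one, some .one :: _ => 0

theorem eps_eps (q : Lab → Word → K) : eps (eps q) = q := by
  ext a l
  simp only [eps, ← mul_assoc, ← mul_pow]
  simp

theorem eps_add (q r : Lab → Word → K) : eps (q + r) = eps q + eps r := by
  ext a l; simp [eps, mul_add]

theorem lam_add (q r : Lab → Word → K) : lam (q + r) = lam q + lam r := by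
  ext a l; cases a <;> simp [lam]

theorem lam_smul (x : K) (q : Lab → Word → K) : lam (x • q) = x • lam q := by
  ext a l; cases a <;> simp [lam]

theorem merge_add (q r : Lab → Lab → Word → K) : merge (q + r) = merge q + merge r := by
  simp only [merge, Pi.add_apply, lam_add]; abel

theorem merge_smul (x : K) (q : Lab → Lab → Word → K) : merge (x • q) = x • merge q := by
  simp only [merge, Pi.smul_apply, lam_smul, smul_add]

theorem rho_add (q r : Lab → Word → K) : rho (q + r) = rho q + rho r := by
  ext a l
  induction l generalizing q r a with
  | nil => cases a <;> simp [rho, lam]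
  | cons o l ih => cases o <;> exact ih _ _ _

theorem rho_smul (x : K) (q : Lab → Word → K) : rho (x • q) = x • rho q := by
  ext a l
  induction l generalizing q a with
  | nil => cases a <;> simp [rho, lam]
  | cons o l ih => cases o <;> exact ih _ _

theorem rho_zero : rho (0 : Lab → Word → K) = 0 := by
  simpa using rho_smul (0 : K) 0

theorem pathD_add (q r : Lab → Word → K) : pathD (q + r) = pathD q + pathD r := by
  ext a l
  induction l generalizing q r a with
  | nil => simp [pathD]
  | cons o l ih =>
    cases o
    · have h1 := ih (fun a l => q a (none :: l)) (fun a l => r a (none :: l)) a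
      have h2 := congrFun (congrFun (congrArg eps (merge_add
        (fun a b l => q a (some b :: l)) (fun a b l => r a (some b :: l)))) a) l
      rw [eps_add] at h2
      simp only [pathD, Pi.add_apply] at h1 h2 ⊢
      linear_combination h1 + h2
    · exact ih _ _ _

theorem pathD_smul (x : K) (q : Lab → Word → K) : pathD (x • q) = x • pathD q := by
  ext a l
  induction l generalizing q a with
  | nil => simp [pathD]
  | cons o l ih =>
    cases o
    · have h1 := ih (fun a l => q a (none :: l)) a
      have h2 := congrFun (congrFun (merge_smul x (fun a b l => q a (some b :: l))) a) l
      simp only [pathD, Pi.smul_apply, smul_eq_mul, eps] at h1 h2 ⊢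
      linear_combination h1 + (-1) ^ dots l * h2
    · exact ih _ _

theorem pathD_zero : pathD (0 : Lab → Word → K) = 0 := by
  simpa using pathD_smul (0 : K) 0

theorem pathD_neg (q : Lab → Word → K) : pathD (-q) = -pathD q := by
  simpa using pathD_smul (-1 : K) q

theorem pathD_none (q : Lab → Word → K) :
    (fun a l => pathD q a (none :: l)) =
      pathD (fun a l => q a (none :: l)) + eps (merge fun a b l => q a (some b :: l)) := rfl

/-- The first circle acts on the whole complex: merging it with its neighbour is linear for
multiplication by X because A is associative, and the other saddles do not touch it. -/
theorem lam_pathD (q : Lab → Word → K) : pathD (lam q) = lam (pathD q) := by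
  ext a l
  induction l generalizing q a with
  | nil => cases a <;> simp [lam, pathD]
  | cons o l ih =>
    cases o with
    | none =>
      have h : (fun a l => lam q a (none :: l)) = lam (fun a l => q a (none :: l)) := by
        ext a l; cases a <;> rfl
      rw [pathD, h, ih]
      cases a <;> simp [lam, pathD, merge, eps]
    | some b =>
      cases a
      · exact congrFun (congrFun pathD_zero b) l
      · rfl

theorem pathD_merge (q : Lab → Lab → Word → K) :
    pathD (merge q) = merge fun a => pathD (q a) := by
  simp only [merge, pathD_add, lam_pathD]

/-- The differential adds exactly one vertical resolution. This anticommutation makes the faces of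
the cube cancel. -/
theorem pathD_eps (q : Lab → Word → K) : pathD (eps q) = -eps (pathD q) := by
  ext a l
  induction l generalizing q a with
  | nil => simp [pathD, eps]
  | cons o l ih =>
    cases o with
    | none =>
      have h : (fun a l => eps q a (none :: l)) = -eps (fun a l => q a (none :: l)) := by
        ext a l; simp [eps, dots, pow_succ]
      have h' : (merge fun a b l => eps q a (some b :: l)) =
          eps (merge fun a b l => q a (some b :: l)) := by
        ext a l; cases a <;> simp [merge, lam, eps, dots, mul_add]
      rw [pathD, h, h', pathD_neg, Pi.neg_apply, Pi.neg_apply, ih, eps_eps]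
      have e : ((-1 : K) ^ dots l) * (-1) ^ dots l = 1 := by rw [← mul_pow]; simp
      simp only [Pi.neg_apply, eps, pathD, dots, pow_succ]
      linear_combination (-(merge (fun a b l => q a (some b :: l)) a l)) * e
    | some b => exact ih _ _

/-- On words starting with `none` the complex is a mapping cone: `merge` is a chain map by
`pathD_merge`, and the sign `eps` makes the two mixed terms cancel. -/
theorem pathD_pathD (q : Lab → Word → K) : pathD (pathD q) = 0 := by
  ext a l
  induction l generalizing q a with
  | nil => simp [pathD]
  | cons o l ih =>
    cases o with
    | none =>
      rw [pathD, pathD_none, pathD_add, pathD_eps, pathD_merge]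
      have := ih (fun a l => q a (none :: l)) a
      simp only [Pi.add_apply, this, Pi.neg_apply, Pi.zero_apply]
      simp only [pathD, eps, merge]
      cases a <;> simp [lam]
    | some b => exact ih _ _

theorem rho_eps (q : Lab → Word → K) : rho (eps q) = eps (rho q) := by
  ext a l
  induction l generalizing q a with
  | nil => cases a <;> simp [rho, eps, lam]
  | cons o l ih =>
    cases o with
    | none =>
      have h : (fun a l => eps q a (none :: l)) = (-1 : K) • eps (fun a l => q a (none :: l)) := by
        ext a l; simp [eps, dots, pow_succ]
      rw [rho, h, rho_smul, Pi.smul_apply, Pi.smul_apply, ih]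
      simp [eps, rho, dots, pow_succ]
    | some b => exact ih _ _

theorem rho_lam (q : Lab → Word → K) : rho (lam q) = lam (rho q) := by
  ext a l
  induction l generalizing q a with
  | nil => cases a <;> simp [rho, lam]
  | cons o l ih =>
    cases o with
    | none =>
      have h : (fun a l => lam q a (none :: l)) = lam (fun a l => q a (none :: l)) := by
        ext a l; cases a <;> rfl
      rw [rho, h, ih]
      cases a <;> rfl
    | some b =>
      cases a
      · exact congrFun (congrFun rho_zero b) l
      · rfl

theorem rho_merge (q : Lab → Lab → Word → K) : rho (merge q) = merge fun a => rho (q a) := by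
  simp only [merge, rho_add, rho_lam]

theorem rho_rho (q : Lab → Word → K) : rho (rho q) = 0 := by
  ext a l
  induction l generalizing q a with
  | nil => cases a <;> simp [rho, lam]
  | cons o l ih => cases o <;> exact ih _ _

/-- Symmetric to `lam_pathD`, for the last circle. The induction runs from the front of the word, so
it rests on the commutation of `rho` with `merge`. -/
theorem rho_pathD (q : Lab → Word → K) : rho (pathD q) = pathD (rho q) := by
  ext a l
  induction l generalizing q a with
  | nil => cases a <;> simp [rho, pathD, lam]
  | cons o l ih =>
    cases o with
    | none =>
      rw [rho, pathD_none, rho_add, rho_eps, rho_merge, Pi.add_apply, Pi.add_apply, ih]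
      rfl
    | some b => exact ih _ _

/-- The recursion for `top` is T ↦ X ⊗ T - 1 ⊗ XT, the general element of the kernel of the
multiplication; this is its 1-component. -/
theorem top_one_some (α : Lab → K) :
    (fun b l => top α .one (some b :: l)) = -lam (top α) := by
  ext b l; cases b <;> simp [top, lam]

theorem pathD_top (α : Lab → K) : pathD (top α) = 0 := by
  ext a l
  induction l generalizing a with
  | nil => rfl
  | cons o l ih =>
    cases o with
    | none =>
      have h : (merge fun a b l => top α a (some b :: l)) = 0 := by
        simp only [merge, top_one_some]
        exact neg_add_cancel _
      rw [pathD, h]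
      have h0 : (fun a l => top α a (none :: l)) = 0 := by ext a l; simp [top]
      rw [h0, pathD_zero]
      simp [eps]
    | some b =>
      cases a
      · rw [pathD, top_one_some, pathD_neg, lam_pathD]
        cases b
        · simp [lam]
        · simpa [lam] using ih .one
      · exact ih b

theorem top_add (α β : Lab → K) : top (α + β) = top α + top β := by
  ext a l
  induction l generalizing a with
  | nil => rfl
  | cons o l ih =>
    rcases o with _ | _ | _ <;> cases a <;> simp [top, ih, add_comm]

theorem top_smul (x : K) (α : Lab → K) : top (x • α) = x • top α := by
  ext a l
  induction l generalizing a with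
  | nil => rfl
  | cons o l ih =>
    rcases o with _ | _ | _ <;> cases a <;> simp [top, ih]

theorem top_zero : top (0 : Lab → K) = 0 := by simpa using top_smul (0 : K) 0

/-- Multiplication by `X` in `A`. -/
def mulX (α : Lab → K) : Lab → K
  | .one => 0
  | .X => α .one

theorem rho_top (α : Lab → K) : rho (top α) = top (mulX α) := by
  ext a l
  induction l generalizing a with
  | nil => cases a <;> rfl
  | cons o l ih =>
    cases o with
    | none =>
      have h0 : (fun a l => top α a (none :: l)) = 0 := by ext a l; simp [top]
      rw [rho, h0, rho_zero]; simp [top]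
    | some b =>
      cases a
      · rw [rho, top_one_some, ← neg_one_smul K (lam (top α)), rho_smul, rho_lam]
        cases b
        · simp [lam, top]
        · simp [lam, top, ih]
      · exact ih b

/-- Multiplying X ⊗ T - 1 ⊗ XT by X gives -X ⊗ XT on the left factor and X ⊗ XT on the right one,
since X² = 0. So X picks up a sign each time it moves past a horizontal crossing. This sign decides
between 0 and 2X in the final answer. -/
theorem lam_top (α : Lab → K) (a : Lab) (l : Word) :
    lam (top α) a l = (-1) ^ l.length * top (mulX α) a l := by
  induction l generalizing a with
  | nil => cases a <;> simp [lam, top, mulX]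
  | cons o l ih =>
    rcases o with _ | _ | _ <;> cases a <;>
      simp [lam, top, pow_succ, ← ih]

theorem pathD_of_dots_eq_zero (q : Lab → Word → K) (a : Lab) (l : Word) (h : dots l = 0) :
    pathD q a l = 0 := by
  induction l generalizing q a with
  | nil => rfl
  | cons o l ih =>
    cases o
    · simp [dots] at h
    · exact ih _ _ h

theorem top_of_dots_ne_zero (α : Lab → K) (a : Lab) (l : Word) (h : dots l ≠ 0) :
    top α a l = 0 := by
  induction l generalizing a with
  | nil => simp [dots] at h
  | cons o l ih =>
    rcases o with _ | _ | _
    · simp [top]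
    all_goals cases a <;> simp_all [top, dots]

theorem eps_top (α : Lab → K) : eps (top α) = top α := by
  ext a l
  by_cases h : dots l = 0
  · simp [eps, h]
  · simp [eps, top_of_dots_ne_zero α a l h]

/-- The word X ⋯ X b reads off the coefficient α b, so `top` loses no information. -/
theorem exists_top_eq (n : ℕ) (b : Lab) : ∃ a l, l.length = n ∧ dots l = 0 ∧
    ∀ α : Lab → K, top α a l = α b := by
  induction n with
  | zero => exact ⟨b, [], rfl, rfl, fun _ => rfl⟩
  | succ n ih =>
    obtain ⟨a, l, h1, h2, h3⟩ := ih
    exact ⟨.X, some a :: l, by simp [h1], h2, h3⟩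

theorem eq_zero_of_top_eq_zero {n : ℕ} {α : Lab → K}
    (h : ∀ a l, l.length = n → dots l = 0 → top α a l = 0) : α = 0 := by
  ext b
  obtain ⟨a, l, h1, h2, h3⟩ := exists_top_eq (K := K) n b
  rw [← h3 α, h a l h1 h2]; rfl

/-- Functions here live on all words at once, without bookkeeping of length or degree. Locality
recovers this bookkeeping: the value at a word depends only on words of the same length with one
vertical resolution fewer. -/
theorem pathD_eq_zero_of_local {q : Lab → Word → K} {a : Lab} {l : Word}
    (h : ∀ a' l', l'.length = l.length → dots l' + 1 = dots l → q a' l' = 0) :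
    pathD q a l = 0 := by
  induction l generalizing q a with
  | nil => rfl
  | cons o l ih =>
    cases o with
    | none =>
      have h1 : pathD (fun a l => q a (none :: l)) a l = 0 :=
        ih fun a' l' hl hd => h a' _ (by simp [hl]) (by simp [dots, hd])
      have h2 : ∀ a b, q a (some b :: l) = 0 := fun a b => h a _ (by simp) (by simp [dots])
      rw [pathD, h1]
      cases a <;> simp [eps, merge, lam, h2]
    | some b => exact ih fun a' l' hl hd => h _ _ (by simp [hl]) (by simpa [dots] using hd)

theorem rho_eq_zero_of_local {q : Lab → Word → K} {a : Lab} {l : Word}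
    (h : ∀ a' l', l'.length = l.length → dots l' = dots l → q a' l' = 0) :
    rho q a l = 0 := by
  induction l generalizing q a with
  | nil => cases a <;> simp [rho, lam, h]
  | cons o l ih =>
    cases o with
    | none => exact ih fun a' l' hl hd => h a' _ (by simp [hl]) (by simp [dots, hd])
    | some b => exact ih fun a' l' hl hd => h _ _ (by simp [hl]) (by simpa [dots] using hd)

theorem pathD_congr {q r : Lab → Word → K} {a : Lab} {l : Word}
    (h : ∀ a' l', l'.length = l.length → q a' l' = r a' l') : pathD q a l = pathD r a l := by
  have := pathD_eq_zero_of_local (q := q + (-1 : K) • r) (a := a) (l := l)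
    fun a' l' hl _ => by simp [h a' l' hl]
  rw [pathD_add, pathD_smul] at this
  simpa [add_neg_eq_zero] using this

/-- The homology of the chain of circles is concentrated in the highest degree. -/
theorem path_exact (n : ℕ) (v : Lab → Word → K)
    (hv : ∀ a l, l.length = n → pathD v a l = 0) :
    ∃ (α : Lab → K) (u : Lab → Word → K),
      ∀ a l, l.length = n → v a l = top α a l + pathD u a l := by
  induction n generalizing v with
  | zero =>
    refine ⟨fun a => v a [], 0, fun a l hl => ?_⟩
    obtain rfl := List.eq_nil_of_length_eq_zero hl
    simp [top, pathD]
  | succ n ih =>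
    -- The splitting p ↦ 1 ⊗ p of the multiplication: subtracting its differential kills all
    -- components of `v` in which the first crossing is vertical.
    let u₁ : Lab → Word → K := fun a l => match a, l with
      | .one, some b :: l => eps (fun a l => v a (none :: l)) b l
      | _, _ => 0
    let v₂ := v + (-1 : K) • pathD u₁
    have hv₂ : ∀ a l, l.length = n + 1 → pathD v₂ a l = 0 := fun a l hl => by
      simp only [v₂, pathD_add, pathD_smul, pathD_pathD]
      simp [hv a l hl]
    have hnone : ∀ a l, v₂ a (none :: l) = 0 := fun a l => by
      have h0 : (fun a l => u₁ a (none :: l)) = 0 := by ext a l; cases a <;> rfl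
      have h1 : (merge fun a b l => u₁ a (some b :: l)) = eps (fun a l => v a (none :: l)) := by
        ext a l; cases a <;> simp [merge, lam, u₁]
      simp [v₂, pathD, h0, h1, pathD_zero, eps_eps]
    have hX : ∀ b l, l.length = n → pathD (fun b l => v₂ .X (some b :: l)) b l = 0 :=
      fun b l hl => hv₂ .X (some b :: l) (by simp [hl])
    -- With those components gone, the cycle equation at `none :: l` says that the multiplication
    -- kills `v₂`, so `v₂` has the form X ⊗ p - 1 ⊗ Xp.
    have hone : ∀ b l, l.length = n →
        v₂ .one (some b :: l) = -lam (fun b l => v₂ .X (some b :: l)) b l := fun b l hl => by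
      have h0 : (fun a l => v₂ a (none :: l)) = 0 := by ext a l; exact hnone a l
      have h1 := hv₂ b (none :: l) (by simp [hl])
      rw [pathD, h0, pathD_zero] at h1
      have h2 : eps (eps (merge fun a b l => v₂ a (some b :: l))) b l = 0 := by
        rw [eps]; simp at h1; simp [h1]
      rw [eps_eps] at h2
      exact eq_neg_of_add_eq_zero_left h2
    obtain ⟨α, u, hu⟩ := ih _ hX
    -- The bounding chain for p is lifted to the kernel of the multiplication, as X ⊗ u - 1 ⊗ Xu.
    let u₂ : Lab → Word → K := fun a l => match a, l with
      | .one, some b :: l => (-lam u) b l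
      | .X, some b :: l => u b l
      | _, _ => 0
    refine ⟨α, u₁ + u₂, fun a l hl => ?_⟩
    suffices h : v₂ a l = top α a l + pathD u₂ a l by
      simp only [v₂, Pi.add_apply, Pi.smul_apply, smul_eq_mul, neg_mul, one_mul] at h
      rw [pathD_add, Pi.add_apply, Pi.add_apply]
      linear_combination h
    match l with
    | none :: l =>
      have h0 : (fun a l => u₂ a (none :: l)) = 0 := by ext a l; cases a <;> rfl
      have h1 : (merge fun a b l => u₂ a (some b :: l)) = 0 := by
        ext a l; cases a <;> simp [merge, lam, u₂]
      rw [hnone, pathD, h0, h1, pathD_zero]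
      simp [top, eps]
    | some b :: l =>
      have hl' : l.length = n := by simpa using hl
      cases a
      · rw [hone b l hl', pathD]
        change _ = _ + pathD (-lam u) b l
        rw [pathD_neg, lam_pathD]
        have := congrFun (congrFun (top_one_some α) b) l
        rw [this]
        cases b <;> simp [lam, hu _ l hl']
        ring
      · exact hu b l hl'

end Path

/-! ### Cyclic words and the complex of the closed braid -/

/-- The basis elements of the complex of the closure of a two-strand braid: a cyclic word with a
label for each circle, or, if all resolutions are vertical, a label for each of the two strands. -/
inductive State
  | base (x y : Lab)
  | dot (w : State)
  | lett (a : Lab) (l : Word)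

namespace State

/-- The number of crossings. -/
def len : State → ℕ
  | base _ _ => 0
  | dot w => w.len + 1
  | lett _ l => l.length + 1

/-- The number of vertical resolutions. -/
def dots : State → ℕ
  | base _ _ => 0
  | dot w => w.dots + 1
  | lett _ l => Khovanov.dots l

end State

section Cyc

variable {K : Type} [CommRing K] (c : K)

/-- The comultiplication, on coefficient functions. -/
def comul (α : Lab → K) (x y : Lab) : K :=
  α .one * comulCoeff c .one x y + α .X * comulCoeff c .X x y

/-- The map that makes the resolution of the first crossing of a word vertical, and merges the
first circle with the last one. -/
def wrap : (Lab → Word → K) → State → K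
  | q, .base x y => comul c (fun a => q a []) x y
  | q, .dot w => wrap (fun a l => q a (none :: l)) w
  | q, .lett b l => q .one (some b :: l) + rho (fun b l => q .X (some b :: l)) b l

/-- The differential on functions of cyclic words. -/
def cycD : (State → K) → State → K
  | _, .base _ _ => 0
  | f, .dot w => cycD (fun w => f (.dot w)) w +
      (-1) ^ w.dots * wrap c (fun a l => f (.lett a l)) w
  | f, .lett a l => pathD (fun a l => f (.lett a l)) a l

/-- The sign operator `(-1)^dots`. -/
def ceps (f : State → K) (w : State) : K := (-1) ^ w.dots * f w

theorem comul_add (α β : Lab → K) : comul c (α + β) = comul c α + comul c β := by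
  ext x y; simp [comul]; ring

theorem comul_smul (r : K) (α : Lab → K) : comul c (r • α) = r • comul c α := by
  ext x y; simp [comul]; ring

theorem wrap_add (q r : Lab → Word → K) : wrap c (q + r) = wrap c q + wrap c r := by
  ext w
  induction w generalizing q r with
  | base x y => exact congrFun (congrFun (comul_add c (fun a => q a []) fun a => r a []) x) y
  | dot w ih => exact ih _ _
  | lett b l =>
    have := congrFun (congrFun
      (rho_add (fun b l => q .X (some b :: l)) fun b l => r .X (some b :: l)) b) l
    simp only [Pi.add_apply] at this
    change _ + rho (fun b l => q .X (some b :: l) + r .X (some b :: l)) b l = _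
    change rho (fun b l => q .X (some b :: l) + r .X (some b :: l)) b l = _ at this
    rw [this]
    simp only [Pi.add_apply, wrap]
    ring

theorem wrap_smul (x : K) (q : Lab → Word → K) : wrap c (x • q) = x • wrap c q := by
  ext w
  induction w generalizing q with
  | base y z => exact congrFun (congrFun (comul_smul c x fun a => q a []) y) z
  | dot w ih => exact ih _
  | lett b l =>
    have := congrFun (congrFun (rho_smul x fun b l => q .X (some b :: l)) b) l
    change _ + rho (x • fun b l => q .X (some b :: l)) b l = _
    rw [this]
    simp [wrap, mul_add]

theorem wrap_zero : wrap c 0 = 0 := by simpa using wrap_smul c 0 0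

theorem cycD_add (f g : State → K) : cycD c (f + g) = cycD c f + cycD c g := by
  ext w
  induction w generalizing f g with
  | base x y => simp [cycD]
  | dot w ih =>
    have h1 := ih (fun w => f (.dot w)) fun w => g (.dot w)
    have h2 := congrFun (wrap_add c (fun a l => f (.lett a l)) fun a l => g (.lett a l)) w
    simp only [Pi.add_apply] at h1 h2
    change cycD c ((fun w => f (.dot w)) + fun w => g (.dot w)) w + _ * wrap c
      ((fun a l => f (.lett a l)) + fun a l => g (.lett a l)) w = _
    change cycD c ((fun w => f (.dot w)) + fun w => g (.dot w)) w = _ at h1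
    simp only [cycD, Pi.add_apply]
    linear_combination h1 + (-1) ^ w.dots * h2
  | lett a l =>
    exact congrFun (congrFun (pathD_add (fun a l => f (.lett a l)) fun a l => g (.lett a l)) a) l

theorem cycD_smul (x : K) (f : State → K) : cycD c (x • f) = x • cycD c f := by
  ext w
  induction w generalizing f with
  | base x y => simp [cycD]
  | dot w ih =>
    have h1 := ih (fun w => f (.dot w))
    have h2 := congrFun (wrap_smul c x (fun a l => f (.lett a l))) w
    simp only [Pi.smul_apply, smul_eq_mul] at h1 h2
    change cycD c (x • (fun w => f (.dot w))) w + _ * wrap c (x • (fun a l => f (.lett a l))) w = _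
    change cycD c (x • (fun w => f (.dot w))) w = _ at h1
    simp only [cycD, Pi.smul_apply, smul_eq_mul]
    linear_combination h1 + (-1) ^ w.dots * h2
  | lett a l => exact congrFun (congrFun (pathD_smul x (fun a l => f (.lett a l))) a) l

theorem wrap_eps (q : Lab → Word → K) : wrap c (eps q) = ceps (wrap c q) := by
  ext w
  induction w generalizing q with
  | base x y => simp [wrap, eps, ceps, comul, dots, State.dots]
  | dot w ih =>
    have h : (fun a l => eps q a (none :: l)) = (-1 : K) • eps (fun a l => q a (none :: l)) := by
      ext a l; simp [eps, dots, pow_succ]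
    rw [wrap, h, wrap_smul, Pi.smul_apply, ih]
    simp [ceps, State.dots, wrap, pow_succ]
  | lett b l =>
    have h : (fun b l => eps q .X (some b :: l)) = eps fun b l => q .X (some b :: l) := rfl
    rw [wrap, h, rho_eps]
    simp [eps, ceps, wrap, State.dots, dots, mul_add]

/-- `wrap` joins the first and the last circle, so X may be placed on either of them beforehand. If
they are already one circle, the two actions agree. -/
theorem wrap_lam (q : Lab → Word → K) : wrap c (lam q) = wrap c (rho q) := by
  ext w
  induction w generalizing q with
  | base x y => rfl
  | dot w ih =>
    have h : (fun a l => lam q a (none :: l)) = lam fun a l => q a (none :: l) := by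
      ext a l; cases a <;> rfl
    rw [wrap, h, ih]; rfl
  | lett b l =>
    change lam q .one _ + rho (fun b l => q .one (some b :: l)) b l =
      rho (fun b l => q .one (some b :: l)) b l + rho (rho fun b l => q .X (some b :: l)) b l
    simp [rho_rho, lam]

theorem cycD_ceps (f : State → K) : cycD c (ceps f) = -ceps (cycD c f) := by
  ext w
  induction w generalizing f with
  | base x y => simp [cycD, ceps]
  | dot w ih =>
    have h : (fun w => ceps f (.dot w)) = (-1 : K) • ceps fun w => f (.dot w) := by
      ext w; simp [ceps, State.dots, pow_succ]
    have h' : (fun a l => ceps f (.lett a l)) = eps fun a l => f (.lett a l) := rfl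
    rw [cycD, h, h', wrap_eps, cycD_smul, Pi.smul_apply, ih]
    simp only [ceps, Pi.neg_apply, cycD, State.dots, pow_succ, smul_eq_mul]
    ring
  | lett a l => exact congrFun (congrFun (pathD_eps fun a l => f (.lett a l)) a) l

/-- This is the chain map whose cone is the complex of the closed braid with one crossing more. When
the next crossing is vertical, merging there puts X on the new first circle, and `wrap_lam` moves it
to the last one. -/
theorem cycD_wrap (q : Lab → Word → K) : cycD c (wrap c q) = wrap c (pathD q) := by
  ext w
  induction w generalizing q with
  | base x y => simp [cycD, wrap, pathD, comul]
  | dot w ih =>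
    have h : (fun a l => wrap c q (.lett a l)) =
        (fun a l => q .one (some a :: l)) + rho fun b l => q .X (some b :: l) := rfl
    rw [cycD, wrap, pathD_none, wrap_add, wrap_eps, merge, wrap_add, wrap_lam, ← wrap_add, ← h]
    exact congrArg (· + _) (ih _)
  | lett b l =>
    change pathD ((fun b l => q .one (some b :: l)) + rho fun b l => q .X (some b :: l)) b l =
      pathD (fun b l => q .one (some b :: l)) b l +
        rho (pathD fun b l => q .X (some b :: l)) b l
    rw [pathD_add, rho_pathD]; rfl

/-- The square of the differential of a mapping cone: `cycD_wrap` and the anticommutation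
`cycD_ceps` cancel the mixed terms. -/
theorem cycD_cycD (f : State → K) : cycD c (cycD c f) = 0 := by
  ext w
  induction w generalizing f with
  | base x y => rfl
  | dot w ih =>
    have h : (fun w => cycD c f (.dot w)) =
        cycD c (fun w => f (.dot w)) + ceps (wrap c fun a l => f (.lett a l)) := rfl
    rw [cycD, h, cycD_add, cycD_ceps, cycD_wrap, Pi.add_apply, ih]
    simp [ceps, cycD]
  | lett a l => exact congrFun (congrFun (pathD_pathD fun a l => f (.lett a l)) a) l

theorem wrap_eq_zero_of_local {q : Lab → Word → K} {w : State}
    (h : ∀ a l, l.length = w.len → dots l = w.dots → q a l = 0) : wrap c q w = 0 := by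
  induction w generalizing q with
  | base x y => simp [wrap, comul, h _ [] rfl rfl]
  | dot w ih => exact ih fun a l hl hd => h a _ (by simp [hl, State.len]) (by simp [hd, State.dots, dots])
  | lett b l =>
    have h1 : rho (fun b l => q .X (some b :: l)) b l = 0 :=
      rho_eq_zero_of_local fun a' l' hl hd =>
        h _ _ (by simp [hl, State.len]) (by simp [hd, State.dots, dots])
    rw [wrap, h1, h _ (some b :: l) (by simp [State.len]) (by simp [State.dots, dots]), add_zero]

theorem cycD_eq_zero_of_local {f : State → K} {w : State}
    (h : ∀ w', w'.len = w.len → w'.dots + 1 = w.dots → f w' = 0) : cycD c f w = 0 := by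
  induction w generalizing f with
  | base x y => rfl
  | dot w ih =>
    have h1 : cycD c (fun w => f (.dot w)) w = 0 :=
      ih fun w' hl hd => h _ (by simp [State.len, hl]) (by simp [State.dots, hd])
    have h2 : wrap c (fun a l => f (.lett a l)) w = 0 :=
      wrap_eq_zero_of_local c fun a l hl hd =>
        h _ (by simp [State.len, hl]) (by simp [State.dots, hd])
    rw [cycD, h1, h2]; simp
  | lett a l =>
    exact pathD_eq_zero_of_local fun a' l' hl hd => h _ (by simp [State.len, hl]) hd

theorem wrap_congr {q r : Lab → Word → K} {w : State}
    (h : ∀ a l, l.length = w.len → q a l = r a l) : wrap c q w = wrap c r w := by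
  have := wrap_eq_zero_of_local c (q := q + (-1 : K) • r) (w := w)
    fun a l hl _ => by simp [h a l hl]
  rw [wrap_add, wrap_smul] at this
  simpa [add_neg_eq_zero] using this

/-- The chain with the component `t` on the states without circles that meet both strands, and
with the top cycles of the chains of circles that cover the last `s` crossings. -/
def gen (t : Lab → Lab → K) (α : ℕ → Lab → K) : State → K
  | .base x y => t x y
  | .dot w => gen t α w
  | .lett a l => top (α (l.length + 1)) a l

theorem gen_add (t t' : Lab → Lab → K) (α α' : ℕ → Lab → K) :
    gen (t + t') (α + α') = gen t α + gen t' α' := by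
  ext w
  induction w with
  | base x y => rfl
  | dot w ih => exact ih
  | lett a l => simp [gen, top_add]

theorem gen_smul (x : K) (t : Lab → Lab → K) (α : ℕ → Lab → K) :
    gen (x • t) (x • α) = x • gen t α := by
  ext w
  induction w with
  | base x y => rfl
  | dot w ih => exact ih
  | lett a l => simp [gen, top_smul]

theorem gen_congr {t : Lab → Lab → K} {α α' : ℕ → Lab → K} {w : State}
    (h : ∀ s, 1 ≤ s → s ≤ w.len → α s = α' s) : gen t α w = gen t α' w := by
  induction w with
  | base x y => rfl
  | dot w ih => exact ih fun s h1 h2 => h s h1 (by simp [State.len]; omega)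
  | lett a l => simp [gen, h (l.length + 1) (by omega) (by simp [State.len])]

/-- The differential on the cycles `gen`. -/
def bd (α : ℕ → Lab → K) (s : ℕ) : Lab → K := ((1 : K) + (-1) ^ s) • mulX (α (s + 1))

/-- The label 1 on the first circle contributes -XT with X acting at the front, the label X
contributes XT with X acting at the back. By `lam_top` both are multiples of the same top cycle,
with coefficients that cancel or add up to 2. -/
theorem wrap_top_lett (α : Lab → K) (b : Lab) (l : Word) :
    wrap c (top α) (.lett b l) = top (((1 : K) + (-1) ^ (l.length + 1)) • mulX α) b l := by
  have h := congrFun (congrFun (top_one_some α) b) l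
  have h' : (fun b l => top α .X (some b :: l)) = top α := rfl
  rw [wrap, h', rho_top, h, top_smul]
  simp only [Pi.neg_apply, lam_top, Pi.smul_apply, smul_eq_mul, pow_succ]
  ring

theorem wrap_top_dot (α : Lab → K) (w : State) : wrap c (top α) (.dot w) = 0 := by
  have h0 : (fun a l => top α a (none :: l)) = 0 := by ext a l; simp [top]
  rw [wrap, h0, wrap_zero]; rfl

/-- The left side is the value of the differential of `gen t α` at `.dot w`. In this form it can be
proved by induction on w; for chains of length `w.len` the additional term disappears once `α (w.len
+ 1) = 0`. -/
theorem cycD_gen (t : Lab → Lab → K) (α : ℕ → Lab → K) (w : State) :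
    cycD c (gen t α) w + ceps (wrap c (top (α (w.len + 1)))) w =
      gen (comul c (α 1)) (bd α) w := by
  induction w with
  | base x y => simp [cycD, ceps, State.dots, wrap, gen, State.len, top]
  | dot w ih =>
    rw [ceps, wrap_top_dot, gen, ← ih, mul_zero, add_zero, cycD, ceps]
    congr 2
    exact wrap_congr c fun a l hl => by simp [gen, hl]
  | lett a l =>
    have h0 : cycD c (gen t α) (.lett a l) = 0 := by
      refine Eq.trans ?_ (congrFun (congrFun (pathD_top (α (l.length + 1))) a) l)
      exact pathD_congr fun a' l' hl => by simp [gen, hl]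
    rw [h0, ceps, wrap_top_lett, gen, zero_add]
    exact congrFun (congrFun (eps_top _) a) l

/-- Every cycle is homologous to one of the form `gen`. -/
theorem cyc_exact (k : ℕ) (v : State → K) (hv : ∀ w, w.len = k → cycD c v w = 0) :
    ∃ (t : Lab → Lab → K) (α : ℕ → Lab → K) (u : State → K),
      (1 ≤ k → comul c (α 1) = 0) ∧ (∀ s, 1 ≤ s → s < k → bd α s = 0) ∧
      ∀ w, w.len = k → v w = cycD c u w + gen t α w := by
  induction k generalizing v with
  | zero =>
    refine ⟨fun x y => v (.base x y), 0, 0, by simp, by simp, fun w hw => ?_⟩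
    cases w
    · simp [cycD, gen]
    all_goals simp [State.len] at hw
  | succ k ih =>
    obtain ⟨β, u, hu⟩ := path_exact k (fun a l => v (.lett a l)) fun a l hl =>
      hv (.lett a l) (by simp [State.len, hl])
    have key : ∀ w, w.len = k → wrap c (fun a l => v (.lett a l)) w =
        wrap c (top β) w + cycD c (wrap c u) w := fun w hw => by
      rw [cycD_wrap, ← Pi.add_apply, ← wrap_add]
      exact wrap_congr c fun a l hl => hu a l (hl.trans hw)
    -- The part of `v` over `.lett` is `top β` plus a coboundary; `wrap` of the bounding chain
    -- corrects the part over `.dot`.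
    have hsum : ∀ w, w.len = k → cycD c ((fun w => v (.dot w)) + (-1 : K) • ceps (wrap c u)) w +
        ceps (wrap c (top β)) w = 0 := fun w hw => by
      have := hv (.dot w) (by simp [State.len, hw])
      rw [cycD, key w hw] at this
      rw [cycD_add, cycD_smul, cycD_ceps]
      simp only [Pi.add_apply, Pi.smul_apply, Pi.neg_apply, ceps, smul_eq_mul] at this ⊢
      linear_combination this
    -- The two summands of `hsum` vanish separately: `wrap` of a top cycle is zero at `.dot` states
    -- and at words with a vertical resolution, and at all other states there is nothing for the
    -- differential to come from.
    have htop : ∀ w, w.len = k → wrap c (top β) w = 0 := fun w hw => by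
      have := hsum w hw
      cases w with
      | base x y => simpa [cycD, ceps, State.dots] using this
      | dot w => exact wrap_top_dot c β w
      | lett b l =>
        by_cases hd : dots l = 0
        · rw [cycD, pathD_of_dots_eq_zero _ _ _ hd] at this
          simpa [ceps, State.dots, hd] using this
        · rw [wrap_top_lett, top_of_dots_ne_zero _ _ _ hd]
    obtain ⟨t, α, u', h1, h2, h3⟩ := ih _ fun w hw => by
      have := hsum w hw
      rwa [ceps, htop w hw, mul_zero, add_zero] at this
    -- The copy of A contributed by the new crossing has index k + 1; the new condition, at s = k,
    -- is `htop` at the words of horizontal resolutions.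
    refine ⟨t, Function.update α (k + 1) β, fun w => match w with
      | .base _ _ => 0
      | .dot w => u' w
      | .lett a l => u a l, fun _ => ?_, fun s hs1 hs2 => ?_, fun w hw => ?_⟩
    · rcases Nat.eq_zero_or_pos k with rfl | hk
      · ext x y
        simpa [wrap, top] using htop (.base x y) rfl
      · rw [Function.update_of_ne (by omega)]
        exact h1 hk
    · rcases Nat.lt_succ_iff_lt_or_eq.mp hs2 with h | rfl
      · rw [bd, Function.update_of_ne (by omega)]
        exact h2 s hs1 h
      · rw [bd, Function.update_self]
        obtain ⟨n, rfl⟩ : ∃ n, s = n + 1 := ⟨s - 1, by omega⟩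
        refine eq_zero_of_top_eq_zero (n := n) fun a l hl _ => ?_
        have := htop (.lett a l) (by simp [State.len, hl])
        rwa [wrap_top_lett, hl] at this
    · cases w with
      | base x y => simp [State.len] at hw
      | dot w =>
        have hw' : w.len = k := by simpa [State.len] using hw
        have := h3 w hw'
        simp only [Pi.add_apply, Pi.smul_apply, smul_eq_mul, ceps] at this
        rw [cycD, gen, gen_congr (α' := α)
          fun s _ hs => by rw [Function.update_of_ne (by omega)]]
        linear_combination this
      | lett a l =>
        have hw' : l.length = k := by simpa [State.len] using hw
        simp only [cycD, gen, hw', Function.update_self]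
        rw [hu a l hw', add_comm]

/-- The cycles of the form `gen` that are boundaries. -/
theorem cyc_boundary (k : ℕ) (t : Lab → Lab → K) (α : ℕ → Lab → K) (u : State → K)
    (hu : ∀ w, w.len = k → gen t α w = cycD c u w) :
    ∃ γ : ℕ → Lab → K, γ (k + 1) = 0 ∧ t = comul c (γ 1) ∧
      ∀ s, 1 ≤ s → s ≤ k → α s = bd γ s := by
  induction k generalizing t α u with
  | zero =>
    refine ⟨0, rfl, ?_, fun s h1 h2 => by omega⟩
    ext x y
    simpa [gen, cycD, comul] using hu (.base x y) rfl
  | succ k ih =>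
    -- No coboundary reaches the states without vertical resolutions.
    have hα : α (k + 1) = 0 := eq_zero_of_top_eq_zero (n := k) fun a l hl hd => by
      have := hu (.lett a l) (by simp [State.len, hl])
      rwa [cycD, pathD_of_dots_eq_zero _ _ _ hd, gen, hl] at this
    obtain ⟨β, u', hu'⟩ := path_exact k (fun a l => u (.lett a l)) fun a l hl => by
      have := hu (.lett a l) (by simp [State.len, hl])
      rw [gen, hl, hα, top_zero] at this
      exact this.symm
    let γ₀ : ℕ → Lab → K := Function.update 0 (k + 1) β
    -- Over `.lett` the bounding chain is a cycle, hence `top β` up to a coboundary. Subtracting the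
    -- differential of `gen 0 γ₀` leaves a bounding problem with one crossing fewer.
    have key : ∀ w, w.len = k → gen (t + (-1 : K) • comul c (γ₀ 1)) (α + (-1 : K) • bd γ₀) w =
        cycD c ((fun w => u (.dot w)) + (-1 : K) • ceps (wrap c u') +
          (-1 : K) • gen 0 γ₀) w := fun w hw => by
      have h1 := hu (.dot w) (by simp [State.len, hw])
      have h2 := cycD_gen c 0 γ₀ w
      have h3 : wrap c (fun a l => u (.lett a l)) w = wrap c (top β) w + cycD c (wrap c u') w := by
        rw [cycD_wrap, ← Pi.add_apply, ← wrap_add]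
        exact wrap_congr c fun a l hl => hu' a l (hl.trans hw)
      rw [hw, show γ₀ (k + 1) = β from Function.update_self ..] at h2
      rw [cycD, h3, gen] at h1
      simp only [gen_add, gen_smul, cycD_add, cycD_smul, cycD_ceps, Pi.add_apply, Pi.smul_apply,
        Pi.neg_apply, smul_eq_mul, ceps] at h1 h2 ⊢
      linear_combination h1 + h2
    obtain ⟨γ, hγ0, hγ1, hγ2⟩ := ih _ _ _ key
    have e : ∀ s, s ≤ k + 1 →
        (fun s => if s ≤ k + 1 then γ s + γ₀ s else 0 : ℕ → Lab → K) s = γ s + γ₀ s :=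
      fun s hs => if_pos hs
    -- The cut-off is needed because the induction controls `γ` at k + 1 but not at k + 2.
    refine ⟨fun s => if s ≤ k + 1 then γ s + γ₀ s else 0, if_neg (by omega), ?_, ?_⟩
    · rw [e 1 (by omega), comul_add, ← hγ1]
      ext; simp
    · intro s h1 h2
      rcases Nat.lt_or_ge s (k + 1) with h | h
      · have := hγ2 s h1 (by omega)
        simp only [bd, if_pos (show s + 1 ≤ k + 1 by omega)]
        ext b
        have := congrFun this b
        cases b <;> simp [bd, mulX] at this ⊢ <;> linear_combination this
      · obtain rfl : s = k + 1 := by omega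
        rw [hα]
        simp only [bd]
        rw [if_neg (by omega)]
        ext b; cases b <;> simp [mulX]

end Cyc

/-! ### Homogeneous components -/

/-- The degree of a letter of a word; a vertical resolution raises the degree by one. -/
def letterDeg : Option Lab → ℤ
  | none => 1
  | some b => b.deg

/-- The degree of a word. -/
def wordDeg (l : Word) : ℤ := (l.map letterDeg).sum

/-- The degree of a state, up to a constant that depends on the diagram. -/
def State.deg : State → ℤ
  | base x y => x.deg + y.deg
  | dot w => w.deg + 1
  | lett a l => a.deg + wordDeg l

@[simp] theorem wordDeg_nil : wordDeg [] = 0 := rfl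

@[simp] theorem wordDeg_cons (o : Option Lab) (l : Word) :
    wordDeg (o :: l) = letterDeg o + wordDeg l := by simp [wordDeg]

@[simp] theorem letterDeg_none : letterDeg none = 1 := rfl

@[simp] theorem letterDeg_some (b : Lab) : letterDeg (some b) = b.deg := rfl

@[simp] theorem Lab.deg_one : Lab.deg .one = 1 := rfl

@[simp] theorem Lab.deg_X : Lab.deg .X = -1 := rfl

/-- The projections of a ring `K` onto the components of a grading `𝒢` for which `c` is
homogeneous of degree `2`. -/
structure Components {K : Type} [CommRing K] (c : K) (𝒢 : ℤ → AddSubgroup K) where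
  /-- the homogeneous component -/
  pr : ℤ → K →+ K
  pr_mem : ∀ j r, pr j r ∈ 𝒢 j
  pr_eq : ∀ j r, r ∈ 𝒢 j → pr j r = r
  pr_mul : ∀ j r, pr (j + 2) (c * r) = c * pr j r

namespace Components

variable {K : Type} [CommRing K] {c : K} {𝒢 : ℤ → AddSubgroup K} (P : Components c 𝒢)

/-- The homogeneous component of a function of words. -/
def wordPr (j : ℤ) (q : Lab → Word → K) (a : Lab) (l : Word) : K :=
  P.pr (j - (a.deg + wordDeg l)) (q a l)

/-- The homogeneous component of a function of states. -/
def statePr (j : ℤ) (f : State → K) (w : State) : K := P.pr (j - w.deg) (f w)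

theorem pr_sign (j : ℤ) (n : ℕ) (r : K) : P.pr j ((-1) ^ n * r) = (-1) ^ n * P.pr j r := by
  rcases Nat.even_or_odd n with h | h <;> simp [h.neg_one_pow]

/-- A multiplication lowers the degree of the labels by one, and the vertical resolution it creates
counts one in `letterDeg`. -/
theorem pathD_wordPr (j : ℤ) (q : Lab → Word → K) (a : Lab) (l : Word) :
    pathD (P.wordPr j q) a l = P.wordPr j (pathD q) a l := by
  induction l generalizing j q a with
  | nil => simp [pathD, wordPr]
  | cons o l ih =>
    cases o with
    | none =>
      have h : (fun a l => P.wordPr j q a (none :: l)) =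
          P.wordPr (j - 1) fun a l => q a (none :: l) := by
        ext a l; simp only [wordPr, wordDeg_cons, letterDeg_none]; congr 2; ring
      rw [pathD, h, ih]
      cases a
      · simp only [wordPr, pathD, eps, merge, lam, Pi.add_apply, wordDeg_cons, letterDeg_none,
          letterDeg_some, Lab.deg_one, map_add, pr_sign, add_zero]
        congr 3; ring
      · simp only [wordPr, pathD, eps, merge, lam, Pi.add_apply, wordDeg_cons, letterDeg_none,
          letterDeg_some, Lab.deg_one, Lab.deg_X, map_add, pr_sign]
        congr 3
        · ring
        · congr 3; ring
    | some b =>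
      have h : (fun b l => P.wordPr j q a (some b :: l)) =
          P.wordPr (j - a.deg) fun b l => q a (some b :: l) := by
        ext b l; simp only [wordPr, wordDeg_cons, letterDeg_some]; congr 2; ring
      rw [pathD, h, ih]
      simp only [wordPr, pathD, wordDeg_cons, letterDeg_some]
      congr 2; ring

theorem rho_wordPr (j : ℤ) (q : Lab → Word → K) (a : Lab) (l : Word) :
    rho (P.wordPr j q) a l = P.wordPr (j - 2) (rho q) a l := by
  induction l generalizing j q a with
  | nil =>
    cases a
    · simp [rho, lam, wordPr]
    · simp only [rho, lam, wordPr, wordDeg_nil, Lab.deg_one, Lab.deg_X]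
      congr 2; ring
  | cons o l ih =>
    cases o with
    | none =>
      have h : (fun a l => P.wordPr j q a (none :: l)) =
          P.wordPr (j - 1) fun a l => q a (none :: l) := by
        ext a l; simp only [wordPr, wordDeg_cons, letterDeg_none]; congr 2; ring
      rw [rho, h, ih]
      simp only [wordPr, rho, wordDeg_cons, letterDeg_none]
      congr 2; ring
    | some b =>
      have h : (fun b l => P.wordPr j q a (some b :: l)) =
          P.wordPr (j - a.deg) fun b l => q a (some b :: l) := by
        ext b l; simp only [wordPr, wordDeg_cons, letterDeg_some]; congr 2; ring
      rw [rho, h, ih]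
      simp only [wordPr, rho, wordDeg_cons, letterDeg_some]
      congr 2; ring

/-- The shift by one appears because the vertical crossing created by `wrap` is not part of `w`. The
base case is the only place where the degree of c matters. -/
theorem wrap_wordPr (j : ℤ) (q : Lab → Word → K) (w : State) :
    wrap c (P.wordPr j q) w = P.statePr (j - 1) (wrap c q) w := by
  induction w generalizing j q with
  | base x y =>
    cases x <;> cases y <;>
      simp only [wrap, comul, comulCoeff, wordPr, statePr, State.deg, wordDeg_nil, Lab.deg_one,
        Lab.deg_X, mul_zero, add_zero, map_zero, mul_one, map_add]
    · congr 2; ring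
    · congr 2; ring
    · rw [mul_comm, ← P.pr_mul, mul_comm]
      congr 3; ring
  | dot w ih =>
    have h : (fun a l => P.wordPr j q a (none :: l)) =
        P.wordPr (j - 1) fun a l => q a (none :: l) := by
      ext a l; simp only [wordPr, wordDeg_cons, letterDeg_none]; congr 2; ring
    rw [wrap, h, ih]
    simp only [statePr, wrap, State.deg]
    congr 2; ring
  | lett b l =>
    have h : (fun b l => P.wordPr j q .X (some b :: l)) =
        P.wordPr (j + 1) fun b l => q .X (some b :: l) := by
      ext b l; simp only [wordPr, wordDeg_cons, letterDeg_some, Lab.deg_X]; congr 2; ring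
    rw [wrap, h, rho_wordPr]
    simp only [statePr, wrap, State.deg, wordPr, wordDeg_cons, letterDeg_some, Lab.deg_one, map_add]
    congr 3 <;> ring

theorem cycD_statePr (j : ℤ) (f : State → K) (w : State) :
    cycD c (P.statePr j f) w = P.statePr j (cycD c f) w := by
  induction w generalizing j f with
  | base x y => simp [cycD, statePr]
  | dot w ih =>
    have h : (fun w => P.statePr j f (.dot w)) = P.statePr (j - 1) fun w => f (.dot w) := by
      ext w; simp only [statePr, State.deg]; congr 2; ring
    have h' : (fun a l => P.statePr j f (.lett a l)) = P.wordPr j fun a l => f (.lett a l) := rfl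
    rw [cycD, h, h', ih, wrap_wordPr]
    simp only [statePr, cycD, State.deg, map_add, pr_sign]
    rw [show j - (w.deg + 1) = j - 1 - w.deg by ring]
  | lett a l => exact P.pathD_wordPr j _ a l

/-- Each step T ↦ X ⊗ T - 1 ⊗ XT lowers the degree by one, so the top cycle of b over n crossings
has degree `b.deg - n`. -/
theorem wordPr_top (j : ℤ) (α : Lab → K) (a : Lab) (l : Word) :
    P.wordPr j (top α) a l = top (fun b => P.pr (j - b.deg + l.length) (α b)) a l := by
  induction l generalizing j a with
  | nil => simp [wordPr, top]
  | cons o l ih =>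
    have ih' : ∀ i a', i = j + 1 - a'.deg - wordDeg l → P.pr i (top α a' l) =
        top (fun b => P.pr (j - b.deg + (l.length + 1)) (α b)) a' l := fun i a' hi => by
      have := ih (j + 1) a'
      rw [wordPr] at this
      rw [hi, show j + 1 - a'.deg - wordDeg l = j + 1 - (a'.deg + wordDeg l) by ring, this]
      congr 1; ext b; congr 2; ring
    rcases o with _ | _ | _ <;> cases a <;> simp only [wordPr, top, map_zero, map_neg,
      wordDeg_cons, letterDeg_some, Lab.deg_one, Lab.deg_X, List.length_cons, Nat.cast_add,
      Nat.cast_one]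
    · exact ih' _ _ (by simp)
    · rw [ih' _ .one (by simp)]
    · exact ih' _ _ (by simp; ring)

/-- Copy s of A sits behind `w.len - s` vertical crossings, followed by a top cycle over s - 1
crossings; its total degree is `w.len + b.deg - (2 * s - 1)`. -/
theorem statePr_gen (j : ℤ) (t : Lab → Lab → K) (α : ℕ → Lab → K) (w : State) :
    P.statePr j (gen t α) w = gen (fun x y => P.pr (j - w.len - x.deg - y.deg) (t x y))
      (fun s b => P.pr (j - w.len - b.deg + (2 * s - 1)) (α s b)) w := by
  induction w generalizing j with
  | base x y => simp [statePr, gen, State.deg, State.len, sub_sub]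
  | dot w ih =>
    have := ih (j - 1)
    simp only [statePr, gen, State.deg, State.len] at this ⊢
    rw [show j - (w.deg + 1) = j - 1 - w.deg by ring, this]
    push_cast
    simp only [sub_sub, add_comm]
  | lett a l =>
    have := P.wordPr_top j (α (l.length + 1)) a l
    simp only [statePr, gen, State.deg, State.len, wordPr] at this ⊢
    rw [this]
    congr 1; ext b; congr 2; push_cast; ring

end Components

/-! ### Labels of rows, and the edges of the cube -/

/-- The label of the row `s` of a word, where the row `0` has the label `b`. -/
def car : Lab → Word → ℕ → Lab
  | b, _, 0 => b
  | b, [], _ + 1 => b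
  | b, none :: l, s + 1 => car b l s
  | _, some b :: l, s + 1 => car b l s

@[simp] theorem car_zero (b : Lab) (l : Word) : car b l 0 = b := by cases l <;> rfl

@[simp] theorem car_none (b : Lab) (l : Word) (s : ℕ) : car b (none :: l) (s + 1) = car b l s := rfl

@[simp] theorem car_some (b b' : Lab) (l : Word) (s : ℕ) :
    car b (some b' :: l) (s + 1) = car b' l s := rfl

/-- The last letter of the word `a l`. -/
def lastLab : Lab → Word → Lab
  | a, [] => a
  | a, none :: l => lastLab a l
  | _, some b :: l => lastLab b l

theorem car_length (a : Lab) (l : Word) : car a l l.length = lastLab a l := by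
  induction l generalizing a with
  | nil => rfl
  | cons o l ih => cases o <;> exact ih _

/-- Replaces the last letter of the word `a l` by `x`. -/
def setLast : Lab → Word → Lab → Lab × Word
  | _, [], x => (x, [])
  | a, none :: l, x => ((setLast a l x).1, none :: (setLast a l x).2)
  | a, some b :: l, x => (a, some (setLast b l x).1 :: (setLast b l x).2)

/-- Makes the resolution of the crossing `t` of the word `a l` horizontal, with the labels `x`
below and `y` above. -/
def splitAt : ℕ → Lab → Word → Lab → Lab → Lab × Word
  | 0, _, none :: l, x, y => (x, some y :: l)
  | t + 1, a, none :: l, x, y => ((splitAt t a l x y).1, none :: (splitAt t a l x y).2)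
  | t + 1, a, some b :: l, x, y => (a, some (splitAt t b l x y).1 :: (splitAt t b l x y).2)
  | _, a, l, _, _ => (a, l)

namespace State

/-- The word of all resolutions of a state. -/
def word : State → Word
  | base _ _ => []
  | dot w => none :: w.word
  | lett a l => some a :: l

/-- The label of the row `0` on the strand `i`. -/
def last (i : Fin 2) : State → Lab
  | base x y => if i = 0 then x else y
  | dot w => w.last i
  | lett a l => lastLab a l

/-- All resolutions are vertical. -/
def IsBase : State → Prop
  | base _ _ => True
  | dot w => w.IsBase
  | lett _ _ => False

/-- The state with a given word, where `x` and `y` are the labels of the strands if all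
resolutions are vertical. -/
def ofWord : Word → Lab → Lab → State
  | [], x, y => base x y
  | none :: l, x, y => dot (ofWord l x y)
  | some a :: l, _, _ => lett a l

/-- The label of the row `s` on the strand `i`. -/
def row (i : Fin 2) (w : State) (s : ℕ) : Lab := car (w.last i) w.word s

@[simp] theorem length_word (w : State) : w.word.length = w.len := by
  induction w <;> simp_all [word, len]

@[simp] theorem word_ofWord (l : Word) (x y : Lab) : (ofWord l x y).word = l := by
  induction l with
  | nil => rfl
  | cons o l ih => cases o <;> simp [ofWord, word, ih]

theorem ofWord_word (w : State) : ofWord w.word (w.last 0) (w.last 1) = w := by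
  induction w with
  | base x y => rfl
  | dot w ih => exact congrArg dot ih
  | lett a l => rfl

theorem last_ofWord (l : Word) (x y : Lab) (i : Fin 2) :
    (ofWord l x y).last i = car (if i = 0 then x else y) l l.length := by
  induction l with
  | nil => simp [ofWord, last]
  | cons o l ih =>
    cases o with
    | none => exact ih
    | some b => exact (car_length b l).symm

theorem row_zero (i : Fin 2) (w : State) : w.row i 0 = w.last i := car_zero ..

theorem row_len (i : Fin 2) (w : State) : w.row i w.len = w.last i := by
  unfold row
  induction w with
  | base x y => rfl
  | dot w ih => exact ih
  | lett a l => exact car_length a l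

theorem last_eq {w : State} (h : ¬ w.IsBase) (i j : Fin 2) : w.last i = w.last j := by
  induction w with
  | base x y => exact absurd trivial h
  | dot w ih => exact ih h
  | lett a l => rfl

theorem row_eq {w : State} (h : ¬ w.IsBase) (i j : Fin 2) (s : ℕ) : w.row i s = w.row j s := by
  rw [row, row, last_eq h i j]

theorem isBase_iff (w : State) : w.IsBase ↔ ∀ o ∈ w.word, o = none := by
  induction w with
  | base x y => simp [IsBase, word]
  | dot w ih => simpa [IsBase, word] using ih
  | lett a l => simp [IsBase, word]

theorem dots_word (w : State) : Khovanov.dots w.word = w.dots := by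
  induction w with
  | base x y => rfl
  | dot w ih => simp [word, Khovanov.dots, dots, ih]
  | lett a l => rfl

/-- Replaces the last letter of a state by `x`. -/
def setLast : State → Lab → Word
  | base _ _, _ => []
  | dot w, x => none :: w.setLast x
  | lett a l, x => some (Khovanov.setLast a l x).1 :: (Khovanov.setLast a l x).2

/-- Makes the resolution of the crossing `t` horizontal, with the labels `x` below and `y` above. -/
def splitAt : ℕ → State → Lab → Lab → State
  | 0, dot w, x, y => lett y (w.setLast x)
  | t + 1, dot w, x, y => dot (splitAt t w x y)
  | t + 1, lett a l, x, y =>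
    lett (Khovanov.splitAt t a l x y).1 (Khovanov.splitAt t a l x y).2
  | _, w, _, _ => w

/-- Makes the resolution of the crossing `t` horizontal, with the label `b`, in a state with
vertical resolutions. -/
def joinAt : ℕ → State → Lab → State
  | 0, dot w, b => lett b w.word
  | t + 1, dot w, b => dot (joinAt t w b)
  | _, w, _ => w

end State

theorem map_isNone_setLast (a : Lab) (l : Word) (x : Lab) :
    (setLast a l x).2.map Option.isNone = l.map Option.isNone := by
  induction l generalizing a with
  | nil => rfl
  | cons o l ih => cases o <;> simp [setLast, ih]

theorem map_isNone_splitAt (t : ℕ) (a : Lab) (l : Word) (x y : Lab) :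
    (splitAt t a l x y).2.map Option.isNone = (l.map Option.isNone).set t false := by
  induction l generalizing a t with
  | nil => cases t <;> rfl
  | cons o l ih => cases o <;> cases t <;> simp [splitAt, ih]

theorem State.map_isNone_setLast {w : State} (h : ¬ w.IsBase) (x : Lab) :
    (w.setLast x).map Option.isNone = w.word.map Option.isNone := by
  induction w with
  | base x y => exact absurd trivial h
  | dot w ih => simp [setLast, word, ih h]
  | lett a l => simp [setLast, word, Khovanov.map_isNone_setLast]

theorem State.map_isNone_splitAt {w : State} (h : ¬ w.IsBase) (t : ℕ) (x y : Lab) :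
    (w.splitAt t x y).word.map Option.isNone = (w.word.map Option.isNone).set t false := by
  induction w generalizing t with
  | base x y => exact absurd trivial h
  | dot w ih =>
    cases t
    · simp [splitAt, word, map_isNone_setLast (w := w) h]
    · simp [splitAt, word, ih h]
  | lett a l => cases t <;> simp [splitAt, word, Khovanov.map_isNone_splitAt]

theorem State.map_isNone_joinAt {w : State} (h : w.IsBase) (t : ℕ) (b : Lab) :
    (w.joinAt t b).word.map Option.isNone = (w.word.map Option.isNone).set t false := by
  induction w generalizing t with
  | base x y => cases t <;> rfl
  | dot w ih =>
    cases t
    · simp [joinAt, word]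
    · simp [joinAt, word, ih h]
  | lett a l => exact h.elim

theorem car_eq_const (b : Lab) (l : Word) (h : ∀ o ∈ l, o = none ∨ o = some b) (s : ℕ) :
    car b l s = b := by
  induction l generalizing s with
  | nil => cases s <;> rfl
  | cons o l ih =>
    cases s with
    | zero => simp
    | succ s =>
      have := ih (fun o ho => h o (by simp [ho])) s
      rcases h o (by simp) with rfl | rfl <;> simpa using this

theorem State.row_joinAt {w : State} (h : w.IsBase) {t : ℕ} (ht : t < w.len) (b : Lab) (i : Fin 2)
    (s : ℕ) : (w.joinAt t b).row i s = b := by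
  have h1 : ∀ o ∈ (w.joinAt t b).word, o = none ∨ o = some b := by
    clear ht
    induction w generalizing t with
    | base x y => cases t <;> simp [joinAt, word]
    | dot w ih =>
      cases t with
      | zero => simpa [joinAt, word] using fun o ho => Or.inl ((isBase_iff w).1 h o ho)
      | succ t => simpa [joinAt, word] using @ih h t
    | lett a l => exact h.elim
  have h2 : (w.joinAt t b).last i = b := by
    clear h1
    induction w generalizing t with
    | base x y => simp [len] at ht
    | dot w ih =>
      cases t with
      | zero =>
        simp only [joinAt, last]
        rw [← car_length]
        exact car_eq_const b _ (fun o ho => Or.inl ((isBase_iff w).1 h o ho)) _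
      | succ t => exact @ih h t (by simpa [len] using ht)
    | lett a l => exact h.elim
  rw [row, h2]
  exact car_eq_const b _ h1 s

/-! ### Which rows of a word change their label under a saddle. -/

section Rows

variable {γ : Type*}

/-- The function g stands for the circle through a row: it is only assumed constant across vertical
crossings. Rows whose label can change are then shown to have the g-value of the last row, which
keeps these lemmas independent of the diagram. -/
theorem car_setLast (a : Lab) (l : Word) (g : ℕ → γ)
    (hg : ∀ s, l[s]? = some none → g s = g (s + 1)) (s : ℕ) (hs : s ≤ l.length) :
    (g s = g l.length ∧ ∀ x, car (setLast a l x).1 (setLast a l x).2 s = x) ∨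
      ∀ x, car (setLast a l x).1 (setLast a l x).2 s = car a l s := by
  induction l generalizing a g s with
  | nil =>
    obtain rfl : s = 0 := by simpa using hs
    simp [setLast]
  | cons o l ih =>
    have ih' := fun a s hs => ih a (fun s => g (s + 1)) (fun s h => hg (s + 1) (by simpa using h)) s hs
    cases o with
    | none =>
      cases s with
      | zero =>
        have := ih' a 0 (by simp)
        simp only [car_zero, zero_add] at this
        rw [← hg 0 (by simp)] at this
        simpa [setLast] using this
      | succ s => simpa [setLast] using ih' a s (by simpa using hs)
    | some b =>
      cases s with
      | zero => simp [setLast]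
      | succ s => simpa [setLast] using ih' b s (by simpa using hs)

theorem car_eq_or (l : Word) (g : ℕ → γ)
    (hg : ∀ s, l[s]? = some none → g s = g (s + 1)) (s : ℕ) (hs : s ≤ l.length) :
    (g s = g 0 ∧ ∀ y, car y l s = y) ∨ ∀ x y, car y l s = car x l s := by
  induction l generalizing g s with
  | nil =>
    obtain rfl : s = 0 := by simpa using hs
    simp
  | cons o l ih =>
    cases s with
    | zero => simp
    | succ s =>
      cases o with
      | none =>
        have := ih (fun s => g (s + 1)) (fun s h => hg (s + 1) (by simpa using h)) s (by simpa using hs)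
        simpa [hg 0 (by simp)] using this
      | some b => simp

/-- Every row of `splitAt t a l x y` belongs to the circle below the crossing `t`, to the one
above it, or keeps its label. -/
theorem car_splitAt (a : Lab) (l : Word) (t : ℕ) (ht : l[t]? = some none) (g : ℕ → γ)
    (hg : ∀ s, s ≠ t → l[s]? = some none → g s = g (s + 1)) (s : ℕ) (hs : s ≤ l.length) :
    (g s = g t ∧ ∀ x y, car (splitAt t a l x y).1 (splitAt t a l x y).2 s = x) ∨
    (g s = g (t + 1) ∧ ∀ x y, car (splitAt t a l x y).1 (splitAt t a l x y).2 s = y) ∨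
      ∀ x y, car (splitAt t a l x y).1 (splitAt t a l x y).2 s = car a l s := by
  induction l generalizing a t g s with
  | nil => simp at ht
  | cons o l ih =>
    cases t with
    | zero =>
      obtain rfl : o = none := by simpa using ht
      cases s with
      | zero => simp [splitAt]
      | succ s =>
        have := car_eq_or l (fun s => g (s + 1))
          (fun s h => hg (s + 1) (by simp) (by simpa using h)) s (by simpa using hs)
        rcases this with h | h
        · exact Or.inr (Or.inl ⟨h.1, fun _ y => h.2 y⟩)
        · exact Or.inr (Or.inr fun _ y => h a y)
    | succ t =>
      have ih' := fun a s hs => ih a t (by simpa using ht) (fun s => g (s + 1))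
        (fun s h1 h => hg (s + 1) (by simpa using h1) (by simpa using h)) s hs
      cases o with
      | none =>
        cases s with
        | zero =>
          have := ih' a 0 (by simp)
          simp only [car_zero, zero_add] at this
          rw [← hg 0 (by simp) (by simp)] at this
          simpa [splitAt] using this
        | succ s => simpa [splitAt] using ih' a s (by simpa using hs)
      | some b =>
        cases s with
        | zero => simp [splitAt]
        | succ s => simpa [splitAt] using ih' b s (by simpa using hs)

theorem length_splitAt (t : ℕ) (a : Lab) (l : Word) (x y : Lab) :
    (splitAt t a l x y).2.length = l.length := by
  simpa using congrArg List.length (map_isNone_splitAt t a l x y)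

theorem State.len_splitAt {w : State} (h : ¬ w.IsBase) (t : ℕ) (x y : Lab) :
    (w.splitAt t x y).len = w.len := by
  simpa using congrArg List.length (State.map_isNone_splitAt h t x y)

theorem State.len_joinAt {w : State} (h : w.IsBase) (t : ℕ) (b : Lab) :
    (w.joinAt t b).len = w.len := by
  simpa using congrArg List.length (State.map_isNone_joinAt h t b)

theorem lastLab_setLast (a : Lab) (l : Word) (x : Lab) :
    lastLab (setLast a l x).1 (setLast a l x).2 = x := by
  induction l generalizing a with
  | nil => rfl
  | cons o l ih => cases o <;> exact ih _

theorem State.lastLab_setLast {w : State} (h : ¬ w.IsBase) (x y : Lab) :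
    lastLab y (w.setLast x) = x := by
  induction w with
  | base x y => exact absurd trivial h
  | dot w ih => exact ih h
  | lett a l => exact Khovanov.lastLab_setLast a l x

theorem State.car_setLast {w : State} (h : ¬ w.IsBase) (g : ℕ → γ)
    (hg : ∀ s, w.word[s]? = some none → g s = g (s + 1)) (s : ℕ) (hs : s ≤ w.len) :
    (g s = g w.len ∧ ∀ x y, car y (w.setLast x) s = x) ∨
    (g s = g 0 ∧ ∀ x y, car y (w.setLast x) s = y) ∨
      ∀ x y z, car y (w.setLast x) s = car z w.word s := by
  induction w generalizing g s with
  | base x y => exact absurd trivial h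
  | dot w ih =>
    cases s with
    | zero => simp
    | succ s =>
      have := ih h (fun s => g (s + 1)) (fun s h => hg (s + 1) (by simpa [word] using h)) s
        (by simpa [len] using hs)
      simpa [hg 0 (by simp [word]), setLast, word, len] using this
  | lett a l =>
    cases s with
    | zero => simp
    | succ s =>
      have := Khovanov.car_setLast a l (fun s => g (s + 1))
        (fun s h => hg (s + 1) (by simpa [word] using h)) s (by simpa [len] using hs)
      rcases this with h | h
      · exact Or.inl ⟨h.1, fun x _ => h.2 x⟩
      · exact Or.inr (Or.inr fun x _ _ => h x)

/-- Every row of `w.splitAt t x y` belongs to the circle below the crossing `t`, to the one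
above it, or keeps its label. -/
theorem State.row_splitAt {w : State} (h : ¬ w.IsBase) (i : Fin 2) {t : ℕ}
    (ht : w.word[t]? = some none) (g : ℕ → γ)
    (hg : ∀ s, s ≠ t → w.word[s]? = some none → g s = g (s + 1)) (h0 : g w.len = g 0)
    (s : ℕ) (hs : s ≤ w.len) :
    (g s = g t ∧ ∀ x y, (w.splitAt t x y).row i s = x) ∨
    (g s = g (t + 1) ∧ ∀ x y, (w.splitAt t x y).row i s = y) ∨
      ∀ x y, (w.splitAt t x y).row i s = w.row i s := by
  induction w generalizing t g s with
  | base x y => exact absurd trivial h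
  | dot w ih =>
    cases t with
    | zero =>
      cases s with
      | zero => exact Or.inl ⟨rfl, fun x y => by rw [row_zero]; exact lastLab_setLast (w := w) h x y⟩
      | succ s =>
        have := State.car_setLast (w := w) h (fun s => g (s + 1))
          (fun s h => hg (s + 1) (by simp) (by simpa [word] using h)) s (by simpa [len] using hs)
        rcases this with ⟨h1, h2⟩ | ⟨h1, h2⟩ | h2
        · exact Or.inl ⟨h1.trans h0, h2⟩
        · exact Or.inr (Or.inl ⟨h1, h2⟩)
        · exact Or.inr (Or.inr fun x y => h2 x y _)
    | succ t =>
      have h1 : g 0 = g 1 := hg 0 (by simp) (by simp [word])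
      have ih' := fun s hs => ih h (t := t) (by simpa [word] using ht) (fun s => g (s + 1))
        (fun s h1 h => hg (s + 1) (by simpa using h1) (by simpa [word] using h))
        (h0.trans h1) s hs
      cases s with
      | zero =>
        have := ih' 0 (by simp)
        simp only [row_zero, zero_add, ← h1] at this
        simp only [row_zero]
        exact this
      | succ s => exact ih' s (by simpa [len] using hs)
  | lett a l =>
    cases t with
    | zero => simp [word] at ht
    | succ t =>
      have key := fun s hs => car_splitAt a l t (by simpa [word] using ht) (fun s => g (s + 1))
        (fun s h1 h => hg (s + 1) (by simpa using h1) (by simpa [word] using h)) s hs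
      cases s with
      | zero =>
        -- Row 0 of a closed word carries the label of the last letter, so it is treated as the
        -- final row and transported by `h0`.
        have := key l.length le_rfl
        simp only [row_zero, splitAt, last]
        simp only [← car_length, length_splitAt]
        simp only [len] at h0
        rw [← h0]
        exact this
      | succ s => exact key s (by simpa [len] using hs)

theorem car_splitAt_self (a : Lab) (l : Word) (t : ℕ) (ht : l[t]? = some none) (x y : Lab) :
    car (splitAt t a l x y).1 (splitAt t a l x y).2 t = x ∧
      car (splitAt t a l x y).1 (splitAt t a l x y).2 (t + 1) = y := by
  induction l generalizing a t with
  | nil => simp at ht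
  | cons o l ih =>
    cases t with
    | zero =>
      obtain rfl : o = none := by simpa using ht
      simp [splitAt]
    | succ t => cases o <;> simpa [splitAt] using ih _ t (by simpa using ht)

theorem State.row_splitAt_self {w : State} (h : ¬ w.IsBase) (i : Fin 2) {t : ℕ}
    (ht : w.word[t]? = some none) (x y : Lab) :
    (w.splitAt t x y).row i t = x ∧ (w.splitAt t x y).row i (t + 1) = y := by
  induction w generalizing t with
  | base x y => exact absurd trivial h
  | dot w ih =>
    cases t with
    | zero =>
      refine ⟨?_, by simp [row, splitAt, word]⟩
      rw [row_zero]
      exact lastLab_setLast (w := w) h x y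
    | succ t => exact ih h (t := t) (by simpa [word] using ht)
  | lett a l =>
    cases t with
    | zero => simp [word] at ht
    | succ t => exact car_splitAt_self a l t (by simpa [word] using ht) x y

end Rows

/-! ### The recursive differential as a signed sum over crossings. -/

section Edges

variable {K : Type} [CommRing K] (c : K)

/-- The component of `pathD` at the crossing `t`. -/
def pathEdge : ℕ → (Lab → Word → K) → Lab → Word → K
  | 0, q, a, none :: l => merge (fun a b l => q a (some b :: l)) a l
  | t + 1, q, a, none :: l => pathEdge t (fun a l => q a (none :: l)) a l
  | t + 1, q, a, some b :: l => pathEdge t (fun b l => q a (some b :: l)) b l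
  | _, _, _, _ => 0

/-- The component of `cycD` at the crossing `t`. -/
def cycEdge : ℕ → (State → K) → State → K
  | 0, f, .dot w => wrap c (fun a l => f (.lett a l)) w
  | t + 1, f, .dot w => cycEdge t (fun w => f (.dot w)) w
  | t + 1, f, .lett a l => pathEdge t (fun a l => f (.lett a l)) a l
  | _, _, _ => 0

/-- The sign of the edge at the crossing `t`. -/
def edgeSgn (t : ℕ) (l : Word) : ℤ := (-1) ^ dots (l.drop (t + 1))

theorem sum_lab {M : Type*} [AddCommMonoid M] (f : Lab → M) : ∑ b, f b = f .one + f .X := by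
  have : (Finset.univ : Finset Lab) = {.one, .X} := rfl
  rw [this, Finset.sum_pair (by simp)]

theorem pathD_eq_sum (q : Lab → Word → K) (a : Lab) (l : Word) :
    pathD q a l = ∑ t ∈ Finset.range l.length, edgeSgn t l * pathEdge t q a l := by
  induction l generalizing q a with
  | nil => rfl
  | cons o l ih =>
    rw [List.length_cons, Finset.sum_range_succ']
    cases o with
    | none => simp [pathD, ih, pathEdge, edgeSgn, eps]
    | some b => simp [pathD, ih, pathEdge, edgeSgn]

/-- Unfolding the iterated cones gives one term per crossing, with the sign counting the vertical
crossings after it, as in the cube of resolutions. -/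
theorem cycD_eq_sum (f : State → K) (w : State) :
    cycD c f w = ∑ t ∈ Finset.range w.len, edgeSgn t w.word * cycEdge c t f w := by
  induction w generalizing f with
  | base x y => rfl
  | dot w ih =>
    rw [State.len, Finset.sum_range_succ']
    simp [cycD, ih, cycEdge, edgeSgn, State.word, State.dots_word]
  | lett a l =>
    rw [State.len, Finset.sum_range_succ']
    simp [cycD, pathD_eq_sum, cycEdge, edgeSgn, State.word]

theorem pathEdge_of_ne (t : ℕ) (q : Lab → Word → K) (a : Lab) (l : Word)
    (h : l[t]? ≠ some none) : pathEdge t q a l = 0 := by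
  induction l generalizing q a t with
  | nil => cases t <;> rfl
  | cons o l ih =>
    cases t with
    | zero => cases o <;> simp_all [pathEdge]
    | succ t => cases o <;> exact ih _ _ _ (by simpa using h)

theorem cycEdge_of_ne (t : ℕ) (f : State → K) (w : State)
    (h : w.word[t]? ≠ some none) : cycEdge c t f w = 0 := by
  induction w generalizing f t with
  | base x y => cases t <;> rfl
  | dot w ih =>
    cases t with
    | zero => simp [State.word] at h
    | succ t => exact ih _ _ (by simpa [State.word] using h)
  | lett a l =>
    cases t with
    | zero => rfl
    | succ t => exact pathEdge_of_ne _ _ _ _ (by simpa [State.word] using h)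

theorem pathEdge_eq (t : ℕ) (q : Lab → Word → K) (a : Lab) (l : Word) (h : l[t]? = some none) :
    pathEdge t q a l = ∑ p : Lab × Lab,
      q (splitAt t a l p.1 p.2).1 (splitAt t a l p.1 p.2).2 * mulCoeff K p.1 p.2 (car a l t) := by
  induction l generalizing q a t with
  | nil => simp at h
  | cons o l ih =>
    cases t with
    | zero =>
      obtain rfl : o = none := by simpa using h
      rw [Fintype.sum_prod_type]
      cases a <;> simp [sum_lab, pathEdge, splitAt, mulCoeff, merge, lam]
    | succ t => cases o <;> simpa [pathEdge, splitAt] using ih t _ _ (by simpa using h)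

theorem setLast_lastLab (a : Lab) (l : Word) : setLast a l (lastLab a l) = (a, l) := by
  induction l generalizing a with
  | nil => rfl
  | cons o l ih => cases o <;> simp [setLast, lastLab, ih]

theorem rho_eq (q : Lab → Word → K) (a : Lab) (l : Word) :
    rho q a l = ∑ x, q (setLast a l x).1 (setLast a l x).2 * mulCoeff K x .X (lastLab a l) := by
  induction l generalizing q a with
  | nil => cases a <;> simp [rho, lam, sum_lab, setLast, lastLab, mulCoeff]
  | cons o l ih => cases o <;> simp [rho, ih, setLast, lastLab]

theorem wrap_eq (q : Lab → Word → K) (w : State) (h : ¬ w.IsBase) (i : Fin 2) :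
    wrap c q w = ∑ p : Lab × Lab, q p.2 (w.setLast p.1) * mulCoeff K p.1 p.2 (w.last i) := by
  induction w generalizing q with
  | base x y => exact absurd trivial h
  | dot w ih => exact ih _ h
  | lett b l =>
    have h1 : q .one (some b :: l) = ∑ x, q .one (State.setLast (.lett b l) x) *
        mulCoeff K x .one (lastLab b l) := by
      have e : State.setLast (.lett b l) (lastLab b l) = some b :: l := by
        simp [State.setLast, setLast_lastLab]
      rw [← e, sum_lab]
      cases lastLab b l <;> simp [mulCoeff]
    rw [wrap, rho_eq, Fintype.sum_prod_type_right, h1]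
    exact (sum_lab (fun y => ∑ x, q y (State.setLast (.lett b l) x) *
      mulCoeff K x y (lastLab b l))).symm

/-- If another crossing is horizontal, the saddle merges two circles. The strand i is arbitrary
because then both strands carry the same label in every row (`State.row_eq`). -/
theorem cycEdge_eq (t : ℕ) (f : State → K) (w : State) (hw : ¬ w.IsBase) (i : Fin 2)
    (h : w.word[t]? = some none) :
    cycEdge c t f w =
      ∑ p : Lab × Lab, f (w.splitAt t p.1 p.2) * mulCoeff K p.1 p.2 (w.row i t) := by
  induction w generalizing f t with
  | base x y => exact absurd trivial hw
  | dot w ih =>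
    cases t with
    | zero => rw [State.row_zero]; exact wrap_eq c _ w hw i
    | succ t => exact ih t _ hw (by simpa [State.word] using h)
  | lett a l =>
    cases t with
    | zero => simp [State.word] at h
    | succ t => exact pathEdge_eq t _ a l (by simpa [State.word] using h)

theorem wrap_eq_base (q : Lab → Word → K) (w : State) (h : w.IsBase) :
    wrap c q w = ∑ b, q b w.word * comulCoeff c b (w.last 0) (w.last 1) := by
  induction w generalizing q with
  | base x y => simp [wrap, comul, sum_lab, State.word, State.last]
  | dot w ih => exact ih _ h
  | lett b l => exact h.elim

theorem cycEdge_eq_base (t : ℕ) (f : State → K) (w : State) (hw : w.IsBase) (ht : t < w.len) :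
    cycEdge c t f w = ∑ b, f (w.joinAt t b) * comulCoeff c b (w.last 0) (w.last 1) := by
  induction w generalizing f t with
  | base x y => simp [State.len] at ht
  | dot w ih =>
    cases t with
    | zero => exact wrap_eq_base c _ w hw
    | succ t => exact ih t _ hw (by simpa [State.len] using ht)
  | lett a l => exact hw.elim

end Edges

/-! ### The circles of the resolutions of the torus link diagram -/

section Torus

variable {k : ℕ} (hk : 0 < k)

/-- The circles of the resolution `D(L)` of the diagram of `T_{2,k}`. -/
def TorusCircles (L : Finset (Fin k)) : Type := (torusDiagram k hk).Circles L

instance (L : Finset (Fin k)) : Fintype (TorusCircles hk L) :=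
  @PlaneDiagram.instFintypeCircles (torusDiagram k hk) L

instance (L : Finset (Fin k)) : DecidableEq (TorusCircles hk L) :=
  @PlaneDiagram.instDecidableEqCircles (torusDiagram k hk) L

/-- The arc on the strand `i` in the row `s`, modulo `k`. -/
def rowArc (i : Fin 2) (s : ℕ) : Fin k × Fin 2 := (⟨s % k, Nat.mod_lt _ hk⟩, i)

/-- The circle through an arc. -/
def torusCircle (L : Finset (Fin k)) (u : Fin k × Fin 2) : TorusCircles hk L :=
  (torusDiagram k hk).circle L u

/-- The circle through the strand `i` in the row `s`, modulo `k`. -/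
def rowCircle (L : Finset (Fin k)) (i : Fin 2) (s : ℕ) : TorusCircles hk L :=
  torusCircle hk L (rowArc hk i s)

theorem rowArc_val (i : Fin 2) (t : Fin k) : rowArc hk i t = (t, i) := by
  simp [rowArc, Nat.mod_eq_of_lt t.2]

theorem rowArc_succ (i : Fin 2) (t : Fin k) : rowArc hk i (t + 1) = (finRotate k t, i) := by
  obtain ⟨m, rfl⟩ : ∃ m, k = m + 1 := ⟨k - 1, by omega⟩
  refine Prod.ext (Fin.ext ?_) rfl
  rw [coe_finRotate]
  simp only [rowArc]
  split_ifs with h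
  · subst h; simp
  · exact Nat.mod_eq_of_lt (by have := Fin.val_lt_last h; omega)

theorem arc_zero (t : Fin k) : (torusDiagram k hk).arc t 0 = rowArc hk 0 t :=
  (rowArc_val hk 0 t).symm

theorem arc_one (t : Fin k) : (torusDiagram k hk).arc t 1 = rowArc hk 1 t :=
  (rowArc_val hk 1 t).symm

theorem arc_two (t : Fin k) : (torusDiagram k hk).arc t 2 = rowArc hk 1 (t + 1) :=
  (rowArc_succ hk 1 t).symm

theorem arc_three (t : Fin k) : (torusDiagram k hk).arc t 3 = rowArc hk 0 (t + 1) :=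
  (rowArc_succ hk 0 t).symm

theorem rowCircle_add (L : Finset (Fin k)) (i : Fin 2) (s n : ℕ) :
    rowCircle hk L i (s + k * n) = rowCircle hk L i s := by
  simp [rowCircle, rowArc]

theorem rowCircle_len (L : Finset (Fin k)) (i : Fin 2) :
    rowCircle hk L i k = rowCircle hk L i 0 := by
  simp [rowCircle, rowArc]

theorem exists_rowCircle (L : Finset (Fin k)) (C : TorusCircles hk L) :
    ∃ i, ∃ s < k, C = rowCircle hk L i s := by
  obtain ⟨u⟩ := C
  exact ⟨u.2, u.1, u.1.2, congrArg _ (rowArc_val hk u.2 u.1).symm⟩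

theorem circle_eq_rowCircle (L : Finset (Fin k)) (u : Fin k × Fin 2) :
    torusCircle hk L u = rowCircle hk L u.2 u.1 :=
  congrArg _ (rowArc_val hk u.2 u.1).symm

theorem rowCircle_of_mem {L : Finset (Fin k)} (i : Fin 2) {t : Fin k} (h : t ∈ L) :
    rowCircle hk L i t = rowCircle hk L i (t + 1) := by
  refine Quot.sound ⟨t, Or.inr ⟨h, ?_⟩⟩
  rw [arc_zero, arc_one, arc_two, arc_three]
  fin_cases i
  · exact Or.inl ⟨rfl, rfl⟩
  · exact Or.inr ⟨rfl, rfl⟩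

theorem rowCircle_of_notMem {L : Finset (Fin k)} {t : Fin k} (h : t ∉ L) :
    rowCircle hk L 0 t = rowCircle hk L 1 t ∧
      rowCircle hk L 0 (t + 1) = rowCircle hk L 1 (t + 1) := by
  refine ⟨Quot.sound ⟨t, Or.inl ⟨h, ?_⟩⟩, (Quot.sound ⟨t, Or.inl ⟨h, ?_⟩⟩ : _ = _).symm⟩
  · rw [arc_zero, arc_one]
    exact Or.inl ⟨rfl, rfl⟩
  · rw [arc_two, arc_three]
    exact Or.inr ⟨rfl, rfl⟩

theorem rowCircle_mod (L : Finset (Fin k)) (i : Fin 2) (s : ℕ) :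
    rowCircle hk L i (s % k) = rowCircle hk L i s := by
  simp [rowCircle, rowArc]

theorem rowCircle_succ_mod (L : Finset (Fin k)) (i : Fin 2) (s : ℕ) :
    rowCircle hk L i (s % k + 1) = rowCircle hk L i (s + 1) := by
  simp [rowCircle, rowArc]

/-- A horizontal crossing joins the two strands; going up from it, each further crossing either
continues both strands or joins them anew, and the closure reaches every row. -/
theorem rowCircle_eq {L : Finset (Fin k)} (h : ∃ t, t ∉ L) (i j : Fin 2) (s : ℕ) :
    rowCircle hk L i s = rowCircle hk L j s := by
  suffices h : rowCircle hk L 0 s = rowCircle hk L 1 s by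
    fin_cases i <;> fin_cases j <;> first | rfl | exact h | exact h.symm
  obtain ⟨t, ht⟩ := h
  have key : ∀ n, rowCircle hk L 0 (t + n) = rowCircle hk L 1 (t + n) := by
    intro n
    induction n with
    | zero => exact (rowCircle_of_notMem hk ht).1
    | succ n ih =>
      have e : ∀ i, rowCircle hk L i ((t + n) % k + 1) = rowCircle hk L i (t + (n + 1)) :=
        fun i => rowCircle_succ_mod hk L i _
      by_cases hm : (⟨(t + n) % k, Nat.mod_lt _ hk⟩ : Fin k) ∈ L
      · rw [← e, ← e, ← rowCircle_of_mem hk 0 hm, ← rowCircle_of_mem hk 1 hm, rowCircle_mod,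
          rowCircle_mod, ih]
      · rw [← e, ← e]
        exact (rowCircle_of_notMem hk hm).2
  -- Going up by s + kt - t rows from row t ends in row s modulo k without leaving ℕ.
  have h1 : (t : ℕ) ≤ k * t := Nat.le_mul_of_pos_left _ hk
  have := key (s + k * t - t)
  rw [show (t : ℕ) + (s + k * t - t) = s + k * t by omega] at this
  simpa only [rowCircle_add] using this

/-- The crossings of a state with vertical resolution. -/
def State.vert (k : ℕ) (w : State) : Finset (Fin k) :=
  Finset.univ.filter fun t => w.word[(t : ℕ)]? = some none

@[simp] theorem State.mem_vert {w : State} {t : Fin k} :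
    t ∈ w.vert k ↔ w.word[(t : ℕ)]? = some none := by simp [vert]

theorem car_succ_of_none {b : Lab} {l : Word} {s : ℕ} (h : l[s]? = some none) :
    car b l (s + 1) = car b l s := by
  induction l generalizing b s with
  | nil => simp at h
  | cons o l ih =>
    cases s with
    | zero =>
      obtain rfl : o = none := by simpa using h
      simp
    | succ s => cases o <;> exact ih (by simpa using h)

theorem car_succ_of_some {b a : Lab} {l : Word} {s : ℕ} (h : l[s]? = some (some a)) :
    car b l (s + 1) = a := by
  induction l generalizing b s with
  | nil => simp at h
  | cons o l ih =>
    cases s with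
    | zero =>
      obtain rfl : o = some a := by simpa using h
      simp
    | succ s => cases o <;> exact ih (by simpa using h)

/-- The state of a labelling of the circles of a resolution. -/
def toState (L : Finset (Fin k)) (σ : TorusCircles hk L → Lab) : State :=
  .ofWord (List.ofFn fun t : Fin k => if t ∈ L then none else some (σ (rowCircle hk L 0 (t + 1))))
    (σ (rowCircle hk L 0 0)) (σ (rowCircle hk L 1 0))

@[simp] theorem len_toState (L : Finset (Fin k)) (σ : TorusCircles hk L → Lab) :
    (toState hk L σ).len = k := by
  rw [← State.length_word]; simp [toState]

theorem word_toState (L : Finset (Fin k)) (σ : TorusCircles hk L → Lab) (t : Fin k) :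
    (toState hk L σ).word[(t : ℕ)]? =
      some (if t ∈ L then none else some (σ (rowCircle hk L 0 (t + 1)))) := by
  simp [toState]

@[simp] theorem vert_toState (L : Finset (Fin k)) (σ : TorusCircles hk L → Lab) :
    (toState hk L σ).vert k = L := by
  ext t
  rw [State.mem_vert, word_toState]
  split_ifs with h <;> simp [h]

theorem row_toState (L : Finset (Fin k)) (σ : TorusCircles hk L → Lab) (i : Fin 2)
    (s : ℕ) (hs : s ≤ k) : (toState hk L σ).row i s = σ (rowCircle hk L i s) := by
  have key : ∀ s ≤ k, car (σ (rowCircle hk L i 0)) (toState hk L σ).word s =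
      σ (rowCircle hk L i s) := by
    intro s
    induction s with
    | zero => simp
    | succ s ih =>
      intro hs
      have hw := word_toState hk L σ ⟨s, hs⟩
      by_cases hm : (⟨s, hs⟩ : Fin k) ∈ L
      · rw [if_pos hm] at hw
        rw [car_succ_of_none hw, ih (by omega)]
        exact congrArg σ (rowCircle_of_mem hk i hm)
      · rw [if_neg hm] at hw
        rw [car_succ_of_some hw]
        exact congrArg σ (rowCircle_eq hk ⟨_, hm⟩ 0 i _)
  have hlast : (toState hk L σ).last i = σ (rowCircle hk L i 0) := by
    have h := State.last_ofWord (toState hk L σ).word (σ (rowCircle hk L 0 0))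
      (σ (rowCircle hk L 1 0)) i
    have e : (if i = 0 then σ (rowCircle hk L 0 0) else σ (rowCircle hk L 1 0)) =
        σ (rowCircle hk L i 0) := by fin_cases i <;> rfl
    rw [e, State.length_word, len_toState, key k le_rfl, rowCircle_len] at h
    rw [← h]
    conv_lhs => rw [toState]
    rw [toState, State.word_ofWord]
  rw [State.row, hlast, key s hs]

theorem toState_eq {L : Finset (Fin k)} {σ : TorusCircles hk L → Lab} {w : State}
    (hw : w.len = k) (hL : w.vert k = L)
    (hσ : ∀ (i : Fin 2), ∀ s < k, σ (rowCircle hk L i s) = w.row i s) : toState hk L σ = w := by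
  have hσ' : ∀ (i : Fin 2), ∀ s ≤ k, σ (rowCircle hk L i s) = w.row i s := fun i s hs => by
    rcases hs.lt_or_eq with h | rfl
    · exact hσ i s h
    · rw [rowCircle_len, hσ i 0 hk, State.row_zero, ← hw, State.row_len]
  rw [toState, hσ' 0 0 hk.le, hσ' 1 0 hk.le, State.row_zero, State.row_zero]
  conv_rhs => rw [← State.ofWord_word w]
  congr 1
  refine List.ext_getElem (by simp [hw]) fun s h1 h2 => ?_
  have hs : s < k := by simpa using h1
  rw [List.getElem_ofFn]
  have hm : (⟨s, hs⟩ : Fin k) ∈ L ↔ w.word[s] = none := by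
    rw [← hL, State.mem_vert, List.getElem?_eq_getElem h2]; simp
  split_ifs with h
  · exact (hm.1 h).symm
  · obtain ⟨a, ha⟩ := Option.ne_none_iff_exists'.1 fun h' => h (hm.2 h')
    rw [ha, hσ' 0 (s + 1) hs, State.row, car_succ_of_some]
    rw [List.getElem?_eq_getElem h2, ha]

theorem State.isBase_iff_vert {w : State} (hw : w.len = k) :
    w.IsBase ↔ ∀ t : Fin k, t ∈ w.vert k := by
  rw [isBase_iff, List.forall_mem_iff_getElem]
  simp only [mem_vert]
  constructor
  · intro h t
    have ht : (t : ℕ) < w.word.length := by simp [hw]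
    rw [List.getElem?_eq_getElem ht, h _ ht]
  · intro h s hs
    have := h ⟨s, by simpa [hw] using hs⟩
    simpa [List.getElem?_eq_getElem hs] using this

/-- The labelling of the circles given by a state. -/
def State.label (w : State) (hw : w.len = k) : TorusCircles hk (w.vert k) → Lab :=
  Quot.lift (fun u : Fin k × Fin 2 => w.row u.2 u.1) (by
    have hrow : ∀ (i : Fin 2) (s : ℕ), s ≤ k →
        (fun u : Fin k × Fin 2 => w.row u.2 u.1) (rowArc hk i s) = w.row i s := fun i s hs => by
      rcases hs.lt_or_eq with h | rfl
      · simp [rowArc, Nat.mod_eq_of_lt h]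
      · simp only [rowArc, Nat.mod_self]
        rw [row_zero, ← row_len i w, hw]
    rintro u v ⟨t, ⟨ht, h⟩ | ⟨ht, h⟩⟩
    all_goals
      have ht1 : (t : ℕ) ≤ k := t.2.le
      have ht2 : (t : ℕ) + 1 ≤ k := t.2
      erw [arc_zero, arc_one, arc_two, arc_three] at h
    · have hb : ¬ w.IsBase := fun hb => ht ((isBase_iff_vert hw).1 hb t)
      rcases h with ⟨rfl, rfl⟩ | ⟨rfl, rfl⟩
      · exact (hrow 0 t ht1).trans ((row_eq hb 0 1 t).trans (hrow 1 t ht1).symm)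
      · exact (hrow 1 _ ht2).trans ((row_eq hb 1 0 _).trans (hrow 0 _ ht2).symm)
    · have hc : ∀ i, w.row i (t + 1) = w.row i t :=
        fun i => car_succ_of_none (State.mem_vert.1 ht)
      rcases h with ⟨rfl, rfl⟩ | ⟨rfl, rfl⟩
      · exact (hrow 0 _ ht1).trans ((hc 0).symm.trans (hrow 0 _ ht2).symm)
      · exact (hrow 1 _ ht1).trans ((hc 1).symm.trans (hrow 1 _ ht2).symm))

theorem State.label_rowCircle (w : State) (hw : w.len = k) (i : Fin 2) (s : ℕ) (hs : s < k) :
    w.label hk hw (rowCircle hk _ i s) = w.row i s := by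
  change w.row i (s % k) = _
  rw [Nat.mod_eq_of_lt hs]

theorem toState_label (w : State) (hw : w.len = k) :
    toState hk (w.vert k) (w.label hk hw) = w :=
  toState_eq hk hw rfl fun i s hs => State.label_rowCircle hk w hw i s hs

/-- Besides surjectivity of `toState`, this provides a way to tell circles apart: a state with
different labels in two rows forces these rows onto different circles. -/
theorem exists_label {L : Finset (Fin k)} (w : State) (hw : w.len = k) (hL : w.vert k = L) :
    ∃ σ : TorusCircles hk L → Lab, toState hk L σ = w := by
  subst hL
  exact ⟨_, toState_label hk w hw⟩

theorem toState_injective (L : Finset (Fin k)) : Function.Injective (toState hk L) := by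
  intro σ τ h
  ext C
  obtain ⟨i, s, hs, rfl⟩ := exists_rowCircle hk L C
  rw [← row_toState hk L σ i s hs.le, h, row_toState hk L τ i s hs.le]

/-! ### Degrees and signs -/

theorem dots_drop (l : Word) (m : ℕ) {n : ℕ} (hn : l.length = n) : dots (l.drop m) =
    (Finset.univ.filter fun t : Fin n => m ≤ t ∧ l[(t : ℕ)]? = some none).card := by
  subst hn
  induction l generalizing m with
  | nil => simp [dots]
  | cons o l ih =>
    rw [List.length_cons, Fin.card_filter_univ_succ]
    cases m with
    | zero =>
      have := ih 0
      simp only [List.drop_zero, zero_le, true_and] at this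
      cases o <;> simp [dots, this]
    | succ m => simp [ih m]

theorem dots_toState (L : Finset (Fin k)) (σ : TorusCircles hk L → Lab) :
    (toState hk L σ).dots = L.card := by
  have h := dots_drop (toState hk L σ).word 0 (n := k) (by simp)
  rw [List.drop_zero, State.dots_word] at h
  rw [h]
  simp only [zero_le, true_and]
  exact congrArg Finset.card (vert_toState hk L σ)

theorem edgeSgn_toState (L : Finset (Fin k)) (τ : TorusCircles hk L → Lab)
    (t : Fin k) : edgeSgn t (toState hk L τ).word =
      (torusDiagram k hk).edgeSign t (L.erase t) := by
  rw [edgeSgn, dots_drop (toState hk L τ).word (t + 1) (n := k) (by simp)]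
  change _ = (-1 : ℤ) ^ ((L.erase t).filter fun b => t < b).card
  congr 2
  ext b
  rw [Finset.mem_filter, Finset.mem_filter, word_toState]
  rw [Finset.mem_erase, Fin.lt_def]
  by_cases hb : b ∈ L
  · simp only [Finset.mem_univ, hb, if_true, and_true, true_and, ne_eq]
    exact ⟨fun h => ⟨fun e => by subst e; omega, h⟩, fun h => h.2⟩
  · simp [hb]

/-- Circles starting above different horizontal crossings are separated by the state that has the
label X above s and 1 above all others. -/
theorem rowCircle_injOn {L : Finset (Fin k)} {s t : Fin k} (hs : s ∉ L) (ht : t ∉ L)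
    (h : rowCircle hk L 0 (s + 1) = rowCircle hk L 0 (t + 1)) : s = t := by
  by_contra hne
  set w : State := .ofWord (List.ofFn fun r : Fin k =>
    if r ∈ L then none else some (if r = s then Lab.X else Lab.one)) .one .one with hw
  have hlen : w.len = k := by rw [← State.length_word]; simp [hw]
  have hword : ∀ r : Fin k, w.word[(r : ℕ)]? =
      some (if r ∈ L then none else some (if r = s then Lab.X else Lab.one)) := fun r => by simp [hw]
  have hL : w.vert k = L := by
    ext r
    rw [State.mem_vert, hword]
    split_ifs with h <;> simp [h]
  obtain ⟨σ, hσ⟩ := exists_label hk w hlen hL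
  have h1 := row_toState hk L σ 0 (s + 1) s.2
  have h2 := row_toState hk L σ 0 (t + 1) t.2
  rw [hσ, State.row, car_succ_of_some (a := .X) (by rw [hword]; simp [hs])] at h1
  rw [hσ, State.row, car_succ_of_some (a := .one) (by rw [hword]; simp [ht, Ne.symm hne])] at h2
  rw [h, ← h2] at h1
  simp at h1

/-- Together with `rowCircle_injOn` this puts the circles in bijection with the horizontal
crossings, as soon as there is one. -/
theorem exists_notMem_rowCircle {L : Finset (Fin k)} (h : ∃ t, t ∉ L)
    (C : TorusCircles hk L) : ∃ t, t ∉ L ∧ rowCircle hk L 0 (t + 1) = C := by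
  obtain ⟨i, s, hs, rfl⟩ := exists_rowCircle hk L C
  obtain ⟨t, ht⟩ := h
  rw [rowCircle_eq hk ⟨t, ht⟩ i 0]
  have key : ∀ n, ∃ r, r ∉ L ∧ rowCircle hk L 0 (r + 1) = rowCircle hk L 0 (t + 1 + n) := by
    intro n
    induction n with
    | zero => exact ⟨t, ht, rfl⟩
    | succ n ih =>
      have e : rowCircle hk L 0 ((t + 1 + n) % k + 1) = rowCircle hk L 0 (t + 1 + (n + 1)) :=
        rowCircle_succ_mod hk L 0 _
      by_cases hm : (⟨(t + 1 + n) % k, Nat.mod_lt _ hk⟩ : Fin k) ∈ L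
      · obtain ⟨r, hr, h⟩ := ih
        refine ⟨r, hr, ?_⟩
        rw [h, ← e, ← rowCircle_of_mem hk 0 hm, rowCircle_mod]
      · exact ⟨_, hm, e⟩
  obtain ⟨r, hr, h⟩ := key (s + k * (t + 1) - (t + 1))
  refine ⟨r, hr, h.trans ?_⟩
  have h1 : (t : ℕ) + 1 ≤ k * (t + 1) := Nat.le_mul_of_pos_left _ hk
  rw [show (t : ℕ) + 1 + (s + k * (t + 1) - (t + 1)) = s + k * (t + 1) by omega, rowCircle_add]

theorem deg_ofWord {l : Word} (x y : Lab) (h : ∃ o ∈ l, o ≠ none) :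
    (State.ofWord l x y).deg = wordDeg l := by
  induction l with
  | nil => simp at h
  | cons o l ih =>
    cases o with
    | none => simp [State.ofWord, State.deg, ih (by simpa using h), add_comm]
    | some b => simp [State.ofWord, State.deg]

theorem deg_ofWord_base {l : Word} (x y : Lab) (h : ∀ o ∈ l, o = none) :
    (State.ofWord l x y).deg = x.deg + y.deg + l.length := by
  induction l with
  | nil => simp [State.ofWord, State.deg]
  | cons o l ih =>
    obtain rfl : o = none := h o (by simp)
    simp [State.ofWord, State.deg, ih fun o ho => h o (by simp [ho]), add_assoc]

theorem rowCircle_univ_ne :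
    rowCircle hk Finset.univ 0 0 ≠ rowCircle hk Finset.univ 1 0 := by
  intro e
  have hl : (State.ofWord (List.replicate k none) .one .X).len = k := by
    rw [← State.length_word]; simp
  obtain ⟨σ, hσ⟩ := exists_label hk (L := Finset.univ)
    (.ofWord (List.replicate k none) .one .X) hl (by ext t; simp)
  have h0 := row_toState hk _ σ 0 0 hk.le
  have h1 := row_toState hk _ σ 1 0 hk.le
  rw [← e, ← h0, hσ, State.row_zero, State.row_zero, State.last_ofWord, State.last_ofWord,
    car_eq_const _ _ (by simp +contextual [List.mem_replicate]),
    car_eq_const _ _ (by simp +contextual [List.mem_replicate])] at h1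
  simp at h1

theorem rowCircle_univ (i : Fin 2) (s : ℕ) :
    rowCircle hk Finset.univ i s = rowCircle hk Finset.univ i 0 := by
  induction s with
  | zero => rfl
  | succ s ih =>
    rw [← ih, ← rowCircle_succ_mod, ← rowCircle_mod hk _ i s]
    exact (rowCircle_of_mem hk i (t := ⟨s % k, Nat.mod_lt _ hk⟩) (Finset.mem_univ _)).symm

/-- With a horizontal crossing, the letters of the word are exactly the circles and the vertical
crossings. Otherwise there are exactly two circles, the two strands. -/
theorem deg_toState (L : Finset (Fin k)) (σ : TorusCircles hk L → Lab) :
    (toState hk L σ).deg = ∑ C, (σ C).deg + L.card := by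
  by_cases h : ∃ t, t ∉ L
  · rw [toState, deg_ofWord]
    swap
    · obtain ⟨t, ht⟩ := h
      exact ⟨_, List.mem_ofFn.2 ⟨t, rfl⟩, by simp [ht]⟩
    rw [wordDeg, List.map_ofFn, List.sum_ofFn]
    have e : ∀ t : Fin k, (letterDeg ∘ fun t : Fin k =>
        if t ∈ L then none else some (σ (rowCircle hk L 0 (t + 1)))) t =
        (if t ∈ L then (1 : ℤ) else 0) +
          if t ∈ Lᶜ then (σ (rowCircle hk L 0 (t + 1))).deg else 0 := fun t => by
      by_cases ht : t ∈ L <;> simp [ht]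
    rw [Finset.sum_congr rfl fun t _ => e t, Finset.sum_add_distrib, ← Finset.sum_filter,
      ← Finset.sum_filter, add_comm]
    congr 1
    · refine Finset.sum_bij (fun t _ => rowCircle hk L 0 (t + 1)) (by simp) ?_ ?_ (by simp)
      · intro s hs t ht e
        exact rowCircle_injOn hk (by simpa using hs) (by simpa using ht) e
      · intro C _
        obtain ⟨t, ht, rfl⟩ := exists_notMem_rowCircle hk h C
        exact ⟨t, by simpa using ht, rfl⟩
    · simp
  · push Not at h
    obtain rfl : L = Finset.univ := by ext t; simp [h t]
    rw [toState, deg_ofWord_base _ _ (by simp)]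
    have huniv : (Finset.univ : Finset (TorusCircles hk Finset.univ)) =
        {rowCircle hk Finset.univ 0 0, rowCircle hk Finset.univ 1 0} := by
      ext C
      obtain ⟨i, s, hs, rfl⟩ := exists_rowCircle hk _ C
      rw [rowCircle_univ hk i s]
      fin_cases i <;> simp
    rw [huniv, Finset.sum_pair (rowCircle_univ_ne hk)]
    simp

end Torus

/-! ### The differential of the torus link diagram -/

section Differential

variable {k : ℕ} (hk : 0 < k) {K : Type} [CommRing K] (c : K)

theorem mem_vert_iff_isNone {w : State} {t : Fin k} :
    t ∈ w.vert k ↔ (w.word.map Option.isNone)[(t : ℕ)]? = some true := by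
  rw [State.mem_vert, List.getElem?_map]
  rcases w.word[(t : ℕ)]? with _ | _ | _ <;> simp

theorem vert_eq_erase {w w' : State} {t : Fin k}
    (h : w'.word.map Option.isNone = (w.word.map Option.isNone).set t false) :
    w'.vert k = (w.vert k).erase t := by
  ext s
  rw [Finset.mem_erase, mem_vert_iff_isNone, mem_vert_iff_isNone, h, List.getElem?_set]
  by_cases hs : s = t
  · subst hs; simp
  · simp [hs, Ne.symm (Fin.val_ne_of_ne hs)]

theorem saddleCoeff_of_not (D : PlaneDiagram) {a : Fin D.n} {L L' : Finset (Fin D.n)}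
    {σ : D.Circles L → Lab} {τ : D.Circles L' → Lab}
    (h : ¬ ∀ u, D.circle L u ≠ D.circle L (D.arc a 0) → D.circle L u ≠ D.circle L (D.arc a 2) →
      σ (D.circle L u) = τ (D.circle L' u)) : D.saddleCoeff c a L L' σ τ = 0 := if_neg h

theorem saddleCoeff_of_merge (D : PlaneDiagram) {a : Fin D.n} {L L' : Finset (Fin D.n)}
    {σ : D.Circles L → Lab} {τ : D.Circles L' → Lab}
    (h : ∀ u, D.circle L u ≠ D.circle L (D.arc a 0) → D.circle L u ≠ D.circle L (D.arc a 2) →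
      σ (D.circle L u) = τ (D.circle L' u))
    (h1 : D.circle L (D.arc a 0) ≠ D.circle L (D.arc a 2))
    (h2 : D.circle L' (D.arc a 0) = D.circle L' (D.arc a 2)) :
    D.saddleCoeff c a L L' σ τ = mulCoeff K (σ (D.circle L (D.arc a 0)))
      (σ (D.circle L (D.arc a 2))) (τ (D.circle L' (D.arc a 0))) :=
  (if_pos h).trans (if_pos ⟨h1, h2⟩)

theorem saddleCoeff_of_split (D : PlaneDiagram) {a : Fin D.n} {L L' : Finset (Fin D.n)}
    {σ : D.Circles L → Lab} {τ : D.Circles L' → Lab}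
    (h : ∀ u, D.circle L u ≠ D.circle L (D.arc a 0) → D.circle L u ≠ D.circle L (D.arc a 2) →
      σ (D.circle L u) = τ (D.circle L' u))
    (h1 : D.circle L (D.arc a 0) = D.circle L (D.arc a 2))
    (h2 : D.circle L' (D.arc a 0) ≠ D.circle L' (D.arc a 2)) :
    D.saddleCoeff c a L L' σ τ = comulCoeff c (σ (D.circle L (D.arc a 0)))
      (τ (D.circle L' (D.arc a 0))) (τ (D.circle L' (D.arc a 2))) :=
  (if_pos h).trans ((if_neg fun h => h.1 h1).trans (if_pos ⟨h1, h2⟩))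

/-- The matrix coefficients of the saddle maps of the torus link diagram. -/
def torusSaddle (t : Fin k) (L L' : Finset (Fin k)) (σ : TorusCircles hk L → Lab)
    (τ : TorusCircles hk L' → Lab) : K :=
  (torusDiagram k hk).saddleCoeff c t L L' σ τ

section Saddle

variable {hk c} {t : Fin k} {L L' : Finset (Fin k)} {σ : TorusCircles hk L → Lab}
  {τ : TorusCircles hk L' → Lab}

theorem torusSaddle_of_not
    (h : ¬ ∀ u, torusCircle hk L u ≠ rowCircle hk L 0 t →
      torusCircle hk L u ≠ rowCircle hk L 1 (t + 1) →
      σ (torusCircle hk L u) = τ (torusCircle hk L' u)) : torusSaddle hk c t L L' σ τ = 0 := by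
  simp only [rowCircle, ← arc_zero hk t, ← arc_two hk t] at h
  exact saddleCoeff_of_not c _ h

theorem torusSaddle_of_merge
    (h : ∀ u, torusCircle hk L u ≠ rowCircle hk L 0 t →
      torusCircle hk L u ≠ rowCircle hk L 1 (t + 1) →
      σ (torusCircle hk L u) = τ (torusCircle hk L' u))
    (h1 : rowCircle hk L 0 t ≠ rowCircle hk L 1 (t + 1))
    (h2 : rowCircle hk L' 0 t = rowCircle hk L' 1 (t + 1)) :
    torusSaddle hk c t L L' σ τ = mulCoeff K (σ (rowCircle hk L 0 t))
      (σ (rowCircle hk L 1 (t + 1))) (τ (rowCircle hk L' 0 t)) := by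
  simp only [rowCircle, ← arc_zero hk t, ← arc_two hk t] at h h1 h2 ⊢
  exact saddleCoeff_of_merge c _ h h1 h2

theorem torusSaddle_of_split
    (h : ∀ u, torusCircle hk L u ≠ rowCircle hk L 0 t →
      torusCircle hk L u ≠ rowCircle hk L 1 (t + 1) →
      σ (torusCircle hk L u) = τ (torusCircle hk L' u))
    (h1 : rowCircle hk L 0 t = rowCircle hk L 1 (t + 1))
    (h2 : rowCircle hk L' 0 t ≠ rowCircle hk L' 1 (t + 1)) :
    torusSaddle hk c t L L' σ τ = comulCoeff c (σ (rowCircle hk L 0 t))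
      (τ (rowCircle hk L' 0 t)) (τ (rowCircle hk L' 1 (t + 1))) := by
  simp only [rowCircle, ← arc_zero hk t, ← arc_two hk t] at h h1 h2 ⊢
  exact saddleCoeff_of_split c _ h h1 h2

end Saddle

/-- A labelling with non-zero coefficient agrees with τ away from the two circles at t, so it comes
from `splitAt` with some pair of labels. The sum over all labellings collapses to the sum over pairs
in `cycEdge_eq`. -/
theorem sum_saddle_merge {t : Fin k} {L : Finset (Fin k)} (ht : t ∈ L) (hL : ∃ s, s ∉ L)
    (f : State → K) (τ : TorusCircles hk L → Lab) :
    ∑ σ : TorusCircles hk (L.erase t) → Lab, f (toState hk (L.erase t) σ) *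
      torusSaddle hk c t (L.erase t) L σ τ =
      cycEdge c t f (toState hk L τ) := by
  set w := toState hk L τ with hw
  have hlen : w.len = k := len_toState hk L τ
  have hvert : w.vert k = L := vert_toState hk L τ
  have hword : w.word[(t : ℕ)]? = some none := by rw [← State.mem_vert, hvert]; exact ht
  have hb : ¬ w.IsBase := fun h => by
    obtain ⟨s, hs⟩ := hL
    rw [State.isBase_iff_vert hlen, hvert] at h
    exact hs (h s)
  have hL' : ∃ s, s ∉ L.erase t := ⟨t, by simp⟩
  have hex : ∀ p : Lab × Lab, ∃ σ : TorusCircles hk (L.erase t) → Lab,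
      toState hk (L.erase t) σ = w.splitAt t p.1 p.2 := fun p =>
    exists_label hk _ (by rw [State.len_splitAt hb, hlen])
      (by rw [vert_eq_erase (State.map_isNone_splitAt hb t p.1 p.2), hvert])
  choose e he using hex
  have hrow : ∀ p i s, s ≤ k →
      e p (rowCircle hk (L.erase t) i s) = (w.splitAt t p.1 p.2).row i s := fun p i s hs => by
    rw [← he, row_toState hk _ _ i s hs]
  have hp : ∀ p, e p (rowCircle hk (L.erase t) 0 t) = p.1 := fun p => by
    rw [hrow p 0 t t.2.le, (State.row_splitAt_self hb 0 hword p.1 p.2).1]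
  have hq : ∀ p, e p (rowCircle hk (L.erase t) 1 (t + 1)) = p.2 := fun p => by
    rw [hrow p 1 (t + 1) t.2, (State.row_splitAt_self hb 1 hword p.1 p.2).2]
  -- The labelling obtained by splitting with labels 1 and X shows that the two circles at t are
  -- different.
  have hne : rowCircle hk (L.erase t) 0 t ≠ rowCircle hk (L.erase t) 1 (t + 1) := fun h => by
    have h1 := hp (.one, .X)
    rw [h, hq] at h1
    simp at h1
  have heq : rowCircle hk L 0 t = rowCircle hk L 1 (t + 1) := by
    rw [rowCircle_of_mem hk 0 ht, rowCircle_eq hk hL 0 1]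
  have hother : ∀ p i s, s ≤ k →
      rowCircle hk (L.erase t) i s ≠ rowCircle hk (L.erase t) 0 t →
      rowCircle hk (L.erase t) i s ≠ rowCircle hk (L.erase t) 1 (t + 1) →
      e p (rowCircle hk (L.erase t) i s) = τ (rowCircle hk L i s) := by
    intro p i s hs h1 h2
    have := State.row_splitAt hb i hword (rowCircle hk (L.erase t) i) (fun r hr h => by
      have hrk : r < k := by
        rw [← hlen, ← State.length_word]
        exact (List.getElem?_eq_some_iff.1 h).1
      refine rowCircle_of_mem hk i (t := ⟨r, hrk⟩) (Finset.mem_erase.2 ⟨?_, ?_⟩)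
      · exact fun e => hr (congrArg Fin.val e)
      · rw [← hvert, State.mem_vert]; exact h) (by rw [hlen, rowCircle_len]) s (by omega)
    rcases this with ⟨h, _⟩ | ⟨h, _⟩ | h
    · exact absurd (h.trans (rowCircle_eq hk hL' i 0 _)) h1
    · exact absurd (h.trans (rowCircle_eq hk hL' i 1 _)) h2
    · rw [hrow p i s hs, h, hw, row_toState hk L τ i s hs]
  have hcond : ∀ p, ∀ u : Fin k × Fin 2,
      torusCircle hk (L.erase t) u ≠ rowCircle hk (L.erase t) 0 t →
      torusCircle hk (L.erase t) u ≠ rowCircle hk (L.erase t) 1 (t + 1) →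
      e p (torusCircle hk (L.erase t) u) = τ (torusCircle hk L u) := fun p u => by
    rw [circle_eq_rowCircle, circle_eq_rowCircle]
    exact hother p u.2 u.1 u.1.2.le
  rw [cycEdge_eq c t f w hb 0 hword]
  refine (Fintype.sum_of_injective e ?_ _ _ ?_ ?_).symm
  · intro p p' h
    exact Prod.ext (by rw [← hp p, h, hp]) (by rw [← hq p, h, hq])
  · intro σ hσ
    rw [torusSaddle_of_not, mul_zero]
    intro hc
    refine hσ ⟨(σ (rowCircle hk _ 0 t), σ (rowCircle hk _ 1 (t + 1))), ?_⟩
    ext C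
    obtain ⟨i, s, hs, rfl⟩ := exists_rowCircle hk _ C
    by_cases h1 : rowCircle hk (L.erase t) i s = rowCircle hk (L.erase t) 0 t
    · rw [h1, hp]
    by_cases h2 : rowCircle hk (L.erase t) i s = rowCircle hk (L.erase t) 1 (t + 1)
    · rw [h2, hq]
    exact (hother _ i s hs.le h1 h2).trans (hc (rowArc hk i s) h1 h2).symm
  · intro p
    rw [torusSaddle_of_merge (hcond p) hne heq, he, hp, hq, hw,
      row_toState hk L τ 0 t t.2.le]

theorem sum_saddle_split (t : Fin k) (f : State → K) (τ : TorusCircles hk Finset.univ → Lab) :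
    ∑ σ : TorusCircles hk (Finset.univ.erase t) → Lab, f (toState hk (Finset.univ.erase t) σ) *
      torusSaddle hk c t (Finset.univ.erase t) Finset.univ σ τ =
      cycEdge c t f (toState hk Finset.univ τ) := by
  set w := toState hk Finset.univ τ with hw
  have hlen : w.len = k := len_toState hk _ τ
  have hvert : w.vert k = Finset.univ := vert_toState hk _ τ
  have hb : w.IsBase := by
    rw [State.isBase_iff_vert hlen, hvert]
    exact Finset.mem_univ
  have ht : (t : ℕ) < w.len := by rw [hlen]; exact t.2
  have hex : ∀ b : Lab, ∃ σ : TorusCircles hk (Finset.univ.erase t) → Lab,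
      toState hk (Finset.univ.erase t) σ = w.joinAt t b := fun b =>
    exists_label hk _ (by rw [State.len_joinAt hb, hlen])
      (by rw [vert_eq_erase (State.map_isNone_joinAt hb t b), hvert])
  choose e he using hex
  have hrow : ∀ b i s, s ≤ k → e b (rowCircle hk (Finset.univ.erase t) i s) = b :=
    fun b i s hs => by
      rw [← row_toState hk _ (e b) i s hs, he, State.row_joinAt hb ht]
  -- With a single horizontal crossing there is one circle, so the condition on circles away from
  -- the saddle is empty and a labelling is a single label.
  have hall : ∀ C, C = rowCircle hk (Finset.univ.erase t) 1 (t + 1) := fun C => by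
    obtain ⟨r, hr, rfl⟩ := exists_notMem_rowCircle hk ⟨t, by simp⟩ C
    obtain rfl : r = t := by simpa using hr
    exact rowCircle_eq hk ⟨_, hr⟩ 0 1 _
  have hcond : ∀ σ : TorusCircles hk (Finset.univ.erase t) → Lab, ∀ u : Fin k × Fin 2,
      torusCircle hk (Finset.univ.erase t) u ≠ rowCircle hk (Finset.univ.erase t) 0 t →
      torusCircle hk (Finset.univ.erase t) u ≠ rowCircle hk (Finset.univ.erase t) 1 (t + 1) →
      σ (torusCircle hk (Finset.univ.erase t) u) = τ (torusCircle hk Finset.univ u) :=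
    fun σ u _ h => absurd (hall _) h
  have hlast : ∀ i s, τ (rowCircle hk Finset.univ i s) = w.last i := fun i s => by
    rw [rowCircle_univ, ← row_toState hk _ τ i 0 hk.le, State.row_zero]
  have hne : rowCircle hk Finset.univ 0 t ≠ rowCircle hk Finset.univ 1 (t + 1) := by
    rw [rowCircle_univ hk 0, rowCircle_univ hk 1]
    exact rowCircle_univ_ne hk
  rw [cycEdge_eq_base c t f w hb ht]
  refine (Fintype.sum_of_injective e ?_ _ _ ?_ ?_).symm
  · intro b b' h
    rw [← hrow b 0 0 hk.le, h, hrow b' 0 0 hk.le]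
  · intro σ hσ
    refine absurd ⟨σ (rowCircle hk _ 1 (t + 1)), ?_⟩ hσ
    ext C
    rw [hall C, hrow _ 1 _ t.2]
  · intro b
    rw [torusSaddle_of_split (hcond _) (hall _) hne, he, hrow _ 0 _ t.2.le, hlast, hlast]

theorem xi_torus {t : Fin k} {L : Finset (Fin k)} (ht : t ∈ L) (f : State → K)
    (τ : TorusCircles hk L → Lab) :
    (torusDiagram k hk).xi c t (L.erase t) L (fun σ => f (toState hk (L.erase t) σ)) τ =
      cycEdge c t f (toState hk L τ) := by
  by_cases hL : ∃ s, s ∉ L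
  · exact sum_saddle_merge hk c ht hL f τ
  · push Not at hL
    obtain rfl : L = Finset.univ := by ext t; simp [hL t]
    exact sum_saddle_split hk c t f τ

/-- The chain of the torus link diagram given by a function of states. -/
def ofState (i : ℤ) (f : State → K) : PlaneDiagram.Chain K (torusDiagram k hk) i :=
  fun L σ => f (toState hk L.1 σ)

theorem sum_cycEdge (f : State → K) {L : Finset (Fin k)} (τ : TorusCircles hk L → Lab) :
    ∑ a ∈ L.attach, ((-1 : ℤ) ^ k * edgeSgn a.1 (toState hk L τ).word) •
      cycEdge c a.1 f (toState hk L τ) = (-1) ^ k * cycD c f (toState hk L τ) := by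
  rw [cycD_eq_sum, len_toState, Finset.sum_range, Finset.mul_sum,
    ← Finset.sum_subset (Finset.subset_univ L), ← Finset.sum_attach L]
  · refine Finset.sum_congr rfl fun a _ => ?_
    simp [mul_assoc]
  · intro t _ ht
    rw [cycEdge_of_ne, mul_zero, mul_zero]
    rw [word_toState, if_neg ht]
    simp

theorem x_torus : (torusDiagram k hk).x = k := by
  change (Finset.univ.filter fun _ : Fin k => true = true).card = k
  simp

theorem y_torus : (torusDiagram k hk).y = 0 := by
  change (Finset.univ.filter fun _ : Fin k => true = false).card = 0
  simp

/-- The bridge between the cube of resolutions and the iterated cone. The factor (-1)^k is the sign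
of the shift by x(D) = k. -/
theorem d_ofState (i i' : ℤ) (h : i + 1 = i') (f : State → K) :
    (torusDiagram k hk).d c i i' h (ofState hk i f) =
      ofState hk i' ((-1 : K) ^ k • cycD c f) := by
  funext L τ
  obtain ⟨L, hL⟩ := L
  have h1 : (torusDiagram k hk).d c i i' h (ofState hk i f) ⟨L, hL⟩ τ =
      ∑ a ∈ L.attach, ((-1 : ℤ) ^ (torusDiagram k hk).x *
        (torusDiagram k hk).edgeSign a.1 (L.erase a.1)) •
        (torusDiagram k hk).xi c a.1 (L.erase a.1) L
          (fun σ => f (toState hk (L.erase a.1) σ)) τ := by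
    rw [PlaneDiagram.d, LinearMap.pi_apply, LinearMap.sum_apply]
    exact Finset.sum_apply ..
  refine h1.trans (Eq.trans (Finset.sum_congr rfl fun a _ => ?_)
    (sum_cycEdge hk c f (L := L) τ))
  refine congrArg₂ (fun (m : ℤ) (r : K) => m • r) ?_ (xi_torus hk c a.2 f τ)
  rw [edgeSgn_toState hk L τ a.1, x_torus]
  rfl

end Differential

/-! ### The cohomology of the torus link diagram -/

theorem State.dots_le_len (w : State) : w.dots ≤ w.len := by
  have h : ∀ l : Word, Khovanov.dots l ≤ l.length := by
    intro l
    induction l with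
    | nil => simp [Khovanov.dots]
    | cons o l ih => cases o <;> simp [Khovanov.dots] <;> omega
  induction w with
  | base x y => simp [dots, len]
  | dot w ih => simpa [dots, len] using ih
  | lett a l => exact (h l).trans (Nat.le_succ _)

section Cohomology

variable {k : ℕ} (hk : 0 < k) {K : Type} [CommRing K] (c : K)

/-- A top cycle vanishes on words with a vertical resolution. So in degree -s only the states with
all vertical crossings in front contribute, and these see nothing but copy s of A, or A ⊗ A when s =
0. -/
theorem gen_congr_of_len {t t' : Lab → Lab → K} {α α' : ℕ → Lab → K} {w : State} {s : ℕ}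
    (hs : w.len = w.dots + s) (ht : s = 0 → t = t') (hα : s ≠ 0 → α s = α' s) :
    gen t α w = gen t' α' w := by
  induction w with
  | base x y =>
    rw [gen, gen, ht (by simpa [State.len, State.dots] using hs.symm)]
  | dot w ih => exact ih (by simp only [State.len, State.dots] at hs; omega)
  | lett a l =>
    simp only [State.len, State.dots] at hs
    by_cases hd : dots l = 0
    · obtain rfl : s = l.length + 1 := by omega
      rw [gen, gen, hα (by omega)]
    · rw [gen, gen, top_of_dots_ne_zero _ _ _ hd, top_of_dots_ne_zero _ _ _ hd]

theorem gen_zero : gen (0 : Lab → Lab → K) 0 = 0 := by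
  simpa using gen_smul (0 : K) 0 0

theorem neg_one_pow_mul_self (r : K) (n : ℕ) : (-1) ^ n * ((-1) ^ n * r) = r := by
  rw [← mul_assoc, ← mul_pow]; simp

theorem dots_toState_cast {i : ℤ} {L : Finset (Fin k)}
    (hL : (L.card : ℤ) = i + (torusDiagram k hk).x) (σ : TorusCircles hk L → Lab) :
    ((toState hk L σ).dots : ℤ) = i + k := by
  rw [dots_toState, hL, x_torus]

-- States of length k with i + k vertical crossings are exactly the labelled resolutions in degree
-- i; from here on, identities of chains are checked on states.
omit [CommRing K] in
theorem ofState_eq_iff {i : ℤ} {f g : State → K} : ofState hk i f = ofState hk i g ↔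
    ∀ w, w.len = k → (w.dots : ℤ) = i + k → f w = g w := by
  constructor
  · intro h w hw hd
    have hL : ((w.vert k).card : ℤ) = i + (torusDiagram k hk).x := by
      rw [x_torus, ← hd, ← dots_toState hk _ (w.label hk hw), toState_label]
    have := congrFun (congrFun h ⟨w.vert k, hL⟩) (w.label hk hw)
    change f (toState hk _ _) = g (toState hk _ _) at this
    rwa [toState_label] at this
  · intro h
    funext L σ
    exact h _ (len_toState hk L.1 σ) (dots_toState_cast hk L.2 σ)

/-- Extension by zero to all states. The vanishing outside degree i allows the results about
functions on all states of length k to be applied to a chain of one degree. -/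
theorem exists_ofState (i : ℤ) (v : PlaneDiagram.Chain K (torusDiagram k hk) i) :
    ∃ f : State → K, ofState hk i f = v ∧ ∀ w, (w.dots : ℤ) ≠ i + k → f w = 0 := by
  classical
  refine ⟨fun w => if h : ∃ p : (L : {L : Finset (Fin k) //
      (L.card : ℤ) = i + (torusDiagram k hk).x}) × (TorusCircles hk L.1 → Lab),
      toState hk p.1.1 p.2 = w then v h.choose.1 h.choose.2 else 0, ?_, fun w hw => dif_neg ?_⟩
  · funext L σ
    have h : ∃ p : (L : {L : Finset (Fin k) //
      (L.card : ℤ) = i + (torusDiagram k hk).x}) × (TorusCircles hk L.1 → Lab),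
      toState hk p.1.1 p.2 = toState hk L.1 σ := ⟨⟨L, σ⟩, rfl⟩
    refine (dif_pos h).trans ?_
    have e : h.choose = ⟨L, σ⟩ := by
      have h1 := h.choose_spec
      generalize h.choose = p at h1
      obtain ⟨⟨L', hL'⟩, σ'⟩ := p
      obtain ⟨L, hL⟩ := L
      obtain rfl : L' = L := by
        have := congrArg (State.vert k) h1
        exact (vert_toState hk L' σ').symm.trans (this.trans (vert_toState hk L σ))
      obtain rfl := toState_injective hk _ h1
      rfl
    rw [e]
  · rintro ⟨⟨L, σ⟩, rfl⟩
    exact hw (dots_toState_cast hk L.2 σ)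

theorem subsingleton_chain (i : ℤ) (h : i < -k ∨ 0 < i) :
    Subsingleton (PlaneDiagram.Chain K (torusDiagram k hk) i) := by
  refine ⟨fun v v' => ?_⟩
  obtain ⟨f, rfl, -⟩ := exists_ofState hk i v
  obtain ⟨g, rfl, -⟩ := exists_ofState hk i v'
  rw [ofState_eq_iff]
  intro w hw hd
  have := w.dots_le_len
  omega

theorem ofState_add (i : ℤ) (f g : State → K) :
    ofState hk i (f + g) = ofState hk i f + ofState hk i g := rfl

theorem ofState_zero (i : ℤ) : ofState hk i (0 : State → K) = 0 := rfl

theorem d_comp_d (i i' i'' : ℤ) (h : i + 1 = i') (h' : i' + 1 = i'') :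
    (torusDiagram k hk).d c i' i'' h' ∘ₗ (torusDiagram k hk).d c i i' h = 0 := by
  refine LinearMap.ext fun v => ?_
  obtain ⟨f, rfl, -⟩ := exists_ofState hk i v
  rw [LinearMap.comp_apply, d_ofState, d_ofState, cycD_smul, cycD_cycD]
  simp [ofState_zero]

/-- Every cocycle is cohomologous to one of the form `gen`. -/
theorem exists_gen (i : ℤ) (v : PlaneDiagram.Chain K (torusDiagram k hk) i)
    (hv : (torusDiagram k hk).d c i (i + 1) rfl v = 0) :
    ∃ (t : Lab → Lab → K) (α : ℕ → Lab → K)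
      (u : PlaneDiagram.Chain K (torusDiagram k hk) (i - 1)),
      comul c (α 1) = 0 ∧ (∀ s, 1 ≤ s → s < k → bd α s = 0) ∧
      v = ofState hk i (gen t α) + (torusDiagram k hk).d c (i - 1) i (sub_add_cancel i 1) u := by
  obtain ⟨f, rfl, hf⟩ := exists_ofState hk i v
  rw [d_ofState, ← ofState_zero, ofState_eq_iff] at hv
  -- Outside degree i + 1 the differential of f vanishes by locality, as f is zero outside degree i.
  have hf' : ∀ w, w.len = k → cycD c f w = 0 := fun w hw => by
    by_cases hd : (w.dots : ℤ) = i + 1 + k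
    · have := hv w hw hd
      rw [← neg_one_pow_mul_self (cycD c f w) k]
      simp only [Pi.smul_apply, smul_eq_mul, Pi.zero_apply] at this
      rw [this, mul_zero]
    · refine cycD_eq_zero_of_local c fun w' _ h => hf w' ?_
      omega
  obtain ⟨t, α, u, h1, h2, h3⟩ := cyc_exact c k f hf'
  refine ⟨t, α, ofState hk (i - 1) ((-1 : K) ^ k • u), h1 hk, h2, ?_⟩
  rw [d_ofState, ← ofState_add, ofState_eq_iff]
  intro w hw _
  rw [h3 w hw, cycD_smul]
  simp only [Pi.add_apply, Pi.smul_apply, smul_eq_mul, neg_one_pow_mul_self]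
  ring

/-- For k crossings there is no copy k + 1, so the additional term in `cycD_gen` drops out. -/
theorem d_gen (i i' : ℤ) (h : i + 1 = i') (t : Lab → Lab → K) (α : ℕ → Lab → K)
    (h1 : α (k + 1) = 0) :
    (torusDiagram k hk).d c i i' h (ofState hk i (gen t α)) =
      ofState hk i' ((-1 : K) ^ k • gen (comul c (α 1)) (bd α)) := by
  rw [d_ofState, ofState_eq_iff]
  intro w hw _
  have := cycD_gen c t α w
  rw [hw, h1, top_zero, wrap_zero] at this
  simp only [Pi.smul_apply, ← this]
  simp [ceps]

theorem d_gen_eq_zero (i : ℤ) (t : Lab → Lab → K) (α : ℕ → Lab → K) (h1 : α (k + 1) = 0)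
    (h2 : comul c (α 1) = 0) (h3 : ∀ s, 1 ≤ s → s < k → bd α s = 0) :
    (torusDiagram k hk).d c i (i + 1) rfl (ofState hk i (gen t α)) = 0 := by
  rw [d_gen hk c i _ rfl t α h1, ← ofState_zero, ofState_eq_iff, h2]
  intro w hw _
  rw [Pi.smul_apply, gen_congr (α' := 0), gen_zero]
  · simp
  · intro s hs1 hs2
    rcases hs2.lt_or_eq with h | rfl
    · exact h3 s hs1 (by omega)
    · rw [bd, hw, h1]
      ext b; cases b <;> simp [mulX]

theorem gen_eq_d (i : ℤ) (t : Lab → Lab → K) (α γ : ℕ → Lab → K) (h1 : γ (k + 1) = 0)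
    (h2 : t = comul c (γ 1)) (h3 : ∀ s, 1 ≤ s → s ≤ k → α s = bd γ s) :
    ∃ u, ofState hk i (gen t α) =
      (torusDiagram k hk).d c (i - 1) i (sub_add_cancel i 1) u := by
  refine ⟨(-1 : K) ^ k • ofState hk (i - 1) (gen 0 γ), ?_⟩
  rw [map_smul, d_gen hk c _ _ _ 0 γ h1, ← h2]
  change _ = ofState hk i ((-1 : K) ^ k • (-1 : K) ^ k • gen t (bd γ))
  rw [ofState_eq_iff]
  intro w hw _
  rw [gen_congr (α' := bd γ) fun s hs1 hs2 => h3 s hs1 (by omega)]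
  simp only [Pi.smul_apply, smul_eq_mul, neg_one_pow_mul_self]

/-- `cyc_boundary` asks for an equation on all states of length k. Outside degree -s both sides are
zero, the left one because of `ht` and `hα`. -/
theorem exists_of_gen_eq_d (s : ℕ) (t : Lab → Lab → K) (α : ℕ → Lab → K)
    (u : PlaneDiagram.Chain K (torusDiagram k hk) (-(s : ℤ) - 1))
    (ht : s ≠ 0 → t = 0) (hα : ∀ r, r ≠ 0 → r ≠ s → α r = 0)
    (h : ofState hk (-(s : ℤ)) (gen t α) =
      (torusDiagram k hk).d c (-(s : ℤ) - 1) (-(s : ℤ)) (sub_add_cancel _ 1) u) :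
    ∃ γ : ℕ → Lab → K, γ (k + 1) = 0 ∧ t = comul c (γ 1) ∧
      ∀ s, 1 ≤ s → s ≤ k → α s = bd γ s := by
  obtain ⟨f, rfl, hf⟩ := exists_ofState hk _ u
  rw [d_ofState, ofState_eq_iff] at h
  refine cyc_boundary c k t α ((-1 : K) ^ k • f) fun w hw => ?_
  rw [cycD_smul]
  by_cases hd : (w.dots : ℤ) = -(s : ℤ) + k
  · exact h w hw hd
  · have h1 : cycD c f w = 0 := cycD_eq_zero_of_local c fun w' _ h' => hf w' (by omega)
    have hle := w.dots_le_len
    have h2 : gen t α w = gen 0 0 w := gen_congr_of_len (s := w.len - w.dots) (by omega)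
      (fun h' => ht (by omega)) fun h' => hα _ h' (by omega)
    rw [Pi.smul_apply, h1, h2, gen_zero]
    simp

/-! ### Homogeneous components of chains -/

variable {c} {𝒢 : ℤ → AddSubgroup K} (P : Components c 𝒢)

theorem stateDeg_torus (L : Finset (Fin k)) (σ : TorusCircles hk L → Lab) :
    (torusDiagram k hk).stateDeg L σ = (toState hk L σ).deg - 2 * k := by
  rw [deg_toState]
  refine congrArg₂ (· - ·) rfl ?_
  rw [x_torus, y_torus]
  simp

include P

theorem ofState_mem_chainGr (i j : ℤ) (f : State → K)
    (h : ∀ w, w.len = k → (w.dots : ℤ) = i + k → P.statePr (j + 2 * k) f w = f w) :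
    ofState hk i f ∈ (torusDiagram k hk).chainGr 𝒢 i j := by
  intro L σ
  have h2 := h _ (len_toState hk L.1 σ) (dots_toState_cast hk L.2 σ)
  rw [Components.statePr] at h2
  have h3 := P.pr_mem (j + 2 * k - (toState hk L.1 σ).deg) (f (toState hk L.1 σ))
  rw [h2] at h3
  refine (congrArg (fun n => f (toState hk L.1 σ) ∈ 𝒢 n) ?_).mp h3
  rw [stateDeg_torus hk L.1 σ]
  ring

theorem statePr_of_mem_chainGr {i j : ℤ} {f : State → K}
    (h : ofState hk i f ∈ (torusDiagram k hk).chainGr 𝒢 i j) :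
    ofState hk i (P.statePr (j + 2 * k) f) = ofState hk i f := by
  funext L σ
  have h1 : f (toState hk L.1 σ) ∈ 𝒢 (j - ((toState hk L.1 σ).deg - 2 * k)) := by
    rw [← stateDeg_torus hk L.1 σ]
    exact h L σ
  refine P.pr_eq _ _ ?_
  rwa [show j + 2 * k - (toState hk L.1 σ).deg = j - ((toState hk L.1 σ).deg - 2 * k) by ring]

omit P in
theorem Components.statePr_statePr (P : Components c 𝒢) (j : ℤ) (f : State → K) :
    P.statePr j (P.statePr j f) = P.statePr j f :=
  funext fun _ => P.pr_eq _ _ (P.pr_mem _ _)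

omit P in
theorem Components.statePr_smul (P : Components c 𝒢) (j : ℤ) (n : ℕ) (f : State → K) :
    P.statePr j ((-1 : K) ^ n • f) = (-1 : K) ^ n • P.statePr j f :=
  funext fun w => P.pr_sign (j - w.deg) n (f w)

theorem d_ofState_statePr (i i' : ℤ) (h : i + 1 = i') (j : ℤ) (f : State → K) :
    (torusDiagram k hk).d c i i' h (ofState hk i (P.statePr j f)) =
      ofState hk i' (P.statePr j ((-1 : K) ^ k • cycD c f)) := by
  rw [d_ofState, P.statePr_smul]
  congr 2
  exact funext (P.cycD_statePr j f)

/-- A homogeneous chain equals its own projection, and the projections commute with the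
differential; so its image equals its own projection as well. -/
theorem isGradedComplex : (torusDiagram k hk).IsGradedComplex c 𝒢 := by
  refine ⟨fun i i' i'' h h' => d_comp_d hk c i i' i'' h h', fun i i' h j v hv => ?_⟩
  obtain ⟨f, rfl, -⟩ := exists_ofState hk i v
  rw [← statePr_of_mem_chainGr hk P hv, d_ofState_statePr]
  refine ofState_mem_chainGr hk P _ _ _ fun w _ _ => ?_
  rw [P.statePr_statePr]

end Cohomology

/-! ### From homogeneous generators and relations to graded cohomology. -/

section Presentation

variable {K : Type} [CommRing K] {c : K} {𝒢 : ℤ → AddSubgroup K}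

/-- Two elements of degrees `d₁` and `d₂` that generate the cohomology of a diagram in
degree `i`, with the relations `ρ`. -/
structure CohomologyGenerators (D : PlaneDiagram) (c : K) (𝒢 : ℤ → AddSubgroup K) (i d₁ d₂ : ℤ)
    (ρ : K × K → Prop) where
  /-- the combinations of the generators -/
  toChain : K × K →ₗ[K] PlaneDiagram.Chain K D i
  d_toChain : ∀ f, D.d c i (i + 1) rfl (toChain f) = 0
  exists_eq : ∀ v, D.d c i (i + 1) rfl v = 0 →
    ∃ f u, v = toChain f + D.d c (i - 1) i (sub_add_cancel i 1) u
  exists_eq_of_mem : ∀ j v, D.d c i (i + 1) rfl v = 0 → v ∈ D.chainGr 𝒢 i j →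
    ∃ f, f.1 ∈ 𝒢 (j - d₁) ∧ f.2 ∈ 𝒢 (j - d₂) ∧
      ∃ u, v = toChain f + D.d c (i - 1) i (sub_add_cancel i 1) u
  exists_boundary : ∀ j u, D.d c (i - 1) i (sub_add_cancel i 1) u ∈ D.chainGr 𝒢 i j →
    ∃ u' ∈ D.chainGr 𝒢 (i - 1) j, D.d c (i - 1) i (sub_add_cancel i 1) u' =
      D.d c (i - 1) i (sub_add_cancel i 1) u
  mem_chainGr : ∀ j f, f.1 ∈ 𝒢 (j - d₁) → f.2 ∈ 𝒢 (j - d₂) → toChain f ∈ D.chainGr 𝒢 i j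
  rel_iff : ∀ f, (∃ u, toChain f = D.d c (i - 1) i (sub_add_cancel i 1) u) ↔ ρ f

/-- The homogeneous elements of `K × K`. -/
def pairGr (𝒢 : ℤ → AddSubgroup K) (d₁ d₂ j : ℤ) : AddSubgroup (K × K) :=
  (𝒢 (j - d₁)).prod (𝒢 (j - d₂))

namespace CohomologyGenerators

variable {D : PlaneDiagram} {i d₁ d₂ : ℤ} {ρ : K × K → Prop}
  (G : CohomologyGenerators D c 𝒢 i d₁ d₂ ρ)

/-- The map from the free module on the generators to the cohomology. -/
def toH : K × K →ₗ[K] D.H c i :=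
  ((D.B c i).comap (D.Z c i).subtype).mkQ ∘ₗ G.toChain.codRestrict (D.Z c i) G.d_toChain

theorem toH_eq_zero {f : K × K} : G.toH f = 0 ↔ ρ f := by
  rw [← G.rel_iff]
  refine (Submodule.Quotient.mk_eq_zero _).trans ?_
  exact ⟨fun ⟨u, hu⟩ => ⟨u, hu.symm⟩, fun ⟨u, hu⟩ => ⟨u, hu.symm⟩⟩

theorem mk_eq_toH {z : D.Z c i} {f : K × K} {u : PlaneDiagram.Chain K D (i - 1)}
    (h : z.1 = G.toChain f + D.d c (i - 1) i (sub_add_cancel i 1) u) :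
    ((D.B c i).comap (D.Z c i).subtype).mkQ z = G.toH f := by
  refine (Submodule.Quotient.eq _).2 ⟨u, ?_⟩
  change _ = z.1 - G.toChain f
  rw [h, add_sub_cancel_left]

theorem toH_surjective : Function.Surjective G.toH := by
  intro x
  obtain ⟨z, rfl⟩ := Submodule.mkQ_surjective _ x
  obtain ⟨f, u, h⟩ := G.exists_eq z.1 z.2
  exact ⟨f, (G.mk_eq_toH h).symm⟩

include G in
theorem subsingleton (h : ∀ f, ρ f) : Subsingleton (D.H c i) := by
  refine ⟨fun x y => ?_⟩
  obtain ⟨f, rfl⟩ := G.toH_surjective x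
  obtain ⟨g, rfl⟩ := G.toH_surjective y
  rw [G.toH_eq_zero.2 (h f), G.toH_eq_zero.2 (h g)]

-- Both the cohomology and N are the quotient of K × K by the kernel ρ. The homogeneous parts
-- correspond because a homogeneous cocycle is represented by homogeneous coefficients.
include G in
theorem gradedIso {N : Type} [AddCommGroup N] [Module K N] (π : K × K →ₗ[K] N)
    (hπ : Function.Surjective π) (hρ : ∀ f, π f = 0 ↔ ρ f) (𝒩 : ℤ → AddSubgroup N)
    (h𝒩 : ∀ j, (pairGr 𝒢 d₁ d₂ j).map π.toAddMonoidHom = 𝒩 j) :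
    GradedIso K (D.HGr c 𝒢 i) 𝒩 := by
  have hker : LinearMap.ker G.toH = LinearMap.ker π := by
    ext f
    rw [LinearMap.mem_ker, LinearMap.mem_ker, G.toH_eq_zero, hρ]
  let e : D.H c i ≃ₗ[K] N := (G.toH.quotKerEquivOfSurjective G.toH_surjective).symm ≪≫ₗ
    Submodule.quotEquivOfEq _ _ hker ≪≫ₗ π.quotKerEquivOfSurjective hπ
  have he : ∀ f, e (G.toH f) = π f := fun f => by
    have : (G.toH.quotKerEquivOfSurjective G.toH_surjective).symm (G.toH f) =
        Submodule.Quotient.mk f := by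
      rw [LinearEquiv.symm_apply_eq]; rfl
    simp only [e, LinearEquiv.trans_apply, this]
    rfl
  refine ⟨e, fun j => ?_⟩
  rw [← h𝒩]
  ext n
  constructor
  · rintro ⟨x, ⟨z, hz, rfl⟩, rfl⟩
    obtain ⟨f, hf1, hf2, u, h⟩ := G.exists_eq_of_mem j z.1 z.2 hz
    refine ⟨f, ⟨hf1, hf2⟩, ?_⟩
    exact (he f).symm.trans (congrArg e (G.mk_eq_toH h).symm)
  · rintro ⟨f, ⟨hf1, hf2⟩, rfl⟩
    exact ⟨G.toH f, ⟨⟨G.toChain f, G.d_toChain f⟩, G.mem_chainGr j f hf1 hf2, rfl⟩, he f⟩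

/-- The map from the homogeneous elements to the cohomology of the degree `j` subcomplex. -/
def toHDeg (j : ℤ) : pairGr 𝒢 d₁ d₂ j →+ D.HDeg c 𝒢 i j :=
  (QuotientAddGroup.mk' _).comp
    ((G.toChain.toAddMonoidHom.comp (pairGr 𝒢 d₁ d₂ j).subtype).codRestrict (D.ZGr c 𝒢 i j)
      fun f => ⟨G.d_toChain f.1, G.mem_chainGr j f.1 f.2.1 f.2.2⟩)

/-- A homogeneous cocycle might a priori bound only an inhomogeneous chain; `exists_boundary`
replaces that chain by a homogeneous one. -/
theorem toHDeg_eq_zero {j : ℤ} {f : pairGr 𝒢 d₁ d₂ j} : G.toHDeg j f = 0 ↔ ρ f.1 := by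
  rw [← G.rel_iff]
  refine (QuotientAddGroup.eq_zero_iff _).trans ?_
  constructor
  · rintro ⟨u, -, hu⟩
    exact ⟨u, hu.symm⟩
  · rintro ⟨u, hu⟩
    obtain ⟨u', hu', h⟩ := G.exists_boundary j u (hu ▸ G.mem_chainGr j f.1 f.2.1 f.2.2)
    exact ⟨u', hu', h.trans hu.symm⟩

theorem toHDeg_surjective (j : ℤ) : Function.Surjective (G.toHDeg j) := by
  intro x
  obtain ⟨z, rfl⟩ := QuotientAddGroup.mk'_surjective _ x
  obtain ⟨f, hf1, hf2, u, h⟩ := G.exists_eq_of_mem j z.1 z.2.1 z.2.2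
  have hd : D.d c (i - 1) i (sub_add_cancel i 1) u = z.1 - G.toChain f := by
    rw [h, add_sub_cancel_left]
  obtain ⟨u', hu', h'⟩ := G.exists_boundary j u
    (hd ▸ AddSubgroup.sub_mem _ z.2.2 (G.mem_chainGr j f hf1 hf2))
  refine ⟨⟨f, hf1, hf2⟩, QuotientAddGroup.eq.2 ⟨u', hu', ?_⟩⟩
  change D.d c (i - 1) i (sub_add_cancel i 1) u' = -G.toChain f + z.1
  rw [h', hd]
  abel

include G in
theorem subsingleton_hDeg {j : ℤ} (h : ∀ f ∈ pairGr 𝒢 d₁ d₂ j, ρ f) :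
    Subsingleton (D.HDeg c 𝒢 i j) := by
  refine ⟨fun x y => ?_⟩
  obtain ⟨f, rfl⟩ := G.toHDeg_surjective j x
  obtain ⟨g, rfl⟩ := G.toHDeg_surjective j y
  rw [G.toHDeg_eq_zero.2 (h f.1 f.2), G.toHDeg_eq_zero.2 (h g.1 g.2)]

include G in
theorem nonempty_hDeg_equiv {j : ℤ} {M : Type} [AddCommGroup M] (θ : K × K →+ M)
    (hθ : ∀ m, ∃ f ∈ pairGr 𝒢 d₁ d₂ j, θ f = m)
    (hρ : ∀ f ∈ pairGr 𝒢 d₁ d₂ j, θ f = 0 ↔ ρ f) : Nonempty (D.HDeg c 𝒢 i j ≃+ M) := by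
  let θ' : pairGr 𝒢 d₁ d₂ j →+ M := θ.comp (pairGr 𝒢 d₁ d₂ j).subtype
  have hs : Function.Surjective θ' := fun m => by
    obtain ⟨f, hf, h⟩ := hθ m
    exact ⟨⟨f, hf⟩, h⟩
  have hker : (G.toHDeg j).ker = θ'.ker := by
    ext f
    rw [AddMonoidHom.mem_ker, AddMonoidHom.mem_ker, G.toHDeg_eq_zero]
    exact (hρ f.1 f.2).symm
  exact ⟨(QuotientAddGroup.quotientKerEquivOfSurjective _ (G.toHDeg_surjective j)).symm.trans
    ((QuotientAddGroup.quotientAddEquivOfEq hker).trans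
      (QuotientAddGroup.quotientKerEquivOfSurjective θ' hs))⟩

end CohomologyGenerators

end Presentation

/-! ### Generators and relations for the cohomology of the torus links. -/

section TorusGenerators

variable {k : ℕ} (hk : 0 < k) {K : Type} [CommRing K] {c : K} {𝒢 : ℤ → AddSubgroup K}

/-- The presentation of the cohomology of `T_{2,k}` in a degree without chains. -/
def outerGenerators {i : ℤ} (hi : i < -k ∨ 0 < i) :
    CohomologyGenerators (torusDiagram k hk) c 𝒢 i 0 0 fun _ => True :=
  haveI := subsingleton_chain hk (K := K) i hi
  { toChain := 0
    d_toChain := fun _ => map_zero _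
    exists_eq := fun _ _ => ⟨0, 0, Subsingleton.elim _ _⟩
    exists_eq_of_mem := fun _ _ _ _ => ⟨0, zero_mem _, zero_mem _, 0, Subsingleton.elim _ _⟩
    exists_boundary := fun _ _ _ => ⟨0, zero_mem _, Subsingleton.elim _ _⟩
    mem_chainGr := fun _ _ _ _ => zero_mem _
    rel_iff := fun _ => ⟨fun _ => trivial, fun _ => ⟨0, Subsingleton.elim _ _⟩⟩ }

/-- A presentation of the cohomology of `T_{2,k}` in the degree `-s` by cycles of the
form `gen`. -/
def torusGenerators (P : Components c 𝒢) {i : ℤ} (s : ℕ) (hi : i = -(s : ℤ)) (d₁ d₂ : ℤ)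
    (ρ : K × K → Prop)
    (T : K × K →ₗ[K] Lab → Lab → K) (A : K × K →ₗ[K] ℕ → Lab → K)
    (hT : s ≠ 0 → ∀ f, T f = 0) (hA : ∀ f r, r ≠ 0 → r ≠ s → A f r = 0)
    (hk1 : ∀ f, A f (k + 1) = 0) (h1 : ∀ f, comul c (A f 1) = 0)
    (hbd : ∀ f r, 1 ≤ r → r < k → bd (A f) r = 0)
    (hgen : ∀ (t : Lab → Lab → K) (α : ℕ → Lab → K), comul c (α 1) = 0 →
      (∀ r, 1 ≤ r → r < k → bd α r = 0) → ∃ f γ, γ (k + 1) = 0 ∧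
        (s = 0 → t = T f + comul c (γ 1)) ∧ (s ≠ 0 → α s = A f s + bd γ s))
    (hTd : ∀ j f x y, P.pr (j + k - x.deg - y.deg) (T f x y) =
      T (P.pr (j - d₁) f.1, P.pr (j - d₂) f.2) x y)
    (hAd : ∀ j f (r : ℕ) b, P.pr (j + k - b.deg + (2 * r - 1)) (A f r b) =
      A (P.pr (j - d₁) f.1, P.pr (j - d₂) f.2) r b)
    (hρ : ∀ f, (∃ γ : ℕ → Lab → K, γ (k + 1) = 0 ∧ T f = comul c (γ 1) ∧
      ∀ r, 1 ≤ r → r ≤ k → A f r = bd γ r) ↔ ρ f) :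
    CohomologyGenerators (torusDiagram k hk) c 𝒢 i d₁ d₂ ρ :=
  have hpr : ∀ j f w, w.len = k → P.statePr (j + 2 * k) (gen (T f) (A f)) w =
      gen (T (P.pr (j - d₁) f.1, P.pr (j - d₂) f.2))
        (A (P.pr (j - d₁) f.1, P.pr (j - d₂) f.2)) w := fun j f w hw => by
    rw [P.statePr_gen, hw]
    congr 1
    · ext x y
      rw [← hTd]
      congr 2; ring
    · ext r b
      rw [← hAd]
      congr 2; ring
  have hex : ∀ v, (torusDiagram k hk).d c i (i + 1) rfl v = 0 →
      ∃ f u, v = ofState hk i (gen (T f) (A f)) +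
        (torusDiagram k hk).d c (i - 1) i (sub_add_cancel i 1) u := fun v hv => by
    obtain ⟨t, α, u, h2, h3, rfl⟩ := exists_gen hk c i v hv
    obtain ⟨f, γ, h4, h5, h6⟩ := hgen t α h2 h3
    -- The discrepancy allowed by `hgen` is a boundary of the small complex, hence a coboundary.
    obtain ⟨u', hu'⟩ := gen_eq_d hk c i (comul c (γ 1)) (bd γ) γ h4 rfl fun _ _ _ => rfl
    refine ⟨f, u' + u, ?_⟩
    rw [map_add, ← hu', ← add_assoc]
    congr 1
    rw [← ofState_add, ← gen_add, ofState_eq_iff]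
    intro w hw hd
    exact gen_congr_of_len (s := s) (by omega) h5 h6
  { toChain :=
      { toFun := fun f => ofState hk i (gen (T f) (A f))
        map_add' := fun f g => by rw [map_add, map_add, gen_add, ofState_add]
        map_smul' := fun r f => by rw [map_smul, map_smul, gen_smul]; rfl }
    d_toChain := fun f => d_gen_eq_zero hk c i _ _ (hk1 f) (h1 f) (hbd f)
    exists_eq := hex
    exists_eq_of_mem := fun j v hv hj => by
      obtain ⟨f, u, h⟩ := hex v hv
      obtain ⟨v, rfl, -⟩ := exists_ofState hk _ v
      obtain ⟨u, rfl, -⟩ := exists_ofState hk _ u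
      -- Projecting the whole equation to degree j gives homogeneous coefficients and a homogeneous
      -- correction term.
      refine ⟨(P.pr (j - d₁) f.1, P.pr (j - d₂) f.2), P.pr_mem _ _, P.pr_mem _ _,
        ofState hk _ (P.statePr (j + 2 * k) u), ?_⟩
      rw [d_ofState, ← ofState_add, ofState_eq_iff] at h
      rw [← statePr_of_mem_chainGr hk P hj, d_ofState_statePr]
      refine (ofState_eq_iff hk (g := gen _ _ + P.statePr _ _)).2 fun w hw hd => ?_
      rw [Pi.add_apply, ← hpr j f w hw]
      simp only [Components.statePr, h w hw hd, Pi.add_apply, map_add]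
    exists_boundary := fun j u hu => by
      obtain ⟨u, rfl, -⟩ := exists_ofState hk _ u
      refine ⟨ofState hk _ (P.statePr (j + 2 * k) u), ofState_mem_chainGr hk P _ _ _
        fun w _ _ => by rw [P.statePr_statePr], ?_⟩
      rw [d_ofState] at hu
      rw [d_ofState_statePr, d_ofState, statePr_of_mem_chainGr hk P hu]
    mem_chainGr := fun j f hf1 hf2 => by
      refine ofState_mem_chainGr hk P _ _ _ fun w hw _ => ?_
      rw [hpr j f w hw, P.pr_eq _ _ hf1, P.pr_eq _ _ hf2]
    rel_iff := fun f => by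
      subst hi
      rw [← hρ]
      constructor
      · rintro ⟨u, hu⟩
        exact exists_of_gen_eq_d hk c s _ _ u (fun h => hT h f) (hA f) hu
      · rintro ⟨γ, h2, h3, h4⟩
        exact gen_eq_d hk c _ _ _ γ h2 h3 h4 }

/-- The generators in the degree `0`. -/
def strandLabels : K × K →ₗ[K] Lab → Lab → K where
  toFun f x y := match x, y with
    | .one, .X => f.1
    | .one, .one => f.2
    | _, _ => 0
  map_add' f g := by ext x y; cases x <;> cases y <;> simp
  map_smul' r f := by ext x y; cases x <;> cases y <;> simp

/-- The generators in the degree `-s`. -/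
def topLabels (s : ℕ) : K × K →ₗ[K] ℕ → Lab → K where
  toFun f r b := if r = s then (match b with
    | .X => f.1
    | .one => if Even s then f.2 else 0) else 0
  map_add' f g := by
    ext r b
    by_cases hr : r = s <;> by_cases hs : Even s <;> cases b <;> simp [hr, hs]
  map_smul' x f := by
    ext r b
    by_cases hr : r = s <;> by_cases hs : Even s <;> cases b <;> simp [hr, hs]

theorem topLabels_of_ne {s r : ℕ} (h : r ≠ s) (f : K × K) : topLabels s f r = 0 := by
  ext b; simp [topLabels, h]

theorem bd_apply (α : ℕ → Lab → K) (s : ℕ) :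
    bd α s .one = 0 ∧ bd α s .X = (1 + (-1) ^ s) * α (s + 1) .one := by
  simp [bd, mulX]

theorem bd_eq_zero_of_odd (α : ℕ → Lab → K) {s : ℕ} (h : Odd s) : bd α s = 0 := by
  simp [bd, h.neg_one_pow]

theorem bd_eq_zero (α : ℕ → Lab → K) {s : ℕ} (h : α (s + 1) .one = 0) : bd α s = 0 := by
  ext b
  cases b
  · exact (bd_apply α s).1
  · rw [(bd_apply α s).2, h, mul_zero]; rfl

/-- The coefficient of 1 ⊗ X recovers that of 1; after that X ⊗ X recovers that of X. This
injectivity of Δ is what makes degree -1 vanish. -/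
theorem eq_zero_of_comul_eq_zero {α : Lab → K} (h : comul c α = 0) : α = 0 := by
  have h1 : α .one = 0 := by simpa [comul, comulCoeff] using congrFun (congrFun h .one) .X
  have h2 := congrFun (congrFun h .X) .X
  ext b
  cases b
  · exact h1
  · simpa [comul, comulCoeff, h1] using h2

/-- The presentation of the cohomology of `T_{2,k}` in the degree `0`. -/
def torusGeneratorsZero (P : Components c 𝒢) :
    CohomologyGenerators (torusDiagram k hk) c 𝒢 0 (-k) (2 - k) fun f => f = 0 :=
  torusGenerators hk P 0 (by simp) _ _ _ strandLabels 0 (fun h => absurd rfl h)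
    (fun _ _ _ _ => rfl) (fun _ => rfl) (fun _ => by ext; simp [comul])
    (fun _ _ _ _ => bd_eq_zero _ rfl)
    (fun t α _ _ => by
      -- Modulo Δ(1) the coefficient of X ⊗ 1 can be removed, at the cost of changing those of 1 ⊗ X
      -- and X ⊗ X; the rest of X ⊗ X is removed by Δ(X). This leaves 1 ⊗ X and 1 ⊗ 1 as a basis of
      -- the cokernel.
      refine ⟨(t .one .X - t .X .one, t .one .one),
        Function.update 0 1 fun b => match b with
          | .one => t .X .one
          | .X => t .X .X - c * t .X .one, ?_, fun _ => ?_, fun h => absurd rfl h⟩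
      · rw [Function.update_of_ne (by omega)]; rfl
      · ext x y
        cases x <;> cases y <;> simp [strandLabels, comul, comulCoeff]
        ring)
    (fun j f x y => by
      cases x <;> cases y <;> simp only [strandLabels, LinearMap.coe_mk, AddHom.coe_mk, map_zero,
        Lab.deg_one, Lab.deg_X]
      · congr 2; ring
      · congr 2; ring)
    (fun _ _ _ _ => map_zero _)
    (fun f => by
      constructor
      · rintro ⟨γ, -, h, -⟩
        have h1 := congrFun (congrFun h .one) .one
        have h2 := congrFun (congrFun h .one) .X
        have h3 := congrFun (congrFun h .X) .one
        simp only [strandLabels, comul, comulCoeff, LinearMap.coe_mk, AddHom.coe_mk, mul_zero,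
          mul_one, add_zero] at h1 h2 h3
        exact Prod.ext (h2.trans h3.symm) h1
      · rintro rfl
        refine ⟨0, rfl, ?_, fun r _ _ => ?_⟩
        · ext; simp [comul]
        · exact (bd_eq_zero _ rfl).symm)

/-- The presentation of the cohomology of `T_{2,k}` in the degree `-1`. -/
def torusGeneratorsOne (P : Components c 𝒢) :
    CohomologyGenerators (torusDiagram k hk) c 𝒢 (-1) 0 0 fun _ => True :=
  torusGenerators hk P 1 (by simp) _ _ _ 0 0 (fun _ _ => rfl)
    (fun _ _ _ _ => rfl) (fun _ => rfl) (fun _ => by ext; simp [comul])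
    (fun _ _ _ _ => bd_eq_zero _ rfl)
    (fun t α h _ => ⟨0, 0, rfl, fun h => absurd h one_ne_zero, fun _ => by
      rw [eq_zero_of_comul_eq_zero h, bd_eq_zero_of_odd _ odd_one]; simp⟩)
    (fun _ _ _ _ => map_zero _) (fun _ _ _ _ => map_zero _)
    (fun f => by
      refine ⟨fun _ => trivial, fun _ => ⟨0, rfl, ?_, fun r _ _ => ?_⟩⟩
      · ext; simp [comul]
      · exact (bd_eq_zero _ rfl).symm)

/-- The presentation of the cohomology of `T_{2,k}` in the degree `-s`, where `2 ≤ s ≤ k`. -/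
def torusGeneratorsTop (P : Components c 𝒢) (htwo : ∀ r : K, 2 * r = 0 → r = 0)
    {i : ℤ} (s : ℕ) (hi : i = -(s : ℤ)) (hs2 : 2 ≤ s) (hsk : s ≤ k) :
    CohomologyGenerators (torusDiagram k hk) c 𝒢 i (-(2 * s) - k) (2 - 2 * s - k) fun f =>
      (Even s → f.2 = 0) ∧ ∃ b, f.1 = (1 + (-1) ^ s) * b ∧ (s = k → b = 0) :=
  torusGenerators hk P s hi _ _ _ 0 (topLabels s) (fun _ _ => rfl)
    (fun f r _ hr => topLabels_of_ne hr f) (fun f => topLabels_of_ne (by omega) f)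
    (fun f => by rw [topLabels_of_ne (by omega)]; ext; simp [comul])
    (fun f r h1 h2 => by
      -- Only the map out of copy s could be non-zero. It has coefficient 0 if s is even; if s is
      -- odd, the chosen generator has no 1-component, and X · X = 0.
      by_cases hr : r + 1 = s
      · rcases Nat.even_or_odd s with he | ho
        · exact bd_eq_zero_of_odd _ (by rw [← hr, Nat.even_add_one] at he; simpa using he)
        · exact bd_eq_zero _ (by simp [topLabels, Nat.not_even_iff_odd.2 ho])
      · exact bd_eq_zero _ (by rw [topLabels_of_ne hr]; rfl))
    (fun t α h1 h2 => by
      refine ⟨(α s .X, α s .one), 0, rfl, fun h => by omega, fun _ => ?_⟩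
      rw [bd_eq_zero 0 rfl, add_zero]
      ext b
      cases b
      · rcases Nat.even_or_odd s with he | ho
        · simp [topLabels, he]
        -- For odd s the cocycle condition in copy s - 1 says that twice the 1-component vanishes;
        -- `htwo` then removes it.
        · have h3 := congrFun (h2 (s - 1) (by omega) (by omega)) .X
          have h4 : Even (s - 1) := by
            obtain ⟨m, rfl⟩ := ho
            exact ⟨m, by omega⟩
          rw [(bd_apply α (s - 1)).2, h4.neg_one_pow, show s - 1 + 1 = s by omega,
            one_add_one_eq_two] at h3
          simp [topLabels, Nat.not_even_iff_odd.2 ho, htwo _ h3]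
      · simp [topLabels])
    (fun _ _ _ _ => map_zero _)
    (fun j f r b => by
      by_cases hr : r = s
      · subst hr
        cases b
        · by_cases he : Even r
          · simp only [topLabels, LinearMap.coe_mk, AddHom.coe_mk, he, if_true, Lab.deg_one]
            congr 2; ring
          · simp [topLabels, he]
        · simp only [topLabels, LinearMap.coe_mk, AddHom.coe_mk, if_true, Lab.deg_X]
          congr 2; ring
      · rw [topLabels_of_ne hr, topLabels_of_ne hr]
        exact map_zero _)
    (fun f => by
      have hone : topLabels s f s .one = if Even s then f.2 else 0 := by simp [topLabels]
      have hX : topLabels s f s .X = f.1 := by simp [topLabels]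
      constructor
      · rintro ⟨γ, h1, -, h2⟩
        have h3 := h2 s (by omega) hsk
        refine ⟨fun he => ?_, γ (s + 1) .one, ?_, ?_⟩
        · rw [if_pos he] at hone
          rw [← hone, h3, (bd_apply γ s).1]
        · rw [← hX, h3, (bd_apply γ s).2]
        · rintro rfl
          rw [h1]; rfl
      · rintro ⟨h1, b, h2, h3⟩
        -- Only the 1-component of copy s + 1 maps to copy s, so its value at X is irrelevant. For s
        -- = k there is no such copy, and b = 0.
        refine ⟨Function.update 0 (s + 1) fun _ => b, ?_, ?_, fun r hr1 hr2 => ?_⟩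
        · by_cases hs : s = k
          · subst hs
            rw [Function.update_self, h3 rfl]; rfl
          · rw [Function.update_of_ne (by omega)]; rfl
        · rw [Function.update_of_ne (by omega)]
          ext; simp [comul]
        · by_cases hr : r = s
          · subst hr
            ext a
            cases a
            · rw [hone, (bd_apply _ r).1]
              split_ifs with he
              · exact h1 he
              · rfl
            · rw [hX, (bd_apply _ r).2, Function.update_self, h2]
          · rw [topLabels_of_ne hr, bd_eq_zero]
            rw [Function.update_of_ne (by omega)]; rfl)

end TorusGenerators

/-! ### The ground rings -/

/-- The homogeneous components of `ℤ[c]`. -/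
def componentsR : Components (Polynomial.X : R) RGr where
  pr j := if 0 ≤ j ∧ j % 2 = 0 then
    ((Polynomial.monomial (j / 2).toNat).comp (Polynomial.lcoeff ℤ (j / 2).toNat)).toAddMonoidHom
    else 0
  pr_mem j p := by
    split_ifs with h
    · intro m hm
      have : (Polynomial.monomial (j / 2).toNat (p.coeff (j / 2).toNat)).coeff m ≠ 0 := hm
      rw [Polynomial.coeff_monomial] at this
      have h2 : (j / 2).toNat = m := by
        by_contra h2
        exact this (if_neg h2)
      omega
    · exact zero_mem _
  pr_eq j p hp := by
    ext m
    have hm : p.coeff m ≠ 0 → 2 * (m : ℤ) = j := hp m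
    split_ifs with h
    · change (Polynomial.monomial (j / 2).toNat (p.coeff (j / 2).toNat)).coeff m = _
      rw [Polynomial.coeff_monomial]
      split_ifs with h2
      · rw [h2]
      · by_contra h3
        have := hm (Ne.symm h3)
        omega
    · by_contra h3
      have := hm (Ne.symm h3)
      omega
  pr_mul j p := by
    by_cases h : 0 ≤ j ∧ j % 2 = 0
    · rw [if_pos h, if_pos (by omega)]
      change Polynomial.monomial ((j + 2) / 2).toNat
        ((Polynomial.X * p).coeff ((j + 2) / 2).toNat) =
        Polynomial.X * Polynomial.monomial (j / 2).toNat (p.coeff (j / 2).toNat)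
      rw [show ((j + 2) / 2).toNat = (j / 2).toNat + 1 by omega, Polynomial.coeff_X_mul,
        Polynomial.X_mul_monomial]
    · rw [if_neg h]
      by_cases h2 : j = -2
      · subst h2
        change Polynomial.monomial 0 ((Polynomial.X * p).coeff 0) = Polynomial.X * 0
        simp
      · rw [if_neg (by omega)]
        simp

/-- The homogeneous components of `ℤ`. -/
def componentsInt : Components (0 : ℤ) ZGrading where
  pr j := if j = 0 then AddMonoidHom.id ℤ else 0
  pr_mem j r := by
    split_ifs with h
    · exact fun _ => h
    · exact zero_mem _
  pr_eq j r hr := by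
    split_ifs with h
    · rfl
    · by_contra h2
      exact h (hr fun h3 => h2 (by simp [h3]))
  pr_mul j r := by simp

theorem two_mul_R (p : R) (h : 2 * p = 0) : p = 0 := by simpa using h

theorem two_mul_int (r : ℤ) (h : 2 * r = 0) : r = 0 := by omega

theorem map_pairGr_id (d₁ d₂ n₁ n₂ : ℤ) (h₁ : n₁ = -d₁) (h₂ : n₂ = -d₂) (j : ℤ) :
    (pairGr RGr d₁ d₂ j).map (LinearMap.id : R × R →ₗ[R] R × R).toAddMonoidHom =
      dsum (shift RGr n₁) (shift RGr n₂) j := by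
  subst h₁ h₂
  exact AddSubgroup.map_id _

theorem map_pairGr_fst (d₁ d₂ n₁ : ℤ) (h₁ : n₁ = -d₁) (j : ℤ) :
    (pairGr RGr d₁ d₂ j).map (LinearMap.fst R R R).toAddMonoidHom = shift RGr n₁ j := by
  subst h₁
  ext p
  constructor
  · rintro ⟨f, hf, rfl⟩
    exact hf.1
  · intro hp
    exact ⟨(p, 0), ⟨hp, zero_mem _⟩, rfl⟩

/-- The projection `R ⊕ R → R/2R ⊕ R`. -/
def modTwo : R × R →ₗ[R] RmodTwo × R :=
  LinearMap.prodMap (Submodule.mkQ (Ideal.span {(2 : R)})) LinearMap.id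

theorem modTwo_surjective : Function.Surjective modTwo := by
  rintro ⟨x, p⟩
  obtain ⟨q, rfl⟩ := Submodule.mkQ_surjective _ x
  exact ⟨(q, p), rfl⟩

theorem modTwo_eq_zero {f : R × R} : modTwo f = 0 ↔ f.2 = 0 ∧ ∃ b, f.1 = 2 * b := by
  rw [Prod.ext_iff, and_comm]
  refine and_congr Iff.rfl ((Submodule.Quotient.mk_eq_zero _).trans ?_)
  exact Ideal.mem_span_singleton

theorem map_pairGr_modTwo (d₁ d₂ n₁ n₂ : ℤ) (h₁ : n₁ = -d₁) (h₂ : n₂ = -d₂) (j : ℤ) :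
    (pairGr RGr d₁ d₂ j).map modTwo.toAddMonoidHom =
      dsum (shift RmodTwoGr n₁) (shift RGr n₂) j := by
  subst h₁ h₂
  ext ⟨x, p⟩
  constructor
  · rintro ⟨f, hf, h⟩
    obtain ⟨rfl, rfl⟩ := Prod.mk.inj h
    exact ⟨⟨f.1, hf.1, rfl⟩, hf.2⟩
  · rintro ⟨⟨q, hq, rfl⟩, hp⟩
    exact ⟨(q, p), ⟨hq, hp⟩, rfl⟩

theorem mem_pairGr_int {d₁ d₂ j : ℤ} {f : ℤ × ℤ} :
    f ∈ pairGr ZGrading d₁ d₂ j ↔ (f.1 ≠ 0 → j = d₁) ∧ (f.2 ≠ 0 → j = d₂) := by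
  rw [← sub_eq_zero (a := j) (b := d₁), ← sub_eq_zero (a := j) (b := d₂)]
  exact Iff.rfl

/-! ### Single bidegrees over the integers. -/

section Int

variable {D : PlaneDiagram} {i d₁ d₂ : ℤ} {ρ : ℤ × ℤ → Prop}
  (G : CohomologyGenerators D (0 : ℤ) ZGrading i d₁ d₂ ρ)

include G

theorem CohomologyGenerators.hDeg_fst {j : ℤ} (hj : j = d₁) (h : d₁ ≠ d₂)
    (hρ : ∀ a, ρ (a, 0) ↔ a = 0) : Nonempty (D.HDeg (0 : ℤ) ZGrading i j ≃+ ℤ) := by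
  subst hj
  refine G.nonempty_hDeg_equiv (AddMonoidHom.fst ℤ ℤ) (fun m => ⟨(m, 0), ?_, rfl⟩) ?_
  · simp [mem_pairGr_int]
  · rintro ⟨a, b⟩ hf
    obtain rfl : b = 0 := by
      by_contra hb
      exact h ((mem_pairGr_int.1 hf).2 hb)
    exact (hρ a).symm

theorem CohomologyGenerators.hDeg_fst_two {j : ℤ} (hj : j = d₁) (h : d₁ ≠ d₂)
    (hρ : ∀ a, ρ (a, 0) ↔ ∃ b, a = 2 * b) :
    Nonempty (D.HDeg (0 : ℤ) ZGrading i j ≃+ ZMod 2) := by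
  subst hj
  refine G.nonempty_hDeg_equiv ((Int.castAddHom (ZMod 2)).comp (AddMonoidHom.fst ℤ ℤ))
    (fun m => ?_) ?_
  · obtain ⟨a, rfl⟩ := ZMod.intCast_surjective m
    exact ⟨(a, 0), by simp [mem_pairGr_int], rfl⟩
  · rintro ⟨a, b⟩ hf
    obtain rfl : b = 0 := by
      by_contra hb
      exact h ((mem_pairGr_int.1 hf).2 hb)
    exact (ZMod.intCast_zmod_eq_zero_iff_dvd a 2).trans (hρ a).symm

theorem CohomologyGenerators.hDeg_snd {j : ℤ} (hj : j = d₂) (h : d₁ ≠ d₂)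
    (hρ : ∀ a, ρ (0, a) ↔ a = 0) : Nonempty (D.HDeg (0 : ℤ) ZGrading i j ≃+ ℤ) := by
  subst hj
  refine G.nonempty_hDeg_equiv (AddMonoidHom.snd ℤ ℤ) (fun m => ⟨(0, m), ?_, rfl⟩) ?_
  · simp [mem_pairGr_int]
  · rintro ⟨a, b⟩ hf
    obtain rfl : a = 0 := by
      by_contra ha
      exact h ((mem_pairGr_int.1 hf).1 ha).symm
    exact (hρ b).symm

theorem CohomologyGenerators.subsingleton_hDeg_int {j : ℤ}
    (h : ∀ f : ℤ × ℤ, (j ≠ d₁ → f.1 = 0) → (j ≠ d₂ → f.2 = 0) → ρ f) :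
    Subsingleton (D.HDeg (0 : ℤ) ZGrading i j) :=
  G.subsingleton_hDeg fun f hf => h f
    (fun h1 => by by_contra h2; exact h1 ((mem_pairGr_int.1 hf).1 h2))
    (fun h1 => by by_contra h2; exact h1 ((mem_pairGr_int.1 hf).2 h2))

end Int

/-- The cohomology of `T_{2,k}` over `ℤ[c]`. -/
theorem cohomology_torus (k : ℕ) (hk : 0 < k) :
    (torusDiagram k hk).IsGradedComplex (Polynomial.X : R) RGr ∧
      (∀ i : ℤ, i < -k ∨ 0 < i →
        Subsingleton ((torusDiagram k hk).H (Polynomial.X : R) i)) ∧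
      GradedIso R ((torusDiagram k hk).HGr Polynomial.X RGr 0)
        (dsum (shift RGr k) (shift RGr (k - 2))) ∧
      Subsingleton ((torusDiagram k hk).H (Polynomial.X : R) (-1)) ∧
      (∀ j : ℤ, 1 ≤ j → 2 * j ≤ k - 1 →
        GradedIso R ((torusDiagram k hk).HGr Polynomial.X RGr (-2 * j))
          (dsum (shift RmodTwoGr (4 * j + k)) (shift RGr (4 * j - 2 + k)))) ∧
      (∀ j : ℤ, 1 ≤ j → 2 * j ≤ k - 1 →
        GradedIso R ((torusDiagram k hk).HGr Polynomial.X RGr (-2 * j - 1))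
          (shift RGr (4 * j + 2 + k))) ∧
      (Even k →
        GradedIso R ((torusDiagram k hk).HGr Polynomial.X RGr (-k))
          (dsum (shift RGr (3 * k)) (shift RGr (3 * k - 2)))) := by
  refine ⟨isGradedComplex hk componentsR,
    fun i hi => (outerGenerators (𝒢 := RGr) hk hi).subsingleton fun _ => trivial,
    (torusGeneratorsZero hk componentsR).gradedIso LinearMap.id Function.surjective_id
      (fun f => Iff.rfl) _ (map_pairGr_id _ _ _ _ (by ring) (by ring)),
    (torusGeneratorsOne hk componentsR).subsingleton fun _ => trivial,
    fun j hj1 hj2 => ?_, fun j hj1 hj2 => ?_, fun he => ?_⟩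
  · lift j to ℕ using by omega
    refine (torusGeneratorsTop hk componentsR two_mul_R (2 * j) (by push_cast; ring) (by omega)
      (by omega)).gradedIso modTwo modTwo_surjective (fun f => ?_) _
      (map_pairGr_modTwo _ _ _ _ (by push_cast; ring) (by push_cast; ring))
    rw [modTwo_eq_zero]
    -- Below the extreme degree there is a copy of A mapping in by 2X, so the relation on the
    -- X-component is divisibility by 2.
    have h1 : 2 * j ≠ k := by omega
    simp [h1, one_add_one_eq_two]
  · lift j to ℕ using by omega
    refine (torusGeneratorsTop hk componentsR two_mul_R (2 * j + 1) (by push_cast; ring) (by omega)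
      (by omega)).gradedIso (LinearMap.fst R R R) LinearMap.fst_surjective (fun f => ?_) _
      (map_pairGr_fst _ _ _ (by push_cast; ring))
    have h1 : ¬ Even (2 * j + 1) := by simp
    have h2 : (1 : R) + (-1) ^ (2 * j + 1) = 0 := by simp [pow_succ]
    simp only [h1, h2, LinearMap.fst_apply, zero_mul, false_imp_iff, true_and]
    exact ⟨fun h => ⟨0, h, fun _ => rfl⟩, fun ⟨_, h, _⟩ => h⟩
  · have h2 : 2 ≤ k := by obtain ⟨m, rfl⟩ := he; omega
    refine (torusGeneratorsTop hk componentsR two_mul_R k rfl h2 le_rfl).gradedIso LinearMap.id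
      Function.surjective_id (fun f => ?_) _ (map_pairGr_id _ _ _ _ (by ring) (by ring))
    simp [he, Prod.ext_iff, and_comm]

/-- The cohomology of `T_{2,k}` over `ℤ` for `c = 0`. -/
theorem cohomology_torus_int (k : ℕ) (hk : 0 < k) :
    (torusDiagram k hk).IsGradedComplex (0 : ℤ) ZGrading ∧
      Nonempty ((torusDiagram k hk).HDeg (0 : ℤ) ZGrading 0 (-k) ≃+ ℤ) ∧
      Nonempty ((torusDiagram k hk).HDeg (0 : ℤ) ZGrading 0 (2 - k) ≃+ ℤ) ∧
      (∀ j : ℤ, 1 ≤ j → 2 * j ≤ k - 1 →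
        Nonempty ((torusDiagram k hk).HDeg (0 : ℤ) ZGrading (-2 * j - 1) (-4 * j - 2 - k) ≃+ ℤ) ∧
        Nonempty ((torusDiagram k hk).HDeg (0 : ℤ) ZGrading (-2 * j) (-4 * j - k) ≃+ ZMod 2) ∧
        Nonempty ((torusDiagram k hk).HDeg (0 : ℤ) ZGrading (-2 * j) (-4 * j + 2 - k) ≃+ ℤ)) ∧
      (Even k →
        Nonempty ((torusDiagram k hk).HDeg (0 : ℤ) ZGrading (-k) (-3 * k) ≃+ ℤ) ∧
        Nonempty ((torusDiagram k hk).HDeg (0 : ℤ) ZGrading (-k) (2 - 3 * k) ≃+ ℤ)) ∧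
      (∀ i j : ℤ,
        ¬ (i = 0 ∧ (j = -k ∨ j = 2 - k)) →
        ¬ (∃ m : ℤ, 1 ≤ m ∧ 2 * m ≤ k - 1 ∧
          ((i = -2 * m - 1 ∧ j = -4 * m - 2 - k) ∨
            (i = -2 * m ∧ (j = -4 * m - k ∨ j = -4 * m + 2 - k)))) →
        ¬ (Even k ∧ i = -k ∧ (j = -3 * k ∨ j = 2 - 3 * k)) →
        Subsingleton ((torusDiagram k hk).HDeg (0 : ℤ) ZGrading i j)) := by
  refine ⟨isGradedComplex hk componentsInt,
    (torusGeneratorsZero hk componentsInt).hDeg_fst rfl (by omega) (by simp),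
    (torusGeneratorsZero hk componentsInt).hDeg_snd rfl (by omega) (by simp),
    fun j hj1 hj2 => ⟨?_, ?_, ?_⟩, fun he => ⟨?_, ?_⟩, fun i j h1 h2 h3 => ?_⟩
  · lift j to ℕ using by omega
    refine (torusGeneratorsTop hk componentsInt two_mul_int (2 * j + 1) (by push_cast; ring)
      (by omega) (by omega)).hDeg_fst (by push_cast; ring) (by omega) fun a => ?_
    simp only [implies_true, true_and]
    exact ⟨fun ⟨b, h, _⟩ => by simpa [pow_succ] using h, fun h => ⟨0, by simpa using h, fun _ => rfl⟩⟩
  · lift j to ℕ using by omega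
    refine (torusGeneratorsTop hk componentsInt two_mul_int (2 * j) (by push_cast; ring)
      (by omega) (by omega)).hDeg_fst_two (by push_cast; ring) (by omega) fun a => ?_
    have h1 : 2 * j ≠ k := by omega
    simp [h1]
  · lift j to ℕ using by omega
    refine (torusGeneratorsTop hk componentsInt two_mul_int (2 * j) (by push_cast; ring)
      (by omega) (by omega)).hDeg_snd (by push_cast; ring) (by omega) fun a => ?_
    have h1 : 2 * j ≠ k := by omega
    simp only [even_two, Even.mul_right, forall_const, h1, false_imp_iff, and_true, and_iff_left_iff_imp]
    exact fun _ => ⟨0, by simp⟩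
  · have h2 : 2 ≤ k := by obtain ⟨m, rfl⟩ := he; omega
    refine (torusGeneratorsTop hk componentsInt two_mul_int k rfl h2 le_rfl).hDeg_fst
      (by ring) (by omega) fun a => ?_
    simp
  · have h2 : 2 ≤ k := by obtain ⟨m, rfl⟩ := he; omega
    refine (torusGeneratorsTop hk componentsInt two_mul_int k rfl h2 le_rfl).hDeg_snd
      (by ring) (by omega) fun a => ?_
    simp [he]
  · by_cases hi : i < -k ∨ 0 < i
    · exact (outerGenerators hk hi).subsingleton_hDeg fun _ _ => trivial
    push Not at hi
    obtain ⟨s, rfl⟩ : ∃ s : ℕ, i = -(s : ℤ) := ⟨(-i).toNat, by omega⟩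
    obtain rfl | rfl | hs : s = 0 ∨ s = 1 ∨ 2 ≤ s := by omega
    · have : j ≠ -k ∧ j ≠ 2 - k := by
        refine ⟨fun h => h1 ⟨by simp, Or.inl h⟩, fun h => h1 ⟨by simp, Or.inr h⟩⟩
      exact (torusGeneratorsZero hk componentsInt).subsingleton_hDeg_int
        fun f hf1 hf2 => Prod.ext (hf1 this.1) (hf2 this.2)
    · exact (torusGeneratorsOne hk componentsInt).subsingleton_hDeg fun _ _ => trivial
    · refine (torusGeneratorsTop hk componentsInt two_mul_int s rfl hs
        (by omega)).subsingleton_hDeg_int fun f hf1 hf2 => ⟨fun he => hf2 ?_, 0, ?_, fun _ => rfl⟩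
      -- For even s the second generator lives only in degree 2 - 2s - k, which is in the excluded
      -- list, under the case s = k or s < k.
      · rintro rfl
        obtain ⟨m, rfl⟩ := he
        by_cases hm : m + m = k
        · exact h3 ⟨⟨m, hm.symm⟩, by omega, Or.inr (by omega)⟩
        · exact h2 ⟨m, by omega, by omega, Or.inr ⟨by omega, Or.inr (by omega)⟩⟩
      · rw [mul_zero]
        refine hf1 ?_
        rintro rfl
        -- The degree of the first generator is excluded for every s with 2 ≤ s ≤ k: as the extreme
        -- degree if s = k is even, and otherwise through m with s = 2m or s = 2m + 1.
        rcases Nat.even_or_odd s with ⟨m, rfl⟩ | ⟨m, rfl⟩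
        · by_cases hm : m + m = k
          · exact h3 ⟨⟨m, hm.symm⟩, by omega, Or.inl (by omega)⟩
          · exact h2 ⟨m, by omega, by omega, Or.inr ⟨by omega, Or.inl (by omega)⟩⟩
        · exact h2 ⟨m, by omega, by omega, Or.inl ⟨by omega, by omega⟩⟩

end Khovanov

end

theorem mainTheorem7 (k : ℕ) (hk : 0 < k) :
    -- the cohomology over `R = ℤ[c]`
    ((torusDiagram k hk).IsGradedComplex (Polynomial.X : R) RGr ∧
      (∀ i : ℤ, i < -k ∨ 0 < i →
        Subsingleton ((torusDiagram k hk).H (Polynomial.X : R) i)) ∧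
      GradedIso R ((torusDiagram k hk).HGr Polynomial.X RGr 0)
        (dsum (shift RGr k) (shift RGr (k - 2))) ∧
      Subsingleton ((torusDiagram k hk).H (Polynomial.X : R) (-1)) ∧
      (∀ j : ℤ, 1 ≤ j → 2 * j ≤ k - 1 →
        GradedIso R ((torusDiagram k hk).HGr Polynomial.X RGr (-2 * j))
          (dsum (shift RmodTwoGr (4 * j + k)) (shift RGr (4 * j - 2 + k)))) ∧
      (∀ j : ℤ, 1 ≤ j → 2 * j ≤ k - 1 →
        GradedIso R ((torusDiagram k hk).HGr Polynomial.X RGr (-2 * j - 1))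
          (shift RGr (4 * j + 2 + k))) ∧
      (Even k →
        GradedIso R ((torusDiagram k hk).HGr Polynomial.X RGr (-k))
          (dsum (shift RGr (3 * k)) (shift RGr (3 * k - 2))))) ∧
    -- the cohomology over `ℤ`, with `c = 0`
    (1 < k →
      (torusDiagram k hk).IsGradedComplex (0 : ℤ) ZGrading ∧
      Nonempty ((torusDiagram k hk).HDeg (0 : ℤ) ZGrading 0 (-k) ≃+ ℤ) ∧
      Nonempty ((torusDiagram k hk).HDeg (0 : ℤ) ZGrading 0 (2 - k) ≃+ ℤ) ∧
      (∀ j : ℤ, 1 ≤ j → 2 * j ≤ k - 1 →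
        Nonempty ((torusDiagram k hk).HDeg (0 : ℤ) ZGrading (-2 * j - 1) (-4 * j - 2 - k) ≃+ ℤ) ∧
        Nonempty ((torusDiagram k hk).HDeg (0 : ℤ) ZGrading (-2 * j) (-4 * j - k) ≃+ ZMod 2) ∧
        Nonempty ((torusDiagram k hk).HDeg (0 : ℤ) ZGrading (-2 * j) (-4 * j + 2 - k) ≃+ ℤ)) ∧
      (Even k →
        Nonempty ((torusDiagram k hk).HDeg (0 : ℤ) ZGrading (-k) (-3 * k) ≃+ ℤ) ∧
        Nonempty ((torusDiagram k hk).HDeg (0 : ℤ) ZGrading (-k) (2 - 3 * k) ≃+ ℤ)) ∧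
      (∀ i j : ℤ,
        ¬ (i = 0 ∧ (j = -k ∨ j = 2 - k)) →
        ¬ (∃ m : ℤ, 1 ≤ m ∧ 2 * m ≤ k - 1 ∧
          ((i = -2 * m - 1 ∧ j = -4 * m - 2 - k) ∨
            (i = -2 * m ∧ (j = -4 * m - k ∨ j = -4 * m + 2 - k)))) →
        ¬ (Even k ∧ i = -k ∧ (j = -3 * k ∨ j = 2 - 3 * k)) →
        Subsingleton ((torusDiagram k hk).HDeg (0 : ℤ) ZGrading i j))) := by
  exact ⟨cohomology_torus k hk, fun _ => cohomology_torus_int k hk⟩
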